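/- Let $L\ge 1$, $T\ge 0$, let $n\le m$, and let $x_1,\dots,x_n\in\mathbb R^{d_x}$ be inputs with $\|x_i\|=1$ and $\Phi_1,\dots,\Phi_n\in\mathbb R^{d_y\times d_x}$ (the labels are $y_i=\Phi_i x_i$). Draw independent Gaussian matrices $W_{1,k},\Psi_k\in\mathbb R^{m\times m}$ $(1\le k\le L)$, $C\in\mathbb R^{m\times d_x}$, $B\in\mathbb R^{d_y\times m}$ with independent centred entries of variance $2/m$, $2/m$, $2/d_x$, $2/d_y$ respectively. Put $z_0^i=[Cx_i]^+$, $z_k^i=[\Psi_k z_{k-1}^i]^+$ (entrywise positive part) and let $D_k^i$ $(0\le k\le L)$ be the diagonal $0/1$ matrix marking the positive entries of $z_k^i$. Let $W_t=(W_{t,1},\dots,W_{t,L})$, $t=1,2,\dots$, be the iterates of gradient descent with a constant learning rate $\eta$, started at $W_1$ (with $B,C,\Psi$ fixed), for the loss $$\ell(W)=\tfrac12\sum_{i=1}^n\big\|(BD_L^iW_L\cdots D_1^iW_1D_0^iC-\Phi_i)x_i\big\|^2 .$$ Set $\tau=\max_{1\le t\le T}\max_{1\le k\le L}\|W_{t,k}-W_{1,k}\|_2$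 and $$G_{t,k}^i=D_k^iW_{t,k}\cdots D_1^iW_{t,1}D_0^iC\quad(0\le k\le L),\qquad F_{t,k}^i=BD_L^iW_{t,L}\cdots D_k^iW_{t,k}D_{k-1}^i\quad(1\le k\le L+1),$$ where $G^i_{t,0}=D^i_0C$ and $F^i_{t,L+1}=BD^i_L$. **Theorem.** Let $\theta\in(0,1/2)$. With probability at least $$1-3L^2\sqrt m\,\exp\!\Big(-\frac{\theta m}{4L}+6\sqrt m+3\max\{d_x,d_y\}\Big)$$ over the initialization, the following implication holds: if $$L\tau\cdot 3\sqrt{12L}\,e^{2\theta}\theta^{-1/2}\le \tfrac19 ,$$ then for all $1\le t\le T$, all $1\le i\le n$ and all $k$ (with $0\le k\le L$ for $G$, $1\le k\le L+1$ for $F$), $$\big\|[G_{t,k}^i]^\top G_{t,k}^i\big\|_2\le\frac{27m}{4d_x},\quad \lambda_{\min}\big([G_{t,k}^i]^\top G_{t,k}^i\big)\ge\frac{m}{12d_x},\quad \big\|F_{t,k}^i[F_{t,k}^i]^\top\big\|_2\le\frac{27m}{4d_y},\quad \lambda_{\min}\big(F_{t,k}^i[F_{t,k}^i]^\top\big)\ge\frac{m}{12d_y}.$$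 In particular, all eigenvalues of $[G_{t,k}^i]^\top G_{t,k}^i$ lie in $[\frac{m}{12d_x},\frac{27m}{4d_x}]$ and all eigenvalues of $F_{t,k}^i[F_{t,k}^i]^\top$ lie in $[\frac{m}{12d_y},\frac{27m}{4d_y}]$. -/

import Mathlib

open MeasureTheory ProbabilityTheory Matrix
open scoped NNReal ENNReal

namespace GReLU

/-- Spectral norm of a real matrix: operator norm between Euclidean spaces. -/
noncomputable def specNorm {p q : ℕ} (A : Matrix (Fin p) (Fin q) ℝ) : ℝ≥0 :=
  ‖(Matrix.toEuclideanLin A).toContinuousLinearMap‖₊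

/-- Entrywise positive part `[v]^+`. -/
def relu {m : ℕ} (v : Fin m → ℝ) : Fin m → ℝ := fun j => max 0 (v j)

/-- `diag([v]_+)`: the diagonal 0/1 matrix marking the strictly positive entries of `v`. -/
noncomputable def gate {m : ℕ} (v : Fin m → ℝ) : Matrix (Fin m) (Fin m) ℝ :=
  Matrix.diagonal fun j => if 0 < v j then 1 else 0

section Network

variable {L m dx dy n : ℕ}

/-- Layers `1, …, L` are indexed by `Fin L`: the entry `k : Fin L` is layer `k + 1`.
`Layers L m` is the type of the trained weights `W_{[L]}` and of the gating weights `Ψ_{[L]}`. -/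
abbrev Layers (L m : ℕ) : Type := Fin L → Matrix (Fin m) (Fin m) ℝ

/-- Gating features: `z_0 = [C x]^+` and `z_k = [Ψ_k z_{k-1}]^+` for `k = 1, …, L`. -/
def feature (Ψ : Layers L m) (C : Matrix (Fin m) (Fin dx) ℝ) (x : Fin dx → ℝ) :
    Fin (L + 1) → (Fin m → ℝ) :=
  Fin.induction (relu (C *ᵥ x)) fun k z => relu (Ψ k *ᵥ z)

/-- Activation matrices `D_k = diag([z_k]_+)`, `k = 0, …, L`. -/
noncomputable def act (Ψ : Layers L m) (C : Matrix (Fin m) (Fin dx) ℝ) (x : Fin dx → ℝ)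
    (k : Fin (L + 1)) : Matrix (Fin m) (Fin m) ℝ :=
  gate (feature Ψ C x k)

/-- `G_k = D_k W_k ⋯ D_1 W_1 D_0 C`, `k = 0, …, L` (so `G_0 = D_0 C`). -/
def subG (D : Fin (L + 1) → Matrix (Fin m) (Fin m) ℝ) (C : Matrix (Fin m) (Fin dx) ℝ)
    (W : Layers L m) : Fin (L + 1) → Matrix (Fin m) (Fin dx) ℝ :=
  Fin.induction (D 0 * C) fun k G => D k.succ * W k * G

/-- `subF D B W j` is `F_{j+1} = B D_L W_L ⋯ D_{j+1} W_{j+1} D_j`, `j = 0, …, L`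
(so the index `Fin.last L` gives `F_{L+1} = B D_L`). -/
def subF (D : Fin (L + 1) → Matrix (Fin m) (Fin m) ℝ) (B : Matrix (Fin dy) (Fin m) ℝ)
    (W : Layers L m) : Fin (L + 1) → Matrix (Fin dy) (Fin m) ℝ :=
  Fin.reverseInduction (B * D (Fin.last L)) fun k F => F * W k * D k.castSucc

/-- The network on one example: `B D_L W_L ⋯ D_1 W_1 D_0 C`. -/
def net (D : Fin (L + 1) → Matrix (Fin m) (Fin m) ℝ) (C : Matrix (Fin m) (Fin dx) ℝ)
    (B : Matrix (Fin dy) (Fin m) ℝ) (W : Layers L m) : Matrix (Fin dy) (Fin dx) ℝ :=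
  B * subG D C W (Fin.last L)

/-- Square loss `(1/2) ∑ i, ‖(W^i - Φ_i) x_i‖²` as a function of the trained layers `W`. -/
noncomputable def loss (x : Fin n → Fin dx → ℝ) (Φ : Fin n → Matrix (Fin dy) (Fin dx) ℝ)
    (Ψ : Layers L m) (C : Matrix (Fin m) (Fin dx) ℝ) (B : Matrix (Fin dy) (Fin m) ℝ)
    (W : Layers L m) : ℝ :=
  (1 / 2) * ∑ i, ∑ a, (((net (act Ψ C (x i)) C B W - Φ i) *ᵥ x i) a) ^ 2

/-- Gradient of `f` with respect to layer `k` at `W`: the matrix of partial derivatives. -/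
noncomputable def gradLayer (f : Layers L m → ℝ) (W : Layers L m) (k : Fin L) :
    Matrix (Fin m) (Fin m) ℝ :=
  Matrix.of fun a b =>
    deriv (fun s : ℝ => f (Function.update W k (W k + s • Matrix.single a b (1 : ℝ)))) 0

/-- One step of gradient descent with learning rate `η` on all layers. -/
noncomputable def gdStep (η : ℝ) (f : Layers L m → ℝ) (W : Layers L m) : Layers L m :=
  fun k => W k - η • gradLayer f W k

/-- Initial values `(W_1, Ψ, C, B)`. -/
abbrev Init (L m dx dy : ℕ) : Type :=
  Layers L m × Layers L m × Matrix (Fin m) (Fin dx) ℝ × Matrix (Fin dy) (Fin m) ℝ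

namespace Init

/-- Trained layers at initialization (time `t = 1`). -/
def W₁ (ω : Init L m dx dy) : Layers L m := ω.1
/-- Fixed gating layers. -/
def Ψ (ω : Init L m dx dy) : Layers L m := ω.2.1
/-- Fixed input layer. -/
def C (ω : Init L m dx dy) : Matrix (Fin m) (Fin dx) ℝ := ω.2.2.1
/-- Fixed output layer. -/
def B (ω : Init L m dx dy) : Matrix (Fin dy) (Fin m) ℝ := ω.2.2.2

end Init

/-- Matrices carry the product `σ`-algebra of their entries. -/
instance instMeasurableSpaceMatrix (p q : ℕ) : MeasurableSpace (Matrix (Fin p) (Fin q) ℝ) :=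
  inferInstanceAs (MeasurableSpace (Fin p → Fin q → ℝ))

/-- Law of a `p × q` matrix with independent `N(0, v)` entries. -/
noncomputable def gaussMatrix (p q : ℕ) (v : ℝ≥0) : Measure (Matrix (Fin p) (Fin q) ℝ) :=
  Measure.pi fun _ : Fin p => Measure.pi fun _ : Fin q => gaussianReal 0 v

/-- Law of the initialization: all entries independent, those of `W_k` and `Ψ_k` being
`N(0, 2/m)`, those of `C` being `N(0, 2/d_x)` and those of `B` being `N(0, 2/d_y)`. -/
noncomputable def initLaw (L m dx dy : ℕ) : Measure (Init L m dx dy) :=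
  (Measure.pi fun _ : Fin L => gaussMatrix m m (2 / (m : ℝ≥0))).prod
    ((Measure.pi fun _ : Fin L => gaussMatrix m m (2 / (m : ℝ≥0))).prod
      ((gaussMatrix m dx (2 / (dx : ℝ≥0))).prod (gaussMatrix dy m (2 / (dy : ℝ≥0)))))

/-- Trained layers `W_t` at times `t = 1, 2, …`: `W_1` is the initialization, and
`W_{t+1}` is obtained from `W_t` by a gradient descent step on the loss. -/
noncomputable def weights (x : Fin n → Fin dx → ℝ) (Φ : Fin n → Matrix (Fin dy) (Fin dx) ℝ)
    (η : ℝ) (ω : Init L m dx dy) (t : ℕ) : Layers L m :=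
  (gdStep η (loss x Φ ω.Ψ ω.C ω.B))^[t - 1] ω.W₁

/-- `τ = max_{1 ≤ t ≤ T} max_k ‖W_{t,k} - W_{1,k}‖₂`. -/
noncomputable def tau (x : Fin n → Fin dx → ℝ) (Φ : Fin n → Matrix (Fin dy) (Fin dx) ℝ)
    (η : ℝ) (T : ℕ) (ω : Init L m dx dy) : ℝ≥0 :=
  (Finset.Icc 1 T).sup fun t =>
    Finset.univ.sup fun k : Fin L => specNorm (weights x Φ η ω t k - weights x Φ η ω 1 k)

/-- `G_{t,k}^i` for the example `x_i = xi`, `k = 0, …, L`. -/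
noncomputable def matG (ω : Init L m dx dy) (xi : Fin dx → ℝ) (Wt : Layers L m)
    (k : Fin (L + 1)) : Matrix (Fin m) (Fin dx) ℝ :=
  subG (act ω.Ψ ω.C xi) ω.C Wt k

/-- `F_{t,k+1}^i` for the example `x_i = xi`, `k = 0, …, L`. -/
noncomputable def matF (ω : Init L m dx dy) (xi : Fin dx → ℝ) (Wt : Layers L m)
    (k : Fin (L + 1)) : Matrix (Fin dy) (Fin m) ℝ :=
  subF (act ω.Ψ ω.C xi) ω.B Wt k

end Network

/-- `‖A‖₂ ≤ hi`, and every eigenvalue of `A` is at least `lo` and at most `hi`. -/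
def SpectrumWithin {d : ℕ} (A : Matrix (Fin d) (Fin d) ℝ) (lo hi : ℝ) : Prop :=
  (specNorm A : ℝ) ≤ hi ∧
    ∀ ev : ℝ, Module.End.HasEigenvalue (Matrix.toLin' A) ev → lo ≤ ev ∧ ev ≤ hi

end GReLU

/-! The gates depend only on `Ψ` and `C`, and the initial trained layers are independent of them.
For one input, the matrices at initialization are therefore products of Gaussian matrices and random
coordinate projections. Gradient descent enters only through `τ`: the conclusion holds for all
weights within `τ` of the initial ones.

Uniform gates. For `z ≠ 0`, flipping signs of rows of a Gaussian matrix `A` shifts the pattern of `A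
z` at will, yet changes neither the law of `A` nor `‖S A u‖` for a fixed pattern `S`. So
(`lintegral_pat_mulVec`, `lintegral_onAlive_featPat_le`) the gates may be treated as independent
fair coins while no feature vanishes, which fails with probability at most `(L+1) 2^(-m)`.

One direction. A random gated layer keeps the squared length at its mean, up to a factor in the
expectation of a test function (`StepBound`). Iterating over at most `L + 1` layers and applying
Markov's inequality gives both tails: powers serve for the upper tail, clamped inverse powers for
the lower one. The lower tail needs the clamp because a layer annihilates a vector with positive
probability.

All directions. For `G` and `Fᵀ` a `1/9`-net of at most `19^d` points suffices
(`exists_initLaw_frame_le`). The intermediate products act on `ℝ^m`, where a full net is too large.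
The coordinates are cut into about `2L/θ` blocks, each block gets its own net, and Cauchy–Schwarz
glues the blocks together (`initLaw_subM_not_opBound_le`). This is the source of the factor `√L
θ^(-1/2)` in the smallness hypothesis.

Perturbation. Telescoping writes the change of `G` or `F` as a sum of (initial partial
product)·(weight change)·(new `G` or `F`). Taking the maximum over layers closes this into a
relative error `δ/(1-δ)` with `δ ≤ 1/36` (`subG_near`, `subF_near`).

If the exponent in the probability is nonnegative, the bound is trivial. Otherwise `√m > 24 L/θ`,
and this absorbs all remaining constants. -/

namespace GReLU

/-! ### Coin patterns, Gaussian matrices, and the Laplace transform of a gated layer. -/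

/-- Squared Euclidean length. -/
def sqNorm {d : ℕ} (v : Fin d → ℝ) : ℝ := ∑ j, v j ^ 2

lemma sqNorm_nonneg {d : ℕ} (v : Fin d → ℝ) : 0 ≤ sqNorm v :=
  Finset.sum_nonneg fun _ _ => sq_nonneg _

@[simp] lemma sqNorm_zero {d : ℕ} : sqNorm (0 : Fin d → ℝ) = 0 := by simp [sqNorm]

lemma sqNorm_eq_zero {d : ℕ} {v : Fin d → ℝ} : sqNorm v = 0 ↔ v = 0 := by
  rw [sqNorm, Finset.sum_eq_zero_iff_of_nonneg fun _ _ => sq_nonneg _]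
  simp [funext_iff]

lemma continuous_sqNorm {d : ℕ} : Continuous (sqNorm : (Fin d → ℝ) → ℝ) := by
  unfold sqNorm; fun_prop

instance (p q : ℕ) (v : ℝ≥0) : IsProbabilityMeasure (gaussMatrix p q v) := by
  unfold gaussMatrix
  exact (inferInstance : IsProbabilityMeasure
    (Measure.pi fun _ : Fin p => Measure.pi fun _ : Fin q => gaussianReal 0 v))

instance (L m dx dy : ℕ) : IsProbabilityMeasure (initLaw L m dx dy) := by
  unfold initLaw; infer_instance

/-- A fair coin. -/
noncomputable def coin : Measure Bool :=
  (2 : ℝ≥0∞)⁻¹ • (Measure.dirac true + Measure.dirac false)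

lemma lintegral_coin (f : Bool → ℝ≥0∞) : ∫⁻ b, f b ∂coin = (f true + f false) / 2 := by
  rw [coin, lintegral_smul_measure, lintegral_add_measure, lintegral_dirac, lintegral_dirac,
    smul_eq_mul, ENNReal.div_eq_inv_mul]

instance : IsProbabilityMeasure coin := ⟨by
  rw [coin, Measure.smul_apply, Measure.add_apply]
  simp only [measure_univ, smul_eq_mul, one_add_one_eq_two]
  exact ENNReal.inv_mul_cancel (by norm_num) (by norm_num)⟩

/-- The uniform law on activation patterns. -/
noncomputable def patLaw (m : ℕ) : Measure (Fin m → Bool) := Measure.pi fun _ => coin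

instance (m : ℕ) : IsProbabilityMeasure (patLaw m) := by unfold patLaw; infer_instance

/-- The diagonal `0/1` matrix of an activation pattern. -/
noncomputable def patMat {m : ℕ} (S : Fin m → Bool) : Matrix (Fin m) (Fin m) ℝ :=
  Matrix.diagonal fun j => if S j then 1 else 0

lemma patMat_mulVec {m : ℕ} (S : Fin m → Bool) (v : Fin m → ℝ) (j : Fin m) :
    (patMat S *ᵥ v) j = if S j then v j else 0 := by
  rw [patMat, mulVec_diagonal]; split_ifs <;> simp

lemma sqNorm_patMat_mulVec {m : ℕ} (S : Fin m → Bool) (v : Fin m → ℝ) :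
    sqNorm (patMat S *ᵥ v) = ∑ j, if S j then v j ^ 2 else 0 := by
  refine Finset.sum_congr rfl fun j _ => ?_
  rw [patMat_mulVec]; split_ifs <;> simp

lemma lintegral_pi_prod {ι E : Type*} [Fintype ι] [MeasurableSpace E] (μ : ι → Measure E)
    [∀ i, IsProbabilityMeasure (μ i)] (f : ι → E → ℝ≥0∞) (hf : ∀ i, Measurable (f i)) :
    ∫⁻ x, ∏ i, f i (x i) ∂Measure.pi μ = ∏ i, ∫⁻ x, f i x ∂μ i := by
  have h := iIndepFun_pi (μ := μ) (X := f) fun i => (hf i).aemeasurable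
  refine (lintegral_prod_eq_prod_lintegral_of_indepFun (μ := Measure.pi μ) Finset.univ
    (fun i (x : ι → E) => f i (x i)) h
    fun i => (hf i).comp (measurable_pi_apply i)).trans ?_
  refine Finset.prod_congr rfl fun i _ => ?_
  exact (measurePreserving_eval μ i).lintegral_comp (hf i)

lemma map_dotProduct_pi_gaussianReal {q : ℕ} (v : ℝ≥0) (u : Fin q → ℝ) :
    (Measure.pi fun _ : Fin q => gaussianReal 0 v).map (fun c => c ⬝ᵥ u) =
      gaussianReal 0 (v * (sqNorm u).toNNReal) := by
  have hm : Measurable fun c : Fin q → ℝ => c ⬝ᵥ u := by unfold dotProduct; fun_prop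
  have : IsProbabilityMeasure
      ((Measure.pi fun _ : Fin q => gaussianReal 0 v).map (fun c => c ⬝ᵥ u)) :=
    Measure.isProbabilityMeasure_map hm.aemeasurable
  refine Measure.ext_of_charFun (funext fun t => ?_)
  rw [charFun_apply_real, integral_map hm.aemeasurable (by fun_prop)]
  have h : ∀ c : Fin q → ℝ, Complex.exp (t * ((c ⬝ᵥ u : ℝ) : ℂ) * Complex.I) =
      ∏ i, Complex.exp ((t * u i : ℝ) * (c i : ℂ) * Complex.I) := by
    intro c
    rw [← Complex.exp_sum, dotProduct]
    push_cast
    rw [Finset.mul_sum, Finset.sum_mul]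
    exact congrArg _ (Finset.sum_congr rfl fun i _ => by ring)
  simp_rw [h]
  rw [integral_fintype_prod_eq_prod (𝕜 := ℂ)
    (fun i (y : ℝ) => Complex.exp ((t * u i : ℝ) * (y : ℂ) * Complex.I))]
  simp_rw [← charFun_apply_real, charFun_gaussianReal]
  rw [← Complex.exp_sum]
  congr 1
  rw [NNReal.coe_mul, Real.coe_toNNReal _ (sqNorm_nonneg u), sqNorm]
  push_cast
  rw [Finset.mul_sum, Finset.sum_mul, Finset.sum_div]
  simp only [mul_zero, zero_mul, zero_sub, Finset.sum_neg_distrib, neg_inj]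
  exact Finset.sum_congr rfl fun i _ => by ring

lemma lintegral_exp_sq_gaussianReal (v : ℝ≥0) {t : ℝ} (ht : 0 < 1 + 2 * t * v) :
    ∫⁻ g, ENNReal.ofReal (Real.exp (-(t * g ^ 2))) ∂gaussianReal 0 v =
      ENNReal.ofReal (√(1 + 2 * t * v))⁻¹ := by
  by_cases hv : v = 0
  · subst hv; simp
  have hv0 : (0 : ℝ) < v := by positivity
  have hb : 0 < t + 1 / (2 * v) := by
    have : t + 1 / (2 * v) = (1 + 2 * t * v) / (2 * v) := by field_simp; ring
    rw [this]; positivity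
  rw [gaussianReal_of_var_ne_zero _ hv, lintegral_withDensity_eq_lintegral_mul _
    (measurable_gaussianPDF 0 v) (by fun_prop)]
  have h : ∀ g : ℝ, (gaussianPDF 0 v * fun g => ENNReal.ofReal (Real.exp (-(t * g ^ 2)))) g =
      ENNReal.ofReal ((√(2 * Real.pi * v))⁻¹ * Real.exp (-(t + 1 / (2 * v)) * g ^ 2)) := by
    intro g
    rw [Pi.mul_apply, gaussianPDF, ← ENNReal.ofReal_mul (gaussianPDFReal_nonneg 0 v g),
      gaussianPDFReal, mul_assoc, ← Real.exp_add]
    congr 3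
    field_simp; ring
  simp_rw [h]
  rw [← ofReal_integral_eq_lintegral_ofReal ((integrable_exp_neg_mul_sq hb).const_mul _)
    (Filter.Eventually.of_forall fun _ => by positivity), integral_const_mul, integral_gaussian]
  congr 1
  rw [← Real.sqrt_inv, ← Real.sqrt_inv, ← Real.sqrt_mul (by positivity)]
  congr 1
  have : t + 1 / (2 * v) = (1 + 2 * t * v) / (2 * v) := by field_simp; ring
  rw [this]
  field_simp

/-- The rows are independent. A closed gate contributes `1`, an open one the Gaussian Laplace
transform, and the fair coin averages the two. -/
lemma lintegral_exp_layer {m q : ℕ} (v : ℝ≥0) (u : Fin q → ℝ) {t : ℝ}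
    (ht : 0 < 1 + 2 * t * (v * sqNorm u)) :
    ∫⁻ S, ∫⁻ W, ENNReal.ofReal (Real.exp (-(t * sqNorm (patMat S *ᵥ (W *ᵥ u)))))
        ∂gaussMatrix m q v ∂patLaw m =
      ENNReal.ofReal (((1 + (√(1 + 2 * t * (v * sqNorm u)))⁻¹) / 2) ^ m) := by
  set w : ℝ := (√(1 + 2 * t * (v * sqNorm u)))⁻¹ with hw
  have hw0 : 0 ≤ w := by positivity
  have hrow : ∫⁻ c, ENNReal.ofReal (Real.exp (-(t * (c ⬝ᵥ u) ^ 2)))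
      ∂(Measure.pi fun _ : Fin q => gaussianReal 0 v) = ENNReal.ofReal w := by
    have hm : Measurable fun c : Fin q → ℝ => c ⬝ᵥ u := by unfold dotProduct; fun_prop
    rw [← lintegral_map (f := fun g : ℝ => ENNReal.ofReal (Real.exp (-(t * g ^ 2))))
      (by fun_prop) hm, map_dotProduct_pi_gaussianReal, lintegral_exp_sq_gaussianReal] <;>
    rw [NNReal.coe_mul, Real.coe_toNNReal _ (sqNorm_nonneg u)]
    exact ht
  have hin : ∀ S : Fin m → Bool,
      ∫⁻ W, ENNReal.ofReal (Real.exp (-(t * sqNorm (patMat S *ᵥ (W *ᵥ u))))) ∂gaussMatrix m q v =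
        ∏ j, if S j then ENNReal.ofReal w else 1 := by
    intro S
    have h : ∀ W : Matrix (Fin m) (Fin q) ℝ,
        ENNReal.ofReal (Real.exp (-(t * sqNorm (patMat S *ᵥ (W *ᵥ u))))) =
        ∏ j, (fun c : Fin q → ℝ =>
          if S j then ENNReal.ofReal (Real.exp (-(t * (c ⬝ᵥ u) ^ 2))) else 1) (W j) := by
      intro W
      rw [sqNorm_patMat_mulVec, Finset.mul_sum, ← Finset.sum_neg_distrib, Real.exp_sum,
        ENNReal.ofReal_prod_of_nonneg fun _ _ => (Real.exp_pos _).le]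
      refine Finset.prod_congr rfl fun j _ => ?_
      by_cases hS : S j <;> simp [hS, mulVec]
    simp_rw [h]
    have hm : Measurable fun c : Fin q → ℝ => c ⬝ᵥ u := by unfold dotProduct; fun_prop
    refine (lintegral_pi_prod (fun _ : Fin m => Measure.pi fun _ : Fin q => gaussianReal 0 v)
      (fun j (c : Fin q → ℝ) => if S j then ENNReal.ofReal (Real.exp (-(t * (c ⬝ᵥ u) ^ 2))) else 1)
      fun j => ?_).trans ?_
    · by_cases hS : S j <;> simp only [hS, if_true, Bool.false_eq_true, if_false] <;> fun_prop
    · refine Finset.prod_congr rfl fun j _ => ?_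
      by_cases hS : S j <;> simp [hS, hrow]
  simp_rw [hin]
  refine (lintegral_pi_prod (fun _ : Fin m => coin)
    (fun _ b => if b then ENNReal.ofReal w else 1) fun _ => measurable_of_countable _).trans ?_
  simp only [lintegral_coin, if_true, Bool.false_eq_true, if_false, Finset.prod_const,
    Finset.card_univ, Fintype.card_fin]
  rw [← ENNReal.ofReal_one, ← ENNReal.ofReal_add hw0 zero_le_one,
    show (2 : ℝ≥0∞) = ENNReal.ofReal 2 by simp, ← ENNReal.ofReal_div_of_pos two_pos,
    ← ENNReal.ofReal_pow (by positivity), add_comm]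


/-! ### Elementary bounds on the exponential rates. -/

lemma log_one_add_le_cubic {x : ℝ} (hx : 0 ≤ x) : Real.log (1 + x) ≤ x - x ^ 2 / 2 + x ^ 3 / 3 := by
  have hmono : MonotoneOn (fun x : ℝ => x - x ^ 2 / 2 + x ^ 3 / 3 - Real.log (1 + x))
      (Set.Ici 0) := by
    apply monotoneOn_of_hasDerivWithinAt_nonneg (convex_Ici 0)
      (f' := fun x => 1 - x + x ^ 2 - 1 / (1 + x))
    · refine ContinuousOn.sub (by fun_prop) (ContinuousOn.log (by fun_prop) fun y hy => ?_)
      have : (0 : ℝ) ≤ y := hy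
      positivity
    · intro y hy
      have hy0 : 0 < y := by simpa using hy
      have h1 : HasDerivAt (fun x : ℝ => x - x ^ 2 / 2 + x ^ 3 / 3 - Real.log (1 + x))
          (1 - (2 * y ^ 1 * 1) / 2 + (3 * y ^ 2 * 1) / 3 - 1 / (1 + y)) y := by
        have hid := hasDerivAt_id' y
        have := (((hid.sub ((hid.pow 2).div_const 2)).add ((hid.pow 3).div_const 3)).sub
          ((hid.const_add 1).log (by positivity)))
        exact this.congr_deriv (by norm_num)
      exact (h1.congr_deriv (by ring)).hasDerivWithinAt
    · intro y hy
      have hy0 : 0 < y := by simpa using hy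
      have : 1 - y + y ^ 2 - 1 / (1 + y) = y ^ 3 / (1 + y) := by field_simp; ring
      rw [this]; positivity
  have := hmono (show (0 : ℝ) ∈ Set.Ici 0 by simp) hx hx
  simp only [ne_eq, OfNat.ofNat_ne_zero, not_false_eq_true, zero_pow, zero_div, sub_zero, add_zero,
    Real.log_one] at this
  linarith

lemma log_one_sub_le {x : ℝ} (h0 : 0 ≤ x) (h1 : x < 1) :
    Real.log (1 - x) ≤ -x - x ^ 2 / 2 - x ^ 3 / 3 := by
  have h := Real.hasSum_pow_div_log_of_abs_lt_one (x := x) (by rw [abs_of_nonneg h0]; exact h1)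
  have h2 := sum_le_hasSum (Finset.range 3) (fun i _ => by positivity) h
  simp only [Finset.sum_range_succ, Finset.sum_range_zero] at h2
  norm_num at h2
  linarith

lemma neg_log_one_sub_le {x : ℝ} (h0 : 0 ≤ x) (h1 : x ≤ 1 / 3) :
    -Real.log (1 - x) ≤ x + x ^ 2 / 2 + 5 / 6 * x ^ 3 := by
  have h := Real.abs_log_sub_add_sum_range_le (x := x) (by rw [abs_of_nonneg h0]; linarith) 3
  rw [abs_of_nonneg h0] at h
  have h' := (abs_le.1 h).1
  simp only [Finset.sum_range_succ, Finset.sum_range_zero] at h'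
  norm_num at h'
  have : x ^ 4 / (1 - x) ≤ x ^ 3 / 2 := by
    rw [div_le_iff₀ (by linarith)]
    nlinarith [pow_nonneg h0 3]
  linarith

/-- Exponential rate of the upper moments of a layer. -/
noncomputable def rateUp (q : ℝ) : ℝ :=
  q * (1 + q) / 2 * (3 * Real.log (1 + q) - Real.log (1 + q / 2) - 1) + Real.log (1 + q / 2)

/-- Exponential rate of the lower tail of a layer. -/
noncomputable def rateLow (q : ℝ) : ℝ :=
  q * (1 - q) / 2 * (1 + Real.log (1 - q / 2) - 3 * Real.log (1 - q)) + Real.log (1 - q / 2)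

lemma rateUp_le_poly {q : ℝ} (h0 : 0 ≤ q) (h1 : q ≤ 3 / 5) :
    rateUp q ≤ q * (1 + q) / 2 * (3 * (q - q ^ 2 / 2 + q ^ 3 / 3) - 1) +
      (q / 2 - q ^ 2 / 8 + q ^ 3 / 24) * (1 - q * (1 + q) / 2) := by
  have e1 := log_one_add_le_cubic h0
  have e2 := log_one_add_le_cubic (x := q / 2) (by positivity)
  have hb : 0 ≤ q * (1 + q) / 2 := by positivity
  -- This is the total coefficient of `log (1 + q/2)` in `rateUp`; its sign allows the cubic upper
  -- bound to be inserted.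
  have hb1 : 0 ≤ 1 - q * (1 + q) / 2 := by nlinarith
  have m1 := mul_le_mul_of_nonneg_left e1 hb
  have m2 := mul_le_mul_of_nonneg_right e2 hb1
  unfold rateUp
  linear_combination 3 * m1 + m2

/-- The leading term is a variance: twice a coin times a squared standard Gaussian has mean `1` and
variance `5`, so the log-moment of order `p ≈ mq/2` is about `5p²/(2m) = 5mq²/8`. -/
lemma rateUp_le {q : ℝ} (h0 : 0 ≤ q) (h1 : q ≤ 1 / 3) : rateUp q ≤ 5 / 8 * q ^ 2 * (1 + q) := by
  have h := rateUp_le_poly h0 (by linarith)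
  have : q * (1 + q) / 2 * (3 * (q - q ^ 2 / 2 + q ^ 3 / 3) - 1) +
      (q / 2 - q ^ 2 / 8 + q ^ 3 / 24) * (1 - q * (1 + q) / 2) - 5 / 8 * q ^ 2 * (1 + q) ≤ 0 := by
    nlinarith [pow_nonneg h0 3, pow_nonneg h0 4, mul_nonneg (pow_nonneg h0 3) (sub_nonneg.2 h1),
      mul_nonneg (pow_nonneg h0 4) (sub_nonneg.2 h1)]
  linarith

/-- A longer range of `q`, for the operator norms of blocks. With the correction `1 + 2q` the cubic
terms cancel exactly in `exists_block_test`. -/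
lemma rateUp_le' {q : ℝ} (h0 : 0 ≤ q) (h1 : q ≤ 3 / 5) :
    rateUp q ≤ 5 / 8 * q ^ 2 * (1 + 2 * q) := by
  have h := rateUp_le_poly h0 h1
  have : q * (1 + q) / 2 * (3 * (q - q ^ 2 / 2 + q ^ 3 / 3) - 1) +
      (q / 2 - q ^ 2 / 8 + q ^ 3 / 24) * (1 - q * (1 + q) / 2) - 5 / 8 * q ^ 2 * (1 + 2 * q) ≤ 0 := by
    nlinarith [pow_nonneg h0 3, pow_nonneg h0 4, mul_nonneg (pow_nonneg h0 3) (sub_nonneg.2 h1),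
      mul_nonneg (pow_nonneg h0 4) (sub_nonneg.2 h1)]
  linarith

lemma rateLow_le {q : ℝ} (h0 : 0 ≤ q) (h1 : q ≤ 1 / 3) : rateLow q ≤ 5 / 8 * q ^ 2 := by
  have e1 := neg_log_one_sub_le h0 h1
  have e2 := log_one_sub_le (x := q / 2) (by positivity) (by linarith)
  have hb : 0 ≤ q * (1 - q) / 2 := by nlinarith
  have m1 := mul_le_mul_of_nonneg_left e1 hb
  have m2 := mul_le_mul_of_nonneg_left e2 (by linarith : 0 ≤ 1 + q * (1 - q) / 2)
  have : (1 + q * (1 - q) / 2) * (-(q / 2) - (q / 2) ^ 2 / 2 - (q / 2) ^ 3 / 3) +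
      q * (1 - q) / 2 * (1 + 3 * (q + q ^ 2 / 2 + 5 / 6 * q ^ 3)) ≤ 5 / 8 * q ^ 2 := by
    nlinarith [pow_nonneg h0 3, pow_nonneg h0 4, mul_nonneg (pow_nonneg h0 3) (sub_nonneg.2 h1),
      mul_nonneg (pow_nonneg h0 4) (sub_nonneg.2 h1), pow_nonneg h0 5]
  unfold rateLow
  nlinarith

/-- The rate needed when `L = 1`, where the quadratic bound of `rateLow_le` is too weak. -/
lemma rateLow_one_third_le : rateLow (1 / 3) ≤ 447 / 10000 := by
  have e2 := log_one_sub_le (x := 1 / 6) (by norm_num) (by norm_num)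
  have e1 : -Real.log (2 / 3) ≤ 407 / 1000 := by
    -- `(49/40)²` exceeds `3/2` only slightly.
    have h := log_one_add_le_cubic (x := 9 / 40) (by norm_num)
    have h2 : Real.log (3 / 2) ≤ Real.log ((1 + 9 / 40) ^ 2) :=
      Real.log_le_log (by norm_num) (by norm_num)
    rw [Real.log_pow] at h2
    rw [← Real.log_inv]
    norm_num at h h2 ⊢
    linarith
  unfold rateLow
  norm_num at e1 e2 ⊢
  linarith

/-- The Chernoff exponent is optimal at `r = 1 - q`. -/
lemma log_rate_le {q r : ℝ} (h0 : 0 < q) (h1 : q ≤ 1 / 3) (hr0 : q ≤ r) (hr1 : r < 1) :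
    Real.log ((1 + r) / 2) + q * (1 - q) / 2 * (Real.log (1 - r ^ 2) - 2 * Real.log r) ≤
      Real.log ((1 + (1 - q)) / 2) +
        q * (1 - q) / 2 * (Real.log (1 - (1 - q) ^ 2) - 2 * Real.log (1 - q)) := by
  set φ : ℝ → ℝ := fun r => Real.log ((1 + r) / 2) +
    q * (1 - q) / 2 * (Real.log (1 - r ^ 2) - 2 * Real.log r) with hφ
  have hd : ∀ y, 0 < y → y < 1 →
      HasDerivAt φ ((y - q) * (1 - q - y) / (y * (1 - y ^ 2))) y := by
    intro y hy0 hy1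
    have hy2 : 0 < 1 - y ^ 2 := by nlinarith
    have hid := hasDerivAt_id' y
    have hA := ((hid.const_add 1).div_const 2).log (by positivity)
    have hB := ((hid.pow 2).const_sub 1).log (by simpa using hy2.ne')
    simp only [Pi.pow_apply] at hB
    have hC := hid.log hy0.ne'
    refine (hA.add ((hB.sub (hC.const_mul 2)).const_mul (q * (1 - q) / 2))).congr_deriv ?_
    have : (1 - y ^ 2) = (1 - y) * (1 + y) := by ring
    have h3 : 1 - y ≠ 0 := by linarith
    have h4 : 1 + y ≠ 0 := by linarith
    simp only [Nat.cast_ofNat]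
    rw [this]
    field_simp
    ring
  have hc : ContinuousOn φ (Set.Ioo 0 1) := fun y hy => (hd y hy.1 hy.2).continuousAt.continuousWithinAt
  -- The derivative has the sign of `(y - q)(1 - q - y)`: `φ` rises from `q` to `1 - q` and then
  -- falls.
  rcases le_total r (1 - q) with h | h
  · have hm : MonotoneOn φ (Set.Icc q (1 - q)) := by
      apply monotoneOn_of_hasDerivWithinAt_nonneg (convex_Icc _ _)
        (hc.mono fun y hy => ⟨by linarith [hy.1], by linarith [hy.2]⟩)
        (f' := fun y => (y - q) * (1 - q - y) / (y * (1 - y ^ 2)))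
      · intro y hy
        rw [interior_Icc] at hy
        exact (hd y (by linarith [hy.1]) (by linarith [hy.2])).hasDerivWithinAt
      · intro y hy
        rw [interior_Icc] at hy
        have : 0 < 1 - y ^ 2 := by nlinarith [hy.1, hy.2]
        exact div_nonneg (mul_nonneg (by linarith [hy.1]) (by linarith [hy.2]))
          (mul_nonneg (by linarith [hy.1]) this.le)
    exact hm ⟨hr0, h⟩ ⟨by linarith, le_rfl⟩ h
  · have hm : AntitoneOn φ (Set.Ico (1 - q) 1) := by
      apply antitoneOn_of_hasDerivWithinAt_nonpos (convex_Ico _ _)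
        (hc.mono fun y hy => ⟨by linarith [hy.1], by linarith [hy.2]⟩)
        (f' := fun y => (y - q) * (1 - q - y) / (y * (1 - y ^ 2)))
      · intro y hy
        rw [interior_Ico] at hy
        exact (hd y (by linarith [hy.1]) (by linarith [hy.2])).hasDerivWithinAt
      · intro y hy
        rw [interior_Ico] at hy
        have : 0 < 1 - y ^ 2 := by nlinarith [hy.1, hy.2]
        exact div_nonpos_of_nonpos_of_nonneg
          (mul_nonpos_of_nonneg_of_nonpos (by linarith [hy.1]) (by linarith [hy.1]))
          (mul_nonneg (by linarith [hy.1]) this.le)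
    exact hm ⟨le_rfl, by linarith⟩ ⟨h, hr1⟩ h

/-- The Chernoff bound for the lower tail of a layer, at deviation `x`. -/
lemma low_chernoff {q x : ℝ} (h0 : 0 < q) (h1 : q ≤ 1 / 3) (hx : 2 * q ^ 3 ≤ x) (m : ℕ) :
    Real.exp (m * (q * (1 - q) / 2)) *
        ((1 + (√(1 + 4 * (q * (1 - q) / 2 / x)))⁻¹) / 2) ^ m ≤
      Real.exp (m * rateLow q) * x ^ (m * (q * (1 - q) / 2)) := by
  have hx0 : 0 < x := lt_of_lt_of_le (by positivity) hx
  set β := q * (1 - q) / 2 with hβ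
  have hβ0 : 0 < β := by rw [hβ]; nlinarith
  set D := 1 + 4 * (β / x) with hD
  have hD1 : 1 < D := by rw [hD]; linarith [div_pos hβ0 hx0]
  set r := (√D)⁻¹ with hr
  have hs1 : 1 < √D := by rw [Real.lt_sqrt zero_le_one]; linarith
  have hr1 : r < 1 := inv_lt_one_of_one_lt₀ hs1
  have hr0 : 0 < r := by positivity
  have hr2 : r ^ 2 = D⁻¹ := by rw [hr, inv_pow, Real.sq_sqrt (by linarith)]
  -- The lower bound `2q³ ≤ x` keeps `r` in the interval where `1 - q` is the maximum.
  have hrq : q ≤ r := by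
    rw [hr, le_inv_comm₀ h0 (by positivity), Real.sqrt_le_left (by positivity), hD, inv_pow,
      ← sub_nonneg]
    have h3 : β / x ≤ β / (2 * q ^ 3) := div_le_div_of_nonneg_left hβ0.le (by positivity) hx
    have h4 : β / (2 * q ^ 3) = (1 - q) / (4 * q ^ 2) := by rw [hβ]; field_simp; ring
    have h5 : 4 * ((1 - q) / (4 * q ^ 2)) = (q ^ 2)⁻¹ - q⁻¹ := by field_simp
    have h6 : 1 ≤ q⁻¹ := (one_le_inv₀ h0).2 (by linarith)
    linarith
  have key := log_rate_le h0 h1 hrq hr1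
  -- Inverting the definition of `r` gives `x = 4β r²/(1 - r²)`, which turns the claim into
  -- `log_rate_le`.
  have hlx : Real.log x = Real.log (4 * β) - (Real.log (1 - r ^ 2) - 2 * Real.log r) := by
    have e : x = 4 * β / ((1 - r ^ 2) / r ^ 2) := by
      rw [hr2]
      have : D ≠ 0 := by linarith
      have h7 : (1 - D⁻¹) / D⁻¹ = D - 1 := by field_simp
      rw [h7, hD]; field_simp; ring
    have h8 : 0 < 1 - r ^ 2 := by nlinarith
    conv_lhs => rw [e]
    rw [Real.log_div (by positivity) (by positivity), Real.log_div (by positivity) (by positivity),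
      Real.log_pow]
    norm_num
  have hconst : Real.log ((1 + (1 - q)) / 2) +
        β * (Real.log (1 - (1 - q) ^ 2) - 2 * Real.log (1 - q)) =
      rateLow q - β + β * Real.log (4 * β) := by
    have a1 : (1 + (1 - q)) / 2 = 1 - q / 2 := by ring
    have a2 : 1 - (1 - q) ^ 2 = (2 * q) * (1 - q / 2) := by ring
    have a3 : 4 * β = (2 * q) * (1 - q) := by rw [hβ]; ring
    rw [a1, a2, a3, Real.log_mul (x := 2 * q) (y := 1 - q / 2) (by positivity) (by linarith),
      Real.log_mul (x := 2 * q) (y := 1 - q) (by positivity) (by linarith), rateLow, ← hβ]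
    ring
  have hfin : β + Real.log ((1 + r) / 2) ≤ rateLow q + β * Real.log x := by
    rw [← hβ, hconst] at key
    rw [hlx]
    linarith
  have hp : 0 < (1 + r) / 2 := by positivity
  rw [← Real.exp_log (pow_pos hp m), Real.rpow_def_of_pos hx0, ← Real.exp_add, ← Real.exp_add,
    Real.log_pow]
  apply Real.exp_le_exp.2
  have := mul_le_mul_of_nonneg_left hfin (Nat.cast_nonneg (α := ℝ) m)
  nlinarith


/-! ### One gated layer: moments and lower tail. -/

/-- Squared length of the output of a random gated layer on `u`. -/
noncomputable def layerOut {m q : ℕ} (u : Fin q → ℝ)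
    (ω : (Fin m → Bool) × Matrix (Fin m) (Fin q) ℝ) : ℝ :=
  sqNorm (patMat ω.1 *ᵥ (ω.2 *ᵥ u))

/-- Law of a random gated layer. -/
noncomputable def layerLaw (m q : ℕ) (v : ℝ≥0) :
    Measure ((Fin m → Bool) × Matrix (Fin m) (Fin q) ℝ) :=
  (patLaw m).prod (gaussMatrix m q v)

instance (m q : ℕ) (v : ℝ≥0) : IsProbabilityMeasure (layerLaw m q v) := by
  unfold layerLaw; infer_instance

lemma measurable_matrix_apply {p q : ℕ} (a : Fin p) (b : Fin q) :
    Measurable fun W : Matrix (Fin p) (Fin q) ℝ => W a b :=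
  (measurable_pi_apply b).comp (measurable_pi_apply (X := fun _ : Fin p => Fin q → ℝ) a)

lemma measurable_mulVec_const {p q : ℕ} (u : Fin q → ℝ) :
    Measurable fun W : Matrix (Fin p) (Fin q) ℝ => W *ᵥ u := by
  refine measurable_pi_lambda _ fun a => ?_
  unfold mulVec dotProduct
  exact Finset.measurable_sum _ fun b _ => (measurable_matrix_apply a b).mul_const _

lemma measurable_layerOut {m q : ℕ} (u : Fin q → ℝ) :
    Measurable (layerOut (m := m) u) := by
  refine measurable_from_prod_countable_right fun S => ?_
  have : Measurable fun W : Matrix (Fin m) (Fin q) ℝ => ∑ j, if S j then (W *ᵥ u) j ^ 2 else 0 := by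
    refine Finset.measurable_sum _ fun j _ => ?_
    by_cases h : S j
    · simp only [h, if_true]
      exact ((measurable_pi_apply j).comp (measurable_mulVec_const u)).pow_const 2
    · simp [h]
  simpa only [layerOut, sqNorm_patMat_mulVec] using this

lemma measurable_exp_layerOut {m q : ℕ} (u : Fin q → ℝ) (c : ℝ) :
    Measurable fun ω : (Fin m → Bool) × Matrix (Fin m) (Fin q) ℝ =>
      ENNReal.ofReal (Real.exp (-(c * layerOut u ω))) :=
  (Real.measurable_exp.comp ((measurable_layerOut u).const_mul c).neg).ennreal_ofReal

lemma layerOut_nonneg {m q : ℕ} (u : Fin q → ℝ) (ω : (Fin m → Bool) × Matrix (Fin m) (Fin q) ℝ) :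
    0 ≤ layerOut u ω := sqNorm_nonneg _

lemma lintegral_layerLaw {m q : ℕ} (v : ℝ≥0) {f : (Fin m → Bool) × Matrix (Fin m) (Fin q) ℝ → ℝ≥0∞}
    (hf : Measurable f) :
    ∫⁻ ω, f ω ∂layerLaw m q v = ∫⁻ S, ∫⁻ W, f (S, W) ∂gaussMatrix m q v ∂patLaw m :=
  lintegral_prod _ hf.aemeasurable

/-- Mean of `layerOut`. -/
noncomputable def layerMean (m : ℕ) {q : ℕ} (v : ℝ≥0) (u : Fin q → ℝ) : ℝ :=
  m * v / 2 * sqNorm u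

lemma layerMean_nonneg (m : ℕ) {q : ℕ} (v : ℝ≥0) (u : Fin q → ℝ) : 0 ≤ layerMean m v u :=
  mul_nonneg (by positivity) (sqNorm_nonneg u)

lemma lintegral_exp_layerOut {m d : ℕ} (hm : 0 < m) (v : ℝ≥0) (u : Fin d → ℝ)
    (hu : 0 < layerMean m v u) {s : ℝ} (hs : 0 < 1 + 4 * s) :
    ∫⁻ ω, ENNReal.ofReal (Real.exp (-(m * s / layerMean m v u * layerOut u ω))) ∂layerLaw m d v =
      ENNReal.ofReal (((1 + (√(1 + 4 * s))⁻¹) / 2) ^ m) := by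
  have hm0 : (0 : ℝ) < m := by exact_mod_cast hm
  have e : 1 + 2 * (m * s / layerMean m v u) * (v * sqNorm u) = 1 + 4 * s := by
    have hne := hu.ne'
    have : (v : ℝ) * sqNorm u = 2 * layerMean m v u / m := by
      rw [layerMean]; field_simp
    rw [this]; field_simp; ring
  have := lintegral_exp_layer (m := m) v u (t := m * s / layerMean m v u) (by rw [e]; exact hs)
  rw [e] at this
  rw [← this, lintegral_layerLaw]
  · rfl
  · exact measurable_exp_layerOut u _

lemma lintegral_layerOut_rpow_le {m d : ℕ} (hm : 0 < m) {v : ℝ≥0} (hv : v ≠ 0) (u : Fin d → ℝ)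
    {q : ℝ} (hq : 0 < q) :
    ∫⁻ ω, ENNReal.ofReal (layerOut u ω ^ (m * (q * (1 + q) / 2))) ∂layerLaw m d v ≤
      ENNReal.ofReal (Real.exp (m * rateUp q)) *
        ENNReal.ofReal (layerMean m v u ^ (m * (q * (1 + q) / 2))) := by
  have hm0 : (0 : ℝ) < m := by exact_mod_cast hm
  set p : ℝ := m * (q * (1 + q) / 2) with hp
  have hp0 : 0 < p := by positivity
  rcases (sqNorm_nonneg u).eq_or_lt with h0 | h0
  · have hu : u = 0 := sqNorm_eq_zero.1 h0.symm
    have : ∀ ω : (Fin m → Bool) × Matrix (Fin m) (Fin d) ℝ, layerOut u ω = 0 := by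
      intro ω; simp [layerOut, hu]
    simp [this, Real.zero_rpow hp0.ne']
  have hv0 : (0 : ℝ) < v := by positivity
  have hρ : 0 < layerMean m v u := by unfold layerMean; positivity
  set ρ := layerMean m v u with hρd
  -- Chosen so that `(1 - 4s)^(-1/2) = 1 + q`. For the exponent `p` this is the stationary point of
  -- the bound that follows from `z^p ≤ exp (p (z - 1))`.
  set s : ℝ := (2 * q + q ^ 2) / (4 * (1 + q) ^ 2) with hs
  have hs0 : 0 < s := by positivity
  have h1s : 1 + 4 * (-s) = ((1 + q)⁻¹) ^ 2 := by rw [hs]; field_simp; ring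
  have hpt : ∀ ω : (Fin m → Bool) × Matrix (Fin m) (Fin d) ℝ,
      ENNReal.ofReal (layerOut u ω ^ p) ≤
      ENNReal.ofReal ((ρ * p / (m * s)) ^ p * Real.exp (-p)) *
        ENNReal.ofReal (Real.exp (-(m * (-s) / ρ * layerOut u ω))) := by
    intro ω
    rw [← ENNReal.ofReal_mul (by positivity)]
    apply ENNReal.ofReal_le_ofReal
    rcases (layerOut_nonneg u ω).eq_or_lt with h | h
    · rw [← h, Real.zero_rpow hp0.ne']; positivity
    set z := layerOut u ω * (m * s) / (ρ * p) with hz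
    have hz0 : 0 < z := by positivity
    have hy : layerOut u ω = ρ * p / (m * s) * z := by rw [hz]; field_simp
    have h3 : z ^ p ≤ Real.exp (p * (z - 1)) := by
      rw [Real.rpow_def_of_pos hz0, Real.exp_le_exp]
      nlinarith [Real.log_le_sub_one_of_pos hz0]
    calc layerOut u ω ^ p = (ρ * p / (m * s)) ^ p * z ^ p := by
          conv_lhs => rw [hy]
          rw [Real.mul_rpow (by positivity) hz0.le]
      _ ≤ (ρ * p / (m * s)) ^ p * Real.exp (p * (z - 1)) := by gcongr
      _ = _ := by
          have h4 : Real.exp (p * (z - 1)) =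
              Real.exp (-p) * Real.exp (-(m * (-s) / ρ * layerOut u ω)) := by
            rw [← Real.exp_add]
            congr 1
            rw [hz]; field_simp; ring
          rw [h4, mul_assoc]
  refine (lintegral_mono hpt).trans ?_
  rw [lintegral_const_mul _ (measurable_exp_layerOut u _),
    lintegral_exp_layerOut hm v u hρ (by rw [h1s]; positivity), h1s,
    Real.sqrt_sq (by positivity), inv_inv, ← ENNReal.ofReal_mul (by positivity),
    ← ENNReal.ofReal_mul (by positivity)]
  apply le_of_eq
  congr 1
  have e1 : ρ * p / (m * s) = ρ * ((1 + q) ^ 3 / (1 + q / 2)) := by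
    rw [hp, hs]; field_simp; ring
  have e2 : (1 + (1 + q)) / 2 = 1 + q / 2 := by ring
  rw [e1, e2, Real.mul_rpow hρ.le (by positivity),
    Real.rpow_def_of_pos (x := (1 + q) ^ 3 / (1 + q / 2)) (by positivity),
    ← Real.exp_log (show (0 : ℝ) < (1 + q / 2) ^ m by positivity),
    Real.log_div (by positivity) (by positivity), Real.log_pow, Real.log_pow]
  rw [mul_assoc, mul_assoc, ← Real.exp_add, ← Real.exp_add, mul_comm]
  congr 2
  rw [hp, rateUp]; push_cast; ring

lemma layerOut_le_prob {m d : ℕ} (hm : 0 < m) {v : ℝ≥0} (u : Fin d → ℝ)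
    (hρ : 0 < layerMean m v u) {q x : ℝ} (h0 : 0 < q) (h1 : q ≤ 1 / 3) (hx : 2 * q ^ 3 ≤ x) :
    layerLaw m d v {ω | layerOut u ω ≤ x * layerMean m v u} ≤
      ENNReal.ofReal (Real.exp (m * rateLow q) * x ^ (m * (q * (1 - q) / 2))) := by
  have hm0 : (0 : ℝ) < m := by exact_mod_cast hm
  have hx0 : 0 < x := lt_of_lt_of_le (by positivity) hx
  set β := q * (1 - q) / 2 with hβ
  have hβ0 : 0 < β := by rw [hβ]; nlinarith
  set ρ := layerMean m v u
  have hmeas : Measurable fun ω : (Fin m → Bool) × Matrix (Fin m) (Fin d) ℝ =>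
      ENNReal.ofReal (Real.exp (m * β)) *
        ENNReal.ofReal (Real.exp (-(m * (β / x) / ρ * layerOut u ω))) :=
    (measurable_exp_layerOut u _).const_mul _
  have hM := mul_meas_ge_le_lintegral (μ := layerLaw m d v) hmeas 1
  rw [one_mul] at hM
  refine le_trans (measure_mono ?_) (hM.trans ?_)
  · intro ω hω
    simp only [Set.mem_ofPred_eq] at hω ⊢
    rw [← ENNReal.ofReal_mul (by positivity), ← Real.exp_add, ← ENNReal.ofReal_one]
    apply ENNReal.ofReal_le_ofReal
    apply Real.one_le_exp
    have h2 : m * (β / x) / ρ * layerOut u ω ≤ m * (β / x) / ρ * (x * ρ) := by gcongr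
    have h3 : m * (β / x) / ρ * (x * ρ) = m * β := by field_simp
    linarith
  · rw [lintegral_const_mul _ (measurable_exp_layerOut u _),
      lintegral_exp_layerOut hm v u hρ (by positivity), ← ENNReal.ofReal_mul (by positivity)]
    exact ENNReal.ofReal_le_ofReal (low_chernoff h0 h1 hx m)

/-- The lower-tail test function: `(b / y) ^ p`, with `b / y` clamped to `[b, 1]`. -/
noncomputable def lowTest (b p y : ℝ) : ℝ≥0∞ := ENNReal.ofReal ((b / max b (min y 1)) ^ p)

lemma measurable_lowTest (b p : ℝ) : Measurable (lowTest b p) := by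
  unfold lowTest; fun_prop

lemma lowTest_le_one {b p : ℝ} (hb : 0 < b) (hp : 0 ≤ p) (y : ℝ) : lowTest b p y ≤ 1 := by
  rw [lowTest, ← ENNReal.ofReal_one]
  exact ENNReal.ofReal_le_ofReal (Real.rpow_le_one (by positivity)
    (div_le_one_of_le₀ (le_max_left _ _) (by positivity)) hp)

lemma lowTest_of_le {b p y : ℝ} (hb : 0 < b) (hy : y ≤ b) : lowTest b p y = 1 := by
  rw [lowTest, max_eq_left ((min_le_left _ _).trans hy), div_self hb.ne', Real.one_rpow,
    ENNReal.ofReal_one]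

lemma lowTest_min_one (b p y : ℝ) : lowTest b p (min y 1) = lowTest b p y := by
  simp [lowTest]

lemma lowTest_one {b p : ℝ} (hb1 : b ≤ 1) : lowTest b p 1 = ENNReal.ofReal (b ^ p) := by
  simp [lowTest, hb1]

/-- Layer-cake integration of a power tail `x^p'` against a smaller power `p`. The clamp at `b`
avoids deviations without a tail estimate; the clamp at `1` ensures that only deviations `x ≥ b` are
needed. -/
lemma lintegral_lowTest_le {Ω : Type*} [MeasurableSpace Ω] (μ : Measure Ω) [IsProbabilityMeasure μ]
    {Z : Ω → ℝ} (hZ : Measurable Z) {y b p p' C : ℝ} (hb : 0 < b) (hp : 0 < p)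
    (hpp : p < p') (hC : 0 ≤ C)
    (htail : ∀ x, b ≤ x → x ≤ 1 → μ {ω | Z ω ≤ x * y} ≤ ENNReal.ofReal (C * x ^ p')) (hy : 0 < y) :
    ∫⁻ ω, lowTest b p (Z ω) ∂μ ≤ ENNReal.ofReal (1 + p / (p' - p) * C) * lowTest b p y := by
  have hpp0 : 0 < p' - p := by linarith
  rw [← lowTest_min_one b p y]
  set y₀ := min y 1 with hy₀
  have hy₀0 : 0 < y₀ := lt_min hy one_pos
  have hy₀1 : y₀ ≤ 1 := min_le_right _ _
  rcases le_or_gt y₀ b with hyb | hyb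
  · rw [lowTest_of_le hb hyb, mul_one]
    refine (lintegral_mono fun ω => lowTest_le_one hb hp.le (Z ω)).trans ?_
    rw [lintegral_one, measure_univ, ← ENNReal.ofReal_one]
    exact ENNReal.ofReal_le_ofReal (by have : 0 ≤ p / (p' - p) * C := by positivity
                                       linarith)
  set w := b / y₀ with hw
  have hw0 : 0 < w := by positivity
  have hw1 : w < 1 := (div_lt_one hy₀0).2 hyb
  have hbw : b ≤ w := by rw [hw, le_div_iff₀ hy₀0]; nlinarith
  have hval : lowTest b p y₀ = ENNReal.ofReal (w ^ p) := by
    rw [lowTest, min_eq_left hy₀1, max_eq_right hyb.le]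
  set g : Ω → ℝ := fun ω => b / max b (min (Z ω) 1) with hg
  have hg0 : ∀ ω, 0 ≤ g ω := fun ω => by rw [hg]; positivity
  have hg1 : ∀ ω, g ω ≤ 1 := fun ω => div_le_one_of_le₀ (le_max_left _ _) (by positivity)
  have hgm : Measurable g := by rw [hg]; fun_prop
  have hlc := lintegral_rpow_eq_lintegral_meas_le_mul μ (Filter.Eventually.of_forall hg0)
    hgm.aemeasurable hp
  have hpt : ∀ t ∈ Set.Ioi (0 : ℝ), μ {a | t ≤ g a} * ENNReal.ofReal (t ^ (p - 1)) ≤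
      (Set.Ioc 0 w).indicator (fun t => ENNReal.ofReal (t ^ (p - 1))) t +
        (Set.Ioi w).indicator (fun t => ENNReal.ofReal (C * w ^ p' * t ^ (-(p' - p) - 1))) t := by
    intro t ht
    have ht0 : 0 < t := ht
    rcases le_or_gt t w with htw | htw
    · rw [Set.indicator_of_mem (show t ∈ Set.Ioc 0 w from ⟨ht0, htw⟩)]
      exact le_add_right (mul_le_of_le_one_left' prob_le_one)
    rw [Set.indicator_of_mem (show t ∈ Set.Ioi w from htw)]
    refine le_add_left ?_
    rcases le_or_gt t 1 with ht1 | ht1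
    -- Level `t` of the test ratio corresponds to deviation `x = w/t`, and `b ≤ w/t ≤ 1` because `w
    -- < t ≤ 1`.
    · have hsub : {a | t ≤ g a} ⊆ {ω | Z ω ≤ w / t * y} := by
        intro ω hω
        simp only [Set.mem_ofPred_eq] at hω ⊢
        rw [hg, le_div_iff₀ (lt_max_of_lt_left hb)] at hω
        have h1 : max b (min (Z ω) 1) ≤ b / t := by
          rw [le_div_iff₀ ht0]; linarith
        have h2 : b / t < 1 := by
          rw [div_lt_one ht0]
          exact lt_of_le_of_lt hbw htw
        have h3 : min (Z ω) 1 ≤ b / t := (le_max_right _ _).trans h1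
        have h4 : Z ω ≤ b / t := by
          rcases min_le_iff.1 h3 with h | h
          · exact h
          · linarith
        refine h4.trans ?_
        rw [hw, div_mul_eq_mul_div, div_le_div_iff_of_pos_right ht0, div_mul_eq_mul_div,
          le_div_iff₀ hy₀0]
        exact mul_le_mul_of_nonneg_left (min_le_left _ _) hb.le
      have h5 := (measure_mono hsub).trans (htail (w / t)
        (hbw.trans (le_div_self hw0.le ht0 ht1)) ((div_le_one ht0).2 htw.le))
      refine (mul_le_mul_left h5 _).trans ?_
      rw [← ENNReal.ofReal_mul (by positivity)]
      apply le_of_eq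
      congr 1
      rw [Real.div_rpow hw0.le ht0.le, show -(p' - p) - 1 = (p - 1) - p' by ring,
        Real.rpow_sub ht0 (p - 1) p']
      field_simp
    · have : {a | t ≤ g a} = ∅ := by
        ext ω
        simp only [Set.mem_ofPred_eq, Set.mem_empty_iff_false, iff_false, not_le]
        exact lt_of_le_of_lt (hg1 ω) ht1
      rw [this]; simp
  have hI1 : ∫⁻ t in Set.Ioc 0 w, ENNReal.ofReal (t ^ (p - 1)) = ENNReal.ofReal (w ^ p / p) := by
    rw [← ofReal_integral_eq_lintegral_ofReal]
    · rw [← intervalIntegral.integral_of_le hw0.le, integral_rpow (Or.inl (by linarith))]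
      simp [Real.zero_rpow hp.ne']
    · exact (intervalIntegrable_iff_integrableOn_Ioc_of_le hw0.le).1
        (intervalIntegral.intervalIntegrable_rpow' (by linarith))
    · filter_upwards [self_mem_ae_restrict measurableSet_Ioc] with t ht
      exact Real.rpow_nonneg ht.1.le _
  have hI2 : ∫⁻ t in Set.Ioi w, ENNReal.ofReal (C * w ^ p' * t ^ (-(p' - p) - 1)) =
      ENNReal.ofReal (C * w ^ p / (p' - p)) := by
    rw [← ofReal_integral_eq_lintegral_ofReal]
    · rw [integral_const_mul, integral_Ioi_rpow_of_lt (by linarith) hw0]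
      congr 1
      rw [show -(p' - p) - 1 + 1 = p - p' by ring, Real.rpow_sub hw0]
      have : p - p' ≠ 0 := by linarith
      have h6 := (Real.rpow_pos_of_pos hw0 p').ne'
      field_simp
      ring
    · exact (integrableOn_Ioi_rpow_of_lt (by linarith) hw0).const_mul _
    · filter_upwards [self_mem_ae_restrict measurableSet_Ioi] with t ht
      have : 0 < t := hw0.trans ht
      positivity
  calc ∫⁻ ω, lowTest b p (Z ω) ∂μ = ∫⁻ ω, ENNReal.ofReal (g ω ^ p) ∂μ := rfl
    _ ≤ ENNReal.ofReal p * ∫⁻ t in Set.Ioi 0,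
        ((Set.Ioc 0 w).indicator (fun t => ENNReal.ofReal (t ^ (p - 1))) t +
        (Set.Ioi w).indicator (fun t => ENNReal.ofReal (C * w ^ p' * t ^ (-(p' - p) - 1))) t) := by
        rw [hlc]
        refine mul_le_mul' le_rfl ?_
        exact setLIntegral_mono' measurableSet_Ioi hpt
    _ ≤ ENNReal.ofReal p * ∫⁻ t,
        ((Set.Ioc 0 w).indicator (fun t => ENNReal.ofReal (t ^ (p - 1))) t +
        (Set.Ioi w).indicator (fun t => ENNReal.ofReal (C * w ^ p' * t ^ (-(p' - p) - 1))) t) := by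
        refine mul_le_mul' le_rfl ?_
        exact setLIntegral_le_lintegral _ _
    _ = ENNReal.ofReal p * (ENNReal.ofReal (w ^ p / p) + ENNReal.ofReal (C * w ^ p / (p' - p))) := by
        rw [lintegral_add_left (Measurable.indicator (by fun_prop) measurableSet_Ioc),
          lintegral_indicator measurableSet_Ioc, lintegral_indicator measurableSet_Ioi, hI1, hI2]
    _ = ENNReal.ofReal (1 + p / (p' - p) * C) * lowTest b p y₀ := by
        rw [hval, ← ENNReal.ofReal_add (by positivity) (by positivity),
          ← ENNReal.ofReal_mul hp.le, ← ENNReal.ofReal_mul (by positivity)]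
        congr 1
        field_simp


/-! ### Row-sign symmetry: activation patterns as independent fair coins. -/

/-- Activation pattern of a vector. -/
noncomputable def pat {m : ℕ} (z : Fin m → ℝ) : Fin m → Bool := fun j => decide (0 < z j)

lemma gate_eq_patMat {m : ℕ} (z : Fin m → ℝ) : gate z = patMat (pat z) := by
  simp [gate, patMat, pat]

lemma pat_relu {m : ℕ} (z : Fin m → ℝ) : pat (relu z) = pat z := by
  funext j; simp [pat, relu]

lemma relu_eq_zero {m : ℕ} {z : Fin m → ℝ} : relu z = 0 ↔ pat z = fun _ => false := by
  simp [relu, pat, funext_iff]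

lemma measurable_pat {m : ℕ} : Measurable (pat : (Fin m → ℝ) → Fin m → Bool) := by
  refine measurable_pi_lambda _ fun j => measurable_to_bool ?_
  have : (fun z : Fin m → ℝ => pat z j) ⁻¹' {true} = {z | 0 < z j} := by
    ext z; simp [pat]
  rw [this]
  exact measurableSet_lt measurable_const (measurable_pi_apply j)

lemma continuous_relu {m : ℕ} : Continuous (relu : (Fin m → ℝ) → Fin m → ℝ) := by
  unfold relu; fun_prop

/-- Change the signs of the rows selected by `σ`. -/
def flip {m d : ℕ} (σ : Fin m → Bool) (C : Matrix (Fin m) (Fin d) ℝ) :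
    Matrix (Fin m) (Fin d) ℝ := fun a b => if σ a then -C a b else C a b

lemma flip_mulVec {m d : ℕ} (σ : Fin m → Bool) (C : Matrix (Fin m) (Fin d) ℝ) (u : Fin d → ℝ)
    (a : Fin m) : (flip σ C *ᵥ u) a = if σ a then -(C *ᵥ u) a else (C *ᵥ u) a := by
  by_cases h : σ a <;> simp [flip, mulVec, dotProduct, h]

lemma measurePreserving_flip {m d : ℕ} (v : ℝ≥0) (σ : Fin m → Bool) :
    MeasurePreserving (flip σ) (gaussMatrix m d v) (gaussMatrix m d v) := by
  refine measurePreserving_pi (fun _ : Fin m => Measure.pi fun _ : Fin d => gaussianReal 0 v)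
    (fun _ : Fin m => Measure.pi fun _ : Fin d => gaussianReal 0 v)
    (f := fun a (c : Fin d → ℝ) b => if σ a then -c b else c b) fun a => ?_
  refine measurePreserving_pi (fun _ : Fin d => gaussianReal 0 v) (fun _ : Fin d => gaussianReal 0 v)
    (f := fun b (x : ℝ) => if σ a then -x else x) fun b => ?_
  by_cases h : σ a
  · simp only [h, if_true]
    exact ⟨measurable_neg, by rw [gaussianReal_map_neg, neg_zero]⟩
  · simp only [h, Bool.false_eq_true, if_false]
    exact MeasurePreserving.id _

lemma measurePreserving_xor {m : ℕ} (S : Fin m → Bool) :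
    MeasurePreserving (fun σ : Fin m → Bool => fun j => xor (S j) (σ j)) (patLaw m) (patLaw m) := by
  refine measurePreserving_pi (fun _ : Fin m => coin) (fun _ : Fin m => coin)
    (f := fun j b => xor (S j) b) fun j => ⟨measurable_of_countable _, ?_⟩
  refine Measure.ext_of_lintegral _ fun f hf => ?_
  rw [lintegral_map hf (measurable_of_countable _), lintegral_coin, lintegral_coin]
  cases S j <;> simp [add_comm]

lemma ae_mulVec_ne_zero {m d : ℕ} {v : ℝ≥0} (hv : v ≠ 0) {z : Fin d → ℝ} (hz : z ≠ 0) :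
    ∀ᵐ C ∂gaussMatrix m d v, ∀ a, (C *ᵥ z) a ≠ 0 := by
  rw [ae_all_iff]
  intro a
  have hrow : ∀ᵐ c ∂(Measure.pi fun _ : Fin d => gaussianReal 0 v), c ⬝ᵥ z ≠ 0 := by
    have hm : Measurable fun c : Fin d → ℝ => c ⬝ᵥ z := by unfold dotProduct; fun_prop
    have h0 : v * (sqNorm z).toNNReal ≠ 0 := by
      refine mul_ne_zero hv ?_
      rw [Ne, Real.toNNReal_eq_zero, not_le]
      exact lt_of_le_of_ne (sqNorm_nonneg z) fun h => hz (sqNorm_eq_zero.1 h.symm)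
    have := nullSingletonClass_gaussianReal (μ := 0) h0
    have h1 : ∀ᵐ g ∂gaussianReal 0 (v * (sqNorm z).toNNReal), g ≠ 0 := Measure.ae_ne _ 0
    rw [← map_dotProduct_pi_gaussianReal] at h1
    exact ae_of_ae_map hm.aemeasurable h1
  exact (measurePreserving_eval (fun _ : Fin m => Measure.pi fun _ : Fin d => gaussianReal 0 v)
    a).quasiMeasurePreserving.ae hrow

/-- The activation pattern of `C z` is uniform, and independent of `C` up to row signs. -/
lemma lintegral_pat_mulVec {m d : ℕ} {v : ℝ≥0} (hv : v ≠ 0) {z : Fin d → ℝ} (hz : z ≠ 0)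
    (h : (Fin m → Bool) → Matrix (Fin m) (Fin d) ℝ → ℝ≥0∞) (hh : ∀ S, Measurable (h S))
    (hflip : ∀ S σ C, h S (flip σ C) = h S C) :
    ∫⁻ C, h (pat (C *ᵥ z)) C ∂gaussMatrix m d v =
      ∫⁻ S, ∫⁻ C, h S C ∂gaussMatrix m d v ∂patLaw m := by
  have hpm : Measurable fun C : Matrix (Fin m) (Fin d) ℝ => pat (C *ᵥ z) :=
    measurable_pat.comp (measurable_mulVec_const z)
  have hu : Measurable fun p : (Fin m → Bool) × Matrix (Fin m) (Fin d) ℝ => h p.1 p.2 :=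
    measurable_from_prod_countable_right hh
  have hH : Measurable fun C : Matrix (Fin m) (Fin d) ℝ => h (pat (C *ᵥ z)) C :=
    hu.comp (hpm.prodMk measurable_id)
  -- Flipping rows by `σ` preserves the law and `h`, and adds `σ` to the pattern as soon as no entry
  -- of `C z` is zero.
  have key : ∀ σ : Fin m → Bool, ∫⁻ C, h (pat (C *ᵥ z)) C ∂gaussMatrix m d v =
      ∫⁻ C, h (fun j => xor (pat (C *ᵥ z) j) (σ j)) C ∂gaussMatrix m d v := by
    intro σ
    rw [← (measurePreserving_flip v σ).lintegral_comp hH]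
    refine lintegral_congr_ae ?_
    filter_upwards [ae_mulVec_ne_zero hv hz] with C hC
    rw [hflip]
    congr 1
    funext j
    have := hC j
    by_cases hs : σ j
    · simp only [pat, flip_mulVec, hs, if_true, Bool.xor_true]
      rcases lt_or_gt_of_ne this with h | h <;> simp [h, not_lt.2 h.le]
    · simp [pat, flip_mulVec, hs]
  -- Since every `σ` gives the same value, average over uniform `σ`. For fixed `C` the shifted
  -- pattern is then itself uniform.
  have h2 : ∫⁻ C, h (pat (C *ᵥ z)) C ∂gaussMatrix m d v =
      ∫⁻ σ, ∫⁻ C, h (fun j => xor (pat (C *ᵥ z) j) (σ j)) C ∂gaussMatrix m d v ∂patLaw m := by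
    simp_rw [← key]
    rw [lintegral_const, measure_univ, mul_one]
  rw [h2, lintegral_lintegral_swap, lintegral_lintegral_swap (μ := patLaw m) hu.aemeasurable]
  · refine lintegral_congr fun C => ?_
    exact (measurePreserving_xor (pat (C *ᵥ z))).lintegral_comp (f := fun S => h S C)
      (measurable_of_countable _)
  · refine (measurable_from_prod_countable_right fun σ => ?_).aemeasurable
    refine hu.comp (Measurable.prodMk ?_ measurable_id)
    exact (measurable_of_countable fun S : Fin m → Bool => fun j => xor (S j) (σ j)).comp hpm

lemma patLaw_singleton {m : ℕ} (S : Fin m → Bool) : patLaw m {S} = (2 : ℝ≥0∞)⁻¹ ^ m := by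
  rw [patLaw, ← Set.univ_pi_singleton, Measure.pi_pi]
  have : ∀ b : Bool, coin {b} = (2 : ℝ≥0∞)⁻¹ := by
    intro b
    rw [← lintegral_indicator_one (MeasurableSet.singleton b), lintegral_coin]
    cases b <;> simp
  simp [this]

lemma gaussMatrix_relu_eq_zero {m d : ℕ} {v : ℝ≥0} (hv : v ≠ 0) {z : Fin d → ℝ} (hz : z ≠ 0) :
    gaussMatrix m d v {C | relu (C *ᵥ z) = 0} = (2 : ℝ≥0∞)⁻¹ ^ m := by
  have h := lintegral_pat_mulVec (m := m) hv hz
    (fun S _ => Set.indicator {fun _ => false} (1 : (Fin m → Bool) → ℝ≥0∞) S)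
    (fun _ => measurable_const) fun _ _ _ => rfl
  simp only [lintegral_const, measure_univ, mul_one] at h
  rw [lintegral_indicator_one (MeasurableSet.singleton _), patLaw_singleton] at h
  rw [← h, ← lintegral_indicator_one]
  · refine lintegral_congr fun C => ?_
    by_cases hC : relu (C *ᵥ z) = 0
    · rw [Set.indicator_of_mem (by exact hC), Set.indicator_of_mem (by exact relu_eq_zero.1 hC)]; rfl
    · rw [Set.indicator_of_notMem (by exact hC),
        Set.indicator_of_notMem (by exact fun h => hC (relu_eq_zero.2 h))]
  · exact (continuous_relu (m := m)).measurable.comp (measurable_mulVec_const z)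
      (MeasurableSet.singleton 0)

/-- Features of the gating layers started at `z`. -/
def feat {L m : ℕ} (Ψ : Layers L m) (z : Fin m → ℝ) : Fin (L + 1) → (Fin m → ℝ) :=
  Fin.induction z fun k z => relu (Ψ k *ᵥ z)

lemma feature_eq_feat {L m dx : ℕ} (Ψ : Layers L m) (C : Matrix (Fin m) (Fin dx) ℝ)
    (x : Fin dx → ℝ) : feature Ψ C x = feat Ψ (relu (C *ᵥ x)) := rfl

@[simp] lemma feat_zero {L m : ℕ} (Ψ : Layers L m) (z : Fin m → ℝ) : feat Ψ z 0 = z := rfl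

lemma feat_succ {L m : ℕ} (Ψ : Layers L m) (z : Fin m → ℝ) (k : Fin L) :
    feat Ψ z k.succ = relu (Ψ k *ᵥ feat Ψ z k.castSucc) := by
  simp [feat, Fin.induction_succ]

lemma feat_succ' {L m : ℕ} (Ψ : Layers (L + 1) m) (z : Fin m → ℝ) (l : Fin (L + 1)) :
    feat Ψ z l.succ = feat (fun k => Ψ k.succ) (relu (Ψ 0 *ᵥ z)) l := by
  induction l using Fin.induction with
  | zero => rw [feat_succ]; rfl
  | succ k ih => rw [feat_succ, feat_succ, ← ih, Fin.succ_castSucc]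

/-- Activation patterns of the layers `1, …, L`. -/
noncomputable def featPat {L m : ℕ} (Ψ : Layers L m) (z : Fin m → ℝ) : Fin L → Fin m → Bool :=
  fun l => pat (feat Ψ z l.succ)

lemma continuous_feat {L m : ℕ} (l : Fin (L + 1)) :
    Continuous fun p : Layers L m × (Fin m → ℝ) => feat p.1 p.2 l := by
  induction l using Fin.induction with
  | zero => exact continuous_snd
  | succ k ih =>
    simp only [feat_succ]
    refine continuous_relu.comp (Continuous.matrix_mulVec ?_ ih)
    exact (continuous_apply k).comp continuous_fst

instance (p q : ℕ) : BorelSpace (Matrix (Fin p) (Fin q) ℝ) :=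
  inferInstanceAs (BorelSpace (Fin p → Fin q → ℝ))

instance (p q : ℕ) : SecondCountableTopology (Matrix (Fin p) (Fin q) ℝ) :=
  inferInstanceAs (SecondCountableTopology (Fin p → Fin q → ℝ))

lemma measurable_feat {L m : ℕ} (l : Fin (L + 1)) :
    Measurable fun p : Layers L m × (Fin m → ℝ) => feat p.1 p.2 l :=
  (continuous_feat l).measurable

lemma measurable_featPat {L m : ℕ} :
    Measurable fun p : Layers L m × (Fin m → ℝ) => featPat p.1 p.2 :=
  measurable_pi_lambda _ fun l => measurable_pat.comp (measurable_feat l.succ)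

/-- Law of `L` independent Gaussian square layers. -/
noncomputable def layersLaw (L m : ℕ) (v : ℝ≥0) : Measure (Layers L m) :=
  Measure.pi fun _ : Fin L => gaussMatrix m m v

instance (L m : ℕ) (v : ℝ≥0) : IsProbabilityMeasure (layersLaw L m v) := by
  unfold layersLaw; infer_instance

lemma lintegral_layersLaw_succ {L m : ℕ} (v : ℝ≥0) {f : Layers (L + 1) m → ℝ≥0∞}
    (hf : Measurable f) :
    ∫⁻ Ψ, f Ψ ∂layersLaw (L + 1) m v =
      ∫⁻ A, ∫⁻ Ψ, f (Fin.cons A Ψ) ∂layersLaw L m v ∂gaussMatrix m m v := by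
  have h := (measurePreserving_piFinSuccAbove (fun _ : Fin (L + 1) => gaussMatrix m m v) 0).symm
  rw [layersLaw, ← h.lintegral_comp hf, lintegral_prod]
  · simp [MeasurableEquiv.piFinSuccAbove_symm_apply, Fin.insertNthEquiv, layersLaw]
  · exact (hf.comp (MeasurableEquiv.measurable _)).aemeasurable

/-- Law of `k` independent uniform patterns. -/
noncomputable def patsLaw (k m : ℕ) : Measure (Fin k → Fin m → Bool) :=
  Measure.pi fun _ : Fin k => patLaw m

instance (k m : ℕ) : IsProbabilityMeasure (patsLaw k m) := by unfold patsLaw; infer_instance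

lemma lintegral_patsLaw_succ {k m : ℕ} (f : (Fin (k + 1) → Fin m → Bool) → ℝ≥0∞) :
    ∫⁻ S, f S ∂patsLaw (k + 1) m =
      ∫⁻ A, ∫⁻ S, f (Fin.cons A S) ∂patsLaw k m ∂patLaw m := by
  have hf : Measurable f := measurable_of_countable _
  have h := (measurePreserving_piFinSuccAbove (fun _ : Fin (k + 1) => patLaw m) 0).symm
  rw [patsLaw, ← h.lintegral_comp hf, lintegral_prod]
  · simp [MeasurableEquiv.piFinSuccAbove_symm_apply, Fin.insertNthEquiv, patsLaw]
  · exact (hf.comp (MeasurableEquiv.measurable _)).aemeasurable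

open Classical in
/-- `a` if no feature before the last layer vanishes, `0` otherwise. -/
noncomputable def onAlive {L m : ℕ} (Ψ : Layers L m) (z : Fin m → ℝ) (a : ℝ≥0∞) : ℝ≥0∞ :=
  if ∀ l : Fin L, feat Ψ z l.castSucc ≠ 0 then a else 0

lemma measurableSet_alive {L m : ℕ} :
    MeasurableSet {p : Layers L m × (Fin m → ℝ) | ∀ l : Fin L, feat p.1 p.2 l.castSucc ≠ 0} := by
  simp only [Set.ofPred_forall]
  exact MeasurableSet.iInter fun l =>
    (measurable_feat l.castSucc (MeasurableSet.singleton 0)).compl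

lemma measurable_onAlive {L m : ℕ} {X : Type*} [MeasurableSpace X] {f : X → Layers L m}
    {g : X → (Fin m → ℝ)} {a : X → ℝ≥0∞} (hf : Measurable f) (hg : Measurable g)
    (ha : Measurable a) : Measurable fun x => onAlive (f x) (g x) (a x) := by
  classical
  unfold onAlive
  exact Measurable.ite ((hf.prodMk hg) measurableSet_alive) ha measurable_const

/-- As long as the features do not vanish, the activation patterns are dominated by uniform ones. -/
lemma lintegral_onAlive_featPat_le {L m : ℕ} {v : ℝ≥0} (hv : v ≠ 0) (z : Fin m → ℝ)
    (Γ : (Fin L → Fin m → Bool) → ℝ≥0∞) :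
    ∫⁻ Ψ, onAlive Ψ z (Γ (featPat Ψ z)) ∂layersLaw L m v ≤ ∫⁻ S, Γ S ∂patsLaw L m := by
  induction L generalizing z with
  | zero =>
    have h1 : ∀ Ψ : Layers 0 m, onAlive Ψ z (Γ (featPat Ψ z)) = Γ (fun l => l.elim0) := by
      intro Ψ
      rw [onAlive, if_pos (fun l => l.elim0)]
      exact congrArg Γ (Subsingleton.elim _ _)
    have h2 : ∀ S : Fin 0 → Fin m → Bool, Γ S = Γ (fun l => l.elim0) := fun S =>
      congrArg Γ (Subsingleton.elim _ _)
    simp_rw [h1]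
    rw [lintegral_congr h2]
    simp
  | succ L ih =>
    by_cases hz : z = 0
    · have : ∀ Ψ : Layers (L + 1) m, onAlive Ψ z (Γ (featPat Ψ z)) = 0 := by
        intro Ψ
        rw [onAlive, if_neg]
        exact fun h => h 0 hz
      simp [this]
    have hmeas : Measurable fun Ψ : Layers (L + 1) m => onAlive Ψ z (Γ (featPat Ψ z)) :=
      measurable_onAlive measurable_id measurable_const ((measurable_of_countable Γ).comp
        (measurable_featPat.comp (measurable_id.prodMk measurable_const)))
    rw [lintegral_layersLaw_succ v hmeas, lintegral_patsLaw_succ]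
    -- Peel off the first layer `A`: the others start from `relu (A z)`, to which induction applies
    -- with the first pattern frozen. Afterwards `pat (A z)` is uniform because `z ≠ 0`.
    calc _ ≤ ∫⁻ A, ∫⁻ S, Γ (Fin.cons (pat (A *ᵥ z)) S) ∂patsLaw L m ∂gaussMatrix m m v := by
          refine lintegral_mono fun A => le_trans (lintegral_mono fun Ψ => ?_)
            (ih (relu (A *ᵥ z)) fun S => Γ (Fin.cons (pat (A *ᵥ z)) S))
          have e1 : featPat (Fin.cons A Ψ : Layers (L + 1) m) z =
              Fin.cons (pat (A *ᵥ z)) (featPat Ψ (relu (A *ᵥ z))) := by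
            funext l
            refine Fin.cases ?_ (fun k => ?_) l
            · rw [featPat, feat_succ]; simp [pat_relu]
            · rw [featPat, feat_succ']; simp [featPat]
          rw [onAlive, onAlive, e1]
          split_ifs with ha hb
          · exact le_rfl
          · refine absurd (fun l => ?_) hb
            have := ha l.succ
            rw [← Fin.succ_castSucc, feat_succ'] at this
            simpa using this
          all_goals simp
      _ = _ := lintegral_pat_mulVec hv hz
          (fun S _ => ∫⁻ S', Γ (Fin.cons S S') ∂patsLaw L m) (fun _ => measurable_const)
          (fun _ _ _ => rfl) |>.trans (by simp)

/-- From a nonzero feature the next one vanishes only if all `m` gates close, which has probability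
`2^(-m)`; sum over the layers. -/
lemma layersLaw_dead_le {L m : ℕ} {v : ℝ≥0} (hv : v ≠ 0) {z : Fin m → ℝ} (hz : z ≠ 0) :
    layersLaw L m v {Ψ | ¬ ∀ l : Fin L, feat Ψ z l.castSucc ≠ 0} ≤ L * (2 : ℝ≥0∞)⁻¹ ^ m := by
  induction L generalizing z with
  | zero =>
    have : {Ψ : Layers 0 m | ¬ ∀ l : Fin 0, feat Ψ z l.castSucc ≠ 0} = ∅ := by
      ext Ψ; simp
    rw [this]; simp
  | succ L ih =>
    have hS : MeasurableSet {Ψ : Layers (L + 1) m | ¬ ∀ l : Fin (L + 1), feat Ψ z l.castSucc ≠ 0} :=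
      ((measurable_id.prodMk measurable_const) measurableSet_alive).compl
    rw [← lintegral_indicator_one hS,
      lintegral_layersLaw_succ v (measurable_one.indicator hS)]
    have hA : MeasurableSet {A : Matrix (Fin m) (Fin m) ℝ | relu (A *ᵥ z) = 0} :=
      (continuous_relu.measurable.comp (measurable_mulVec_const z)) (MeasurableSet.singleton 0)
    calc _ ≤ ∫⁻ A, ({A : Matrix (Fin m) (Fin m) ℝ | relu (A *ᵥ z) = 0}.indicator 1 A +
          L * (2 : ℝ≥0∞)⁻¹ ^ m) ∂gaussMatrix m m v := by
          refine lintegral_mono fun A => ?_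
          by_cases hA0 : relu (A *ᵥ z) = 0
          · rw [Set.indicator_of_mem (s := {A : Matrix (Fin m) (Fin m) ℝ | relu (A *ᵥ z) = 0}) hA0]
            refine le_add_right ((lintegral_mono fun Ψ => Set.indicator_le_self' (by simp) _).trans ?_)
            simp
          · refine le_add_left (le_trans ?_ (ih hA0))
            have hS' : MeasurableSet
                {Ψ : Layers L m | ¬ ∀ l : Fin L, feat Ψ (relu (A *ᵥ z)) l.castSucc ≠ 0} :=
              ((measurable_id.prodMk measurable_const) measurableSet_alive).compl
            rw [← lintegral_indicator_one hS']
            refine lintegral_mono fun Ψ => ?_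
            by_cases h2 : ∀ l : Fin L, feat Ψ (relu (A *ᵥ z)) l.castSucc ≠ 0
            · refine (Set.indicator_of_notMem ?_ _).trans_le zero_le
              refine not_not_intro fun l => ?_
              refine Fin.cases ?_ (fun k => ?_) l
              · simpa using hz
              · rw [← Fin.succ_castSucc, feat_succ']
                simpa using h2 k
            · exact (Set.indicator_le_self' (by simp) _).trans
                (Set.indicator_of_mem (s := {Ψ : Layers L m |
                  ¬ ∀ l : Fin L, feat Ψ (relu (A *ᵥ z)) l.castSucc ≠ 0}) h2
                  (1 : Layers L m → ℝ≥0∞)).ge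
      _ ≤ _ := by
          rw [lintegral_add_right _ measurable_const, lintegral_indicator_one hA,
            gaussMatrix_relu_eq_zero hv hz]
          simp [add_mul, add_comm]


/-! ### Test functions along chains of gated layers. -/

/-- A random gated layer multiplies the expectation of the test function `f` by at most `γ`. -/
structure StepBound (m : ℕ) (f : ℝ → ℝ≥0∞) (γ : ℝ≥0∞) : Prop where
  meas : Measurable f
  step : ∀ {d : ℕ} {v : ℝ≥0}, v ≠ 0 → ∀ (u : Fin d → ℝ) {c : ℝ}, 0 < c →
    ∫⁻ ω, f (c * layerOut u ω) ∂layerLaw m d v ≤ γ * f (c * layerMean m v u)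

lemma stepBound_rpow {m : ℕ} (hm : 0 < m) {q : ℝ} (hq : 0 < q) :
    StepBound m (fun y => ENNReal.ofReal (y ^ (m * (q * (1 + q) / 2))))
      (ENNReal.ofReal (Real.exp (m * rateUp q))) where
  meas := by fun_prop
  step := by
    intro d v hv u c hc
    have h1 : ∀ ω : (Fin m → Bool) × Matrix (Fin m) (Fin d) ℝ,
        ENNReal.ofReal ((c * layerOut u ω) ^ (m * (q * (1 + q) / 2))) =
        ENNReal.ofReal (c ^ (m * (q * (1 + q) / 2))) *
          ENNReal.ofReal (layerOut u ω ^ (m * (q * (1 + q) / 2))) := fun ω => by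
      rw [Real.mul_rpow hc.le (layerOut_nonneg u ω), ENNReal.ofReal_mul (by positivity)]
    simp_rw [h1]
    rw [lintegral_const_mul _ ((measurable_layerOut u).pow_const _).ennreal_ofReal,
      Real.mul_rpow hc.le (layerMean_nonneg m v u), ENNReal.ofReal_mul (by positivity),
      mul_left_comm]
    exact mul_le_mul' le_rfl (lintegral_layerOut_rpow_le hm hv u hq)

/-- Lowering the exponent by `h` below that of the tail makes the layer-cake integral converge; the
price is the factor with `1/h`. -/
lemma stepBound_lowTest {m : ℕ} (hm : 0 < m) {q b h E : ℝ} (hq : 0 < q) (hq1 : q ≤ 1 / 3)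
    (hb : 2 * q ^ 3 ≤ b) (hh : 0 < h) (hh1 : h < m * (q * (1 - q) / 2)) (hE : rateLow q ≤ E) :
    StepBound m (lowTest b (m * (q * (1 - q) / 2) - h))
      (ENNReal.ofReal (1 + (m * (q * (1 - q) / 2) - h) / h * Real.exp (m * E))) where
  meas := measurable_lowTest _ _
  step := by
    intro d v hv u c hc
    have hb0 : 0 < b := lt_of_lt_of_le (by positivity) hb
    rcases (sqNorm_nonneg u).eq_or_lt with h0 | h0
    · have hu : u = 0 := sqNorm_eq_zero.1 h0.symm
      have h1 : ∀ ω : (Fin m → Bool) × Matrix (Fin m) (Fin d) ℝ, layerOut u ω = 0 := by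
        intro ω; simp [layerOut, hu]
      have h2 : layerMean m v u = 0 := by simp [layerMean, hu]
      simp only [h1, h2, mul_zero, lintegral_const, measure_univ, mul_one]
      refine le_mul_of_one_le_left' ?_
      rw [← ENNReal.ofReal_one]
      apply ENNReal.ofReal_le_ofReal
      have : 0 ≤ (m * (q * (1 - q) / 2) - h) / h := div_nonneg (by linarith) hh.le
      nlinarith [Real.exp_pos (m * E)]
    have hm0 : (0 : ℝ) < m := by exact_mod_cast hm
    have hv0 : (0 : ℝ) < v := by positivity
    have hρ : 0 < layerMean m v u := by unfold layerMean; positivity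
    have := lintegral_lowTest_le (layerLaw m d v) (Z := fun ω => c * layerOut u ω)
      ((measurable_layerOut u).const_mul c) (y := c * layerMean m v u) (b := b)
      (p := m * (q * (1 - q) / 2) - h) (p' := m * (q * (1 - q) / 2)) (C := Real.exp (m * E)) hb0
      (by linarith) (by linarith) (Real.exp_pos _).le (fun x hx _ => ?_) (by positivity)
    · simpa only [sub_sub_cancel] using this
    · refine le_trans (measure_mono fun ω hω => ?_)
        ((layerOut_le_prob hm u hρ hq hq1 (hb.trans hx)).trans (ENNReal.ofReal_le_ofReal ?_))
      · simp only [Set.mem_ofPred_eq] at hω ⊢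
        refine le_of_mul_le_mul_left ?_ hc
        linarith
      · have : 0 < x := hb0.trans_le hx
        gcongr

/-- Redrawing one independent coordinate lets the newest layer of a chain be integrated first,
conditionally on the others. -/
lemma lintegral_pi_resample {ι E : Type*} [Fintype ι] [DecidableEq ι] [MeasurableSpace E]
    (μ : ι → Measure E) [∀ i, IsProbabilityMeasure (μ i)] (k : ι) {F : (ι → E) → ℝ≥0∞}
    (hF : Measurable F) :
    ∫⁻ x, F x ∂Measure.pi μ = ∫⁻ x, ∫⁻ y, F (Function.update x k y) ∂μ k ∂Measure.pi μ := by
  refine lintegral_eq_of_lmarginal_eq {k} hF ?_ ?_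
  · have := hF.lmarginal μ (s := {k})
    rwa [lmarginal_singleton] at this
  · rw [← lmarginal_singleton]
    funext x
    conv_rhs => rw [lmarginal_singleton]
    simp [lmarginal_update_of_mem]

/-- Patterns and square layers, all independent. -/
noncomputable def chainLaw (k L m : ℕ) (v : ℝ≥0) : Measure ((Fin k → Fin m → Bool) × Layers L m) :=
  (patsLaw k m).prod (layersLaw L m v)

instance (k L m : ℕ) (v : ℝ≥0) : IsProbabilityMeasure (chainLaw k L m v) := by
  unfold chainLaw; infer_instance

lemma measurable_update_layers {L m : ℕ} (l : Fin L) :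
    Measurable fun p : Layers L m × Matrix (Fin m) (Fin m) ℝ => Function.update p.1 l p.2 := by
  refine measurable_pi_lambda _ fun a => ?_
  by_cases h : a = l
  · subst h; simpa using measurable_snd
  · simp only [Function.update_of_ne h]
    exact (measurable_pi_apply a).comp measurable_fst

lemma lintegral_chainLaw_resample {k L m : ℕ} {v : ℝ≥0} (a : Fin k) (l : Fin L)
    {F : (Fin k → Fin m → Bool) × Layers L m → ℝ≥0∞} (hF : Measurable F) :
    ∫⁻ p, F p ∂chainLaw k L m v =
      ∫⁻ p, ∫⁻ ω, F (Function.update p.1 a ω.1, Function.update p.2 l ω.2) ∂layerLaw m m v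
        ∂chainLaw k L m v := by
  have hu := measurable_update_layers (m := m) l
  have hjoint : ∀ S : Fin k → Fin m → Bool, Measurable
      fun q : Layers L m × ((Fin m → Bool) × Matrix (Fin m) (Fin m) ℝ) =>
        F (Function.update S a q.2.1, Function.update q.1 l q.2.2) := fun S =>
    hF.comp (((measurable_of_countable fun s => Function.update S a s).comp
      (measurable_fst.comp measurable_snd)).prodMk
      (hu.comp (measurable_fst.prodMk (measurable_snd.comp measurable_snd))))
  have hw : ∀ S, Measurable fun W : Layers L m =>
      ∫⁻ w, F (S, Function.update W l w) ∂gaussMatrix m m v := fun S =>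
    Measurable.lintegral_prod_right (hF.comp (measurable_const.prodMk hu))
  have hmeasR : Measurable fun p : (Fin k → Fin m → Bool) × Layers L m =>
      ∫⁻ ω, F (Function.update p.1 a ω.1, Function.update p.2 l ω.2) ∂layerLaw m m v :=
    measurable_from_prod_countable_right fun S => Measurable.lintegral_prod_right (hjoint S)
  rw [chainLaw, lintegral_prod _ hF.aemeasurable, lintegral_prod _ hmeasR.aemeasurable]
  calc ∫⁻ S, ∫⁻ W, F (S, W) ∂layersLaw L m v ∂patsLaw k m
      = ∫⁻ S, ∫⁻ W, ∫⁻ w, F (S, Function.update W l w) ∂gaussMatrix m m v ∂layersLaw L m v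
          ∂patsLaw k m := lintegral_congr fun S =>
        lintegral_pi_resample (fun _ : Fin L => gaussMatrix m m v) l (hF.comp measurable_prodMk_left)
    _ = ∫⁻ S, ∫⁻ s, ∫⁻ W, ∫⁻ w, F (Function.update S a s, Function.update W l w)
          ∂gaussMatrix m m v ∂layersLaw L m v ∂patLaw m ∂patsLaw k m :=
        lintegral_pi_resample (fun _ : Fin k => patLaw m) a (measurable_of_countable _)
    _ = _ := by
        refine lintegral_congr fun S => ?_
        rw [lintegral_lintegral_swap]
        · refine lintegral_congr fun W => ?_
          exact (lintegral_layerLaw v ((hjoint S).comp measurable_prodMk_left)).symm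
        · exact (measurable_from_prod_countable_right fun s =>
            hw (Function.update S a s)).aemeasurable

/-- Partial products `D_b W_b ⋯ W_{a+1} D_a`, read as `0` when `b < a`. -/
def subM {L m : ℕ} (D : Fin (L + 1) → Matrix (Fin m) (Fin m) ℝ) (W : Layers L m)
    (a : Fin (L + 1)) : Fin (L + 1) → Matrix (Fin m) (Fin m) ℝ :=
  Fin.induction (if a = 0 then D 0 else 0) fun k P =>
    if a = k.succ then D k.succ else D k.succ * W k * P

section Recursions

variable {L m dx dy : ℕ} (D : Fin (L + 1) → Matrix (Fin m) (Fin m) ℝ)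
  (C : Matrix (Fin m) (Fin dx) ℝ) (B : Matrix (Fin dy) (Fin m) ℝ) (W : Layers L m)

lemma subG_zero : subG D C W 0 = D 0 * C := rfl

lemma subG_succ (k : Fin L) : subG D C W k.succ = D k.succ * W k * subG D C W k.castSucc := by
  simp [subG, Fin.induction_succ]

lemma subM_zero (a : Fin (L + 1)) : subM D W a 0 = if a = 0 then D 0 else 0 := rfl

lemma subM_succ (a : Fin (L + 1)) (k : Fin L) : subM D W a k.succ =
    if a = k.succ then D k.succ else D k.succ * W k * subM D W a k.castSucc := by
  simp [subM, Fin.induction_succ]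

lemma subF_last : subF D B W (Fin.last L) = B * D (Fin.last L) := by
  simp [subF, Fin.reverseInduction_last]

lemma subF_castSucc (k : Fin L) :
    subF D B W k.castSucc = subF D B W k.succ * W k * D k.castSucc := by
  simp [subF, Fin.reverseInduction_castSucc]

end Recursions

section Congr

variable {L m dx dy : ℕ} {D D' : Fin (L + 1) → Matrix (Fin m) (Fin m) ℝ}
  {C : Matrix (Fin m) (Fin dx) ℝ} {B : Matrix (Fin dy) (Fin m) ℝ} {W W' : Layers L m}

lemma subG_congr (k : Fin (L + 1)) (hD : ∀ l ≤ k, D l = D' l)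
    (hW : ∀ l : Fin L, l.succ ≤ k → W l = W' l) : subG D C W k = subG D' C W' k := by
  induction k using Fin.induction with
  | zero => rw [subG_zero, subG_zero, hD 0 le_rfl]
  | succ k ih =>
    rw [subG_succ, subG_succ, hD k.succ le_rfl, hW k le_rfl,
      ih (fun l hl => hD l (hl.trans k.castSucc_lt_succ.le))
        fun l hl => hW l (hl.trans k.castSucc_lt_succ.le)]

lemma subM_congr (a k : Fin (L + 1)) (hD : ∀ l ≤ k, D l = D' l)
    (hW : ∀ l : Fin L, l.succ ≤ k → W l = W' l) : subM D W a k = subM D' W' a k := by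
  induction k using Fin.induction with
  | zero => rw [subM_zero, subM_zero, hD 0 le_rfl]
  | succ k ih =>
    rw [subM_succ, subM_succ, hD k.succ le_rfl, hW k le_rfl,
      ih (fun l hl => hD l (hl.trans k.castSucc_lt_succ.le))
        fun l hl => hW l (hl.trans k.castSucc_lt_succ.le)]

lemma subF_congr (k : Fin (L + 1)) (hD : ∀ l, k ≤ l → D l = D' l)
    (hW : ∀ l : Fin L, k ≤ l.castSucc → W l = W' l) : subF D B W k = subF D' B W' k := by
  induction k using Fin.reverseInduction with
  | last => rw [subF_last, subF_last, hD _ le_rfl]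
  | cast k ih =>
    rw [subF_castSucc, subF_castSucc, hD _ le_rfl, hW k le_rfl,
      ih (fun l hl => hD l (k.castSucc_lt_succ.le.trans hl))
        fun l hl => hW l (k.castSucc_lt_succ.le.trans hl)]

end Congr

section Continuity

variable {L m dx dy : ℕ} (D : Fin (L + 1) → Matrix (Fin m) (Fin m) ℝ)

lemma continuous_subG (k : Fin (L + 1)) :
    Continuous fun p : Matrix (Fin m) (Fin dx) ℝ × Layers L m => subG D p.1 p.2 k := by
  induction k using Fin.induction with
  | zero => exact continuous_const.matrix_mul continuous_fst
  | succ k ih =>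
    simp only [subG_succ]
    exact (continuous_const.matrix_mul ((continuous_apply k).comp continuous_snd)).matrix_mul ih

lemma continuous_subM (a k : Fin (L + 1)) :
    Continuous fun W : Layers L m => subM D W a k := by
  induction k using Fin.induction with
  | zero => exact continuous_const
  | succ k ih =>
    simp only [subM_succ]
    split_ifs
    · exact continuous_const
    · exact (continuous_const.matrix_mul (continuous_apply k)).matrix_mul ih

lemma continuous_subF (k : Fin (L + 1)) :
    Continuous fun p : Matrix (Fin dy) (Fin m) ℝ × Layers L m => subF D p.1 p.2 k := by
  induction k using Fin.reverseInduction with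
  | last => simp only [subF_last]; exact continuous_fst.matrix_mul continuous_const
  | cast k ih =>
    simp only [subF_castSucc]
    exact (ih.matrix_mul ((continuous_apply k).comp continuous_snd)).matrix_mul continuous_const

end Continuity

lemma layerMean_two_div {m d : ℕ} (k : ℕ) (u : Fin d → ℝ) :
    layerMean m (2 / (k : ℝ≥0)) u = m / k * sqNorm u := by
  unfold layerMean; push_cast; ring

lemma layerMean_square {m : ℕ} (hm : 0 < m) {d : ℕ} (u : Fin d → ℝ) :
    layerMean m (2 / (m : ℝ≥0)) u = sqNorm u := by
  have : (m : ℝ) ≠ 0 := by exact_mod_cast hm.ne'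
  rw [layerMean_two_div, div_self this, one_mul]

lemma measurable_test {X : Type*} [MeasurableSpace X] [TopologicalSpace X] [OpensMeasurableSpace X]
    {f : ℝ → ℝ≥0∞} (hf : Measurable f) {p q : ℕ} {A : X → Matrix (Fin p) (Fin q) ℝ}
    (hA : Continuous A) (u : Fin q → ℝ) (c : ℝ) :
    Measurable fun x => f (c * sqNorm (A x *ᵥ u)) := by
  have h : Continuous fun x => c * sqNorm (A x *ᵥ u) :=
    continuous_const.mul (continuous_sqNorm.comp (hA.matrix_mulVec continuous_const))
  exact hf.comp h.measurable

section Chains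

variable {L m dx dy : ℕ} {f : ℝ → ℝ≥0∞} {γ : ℝ≥0∞}

/-- Activation matrices given by a list of patterns. -/
noncomputable def patMats (S : Fin (L + 1) → Fin m → Bool) :
    Fin (L + 1) → Matrix (Fin m) (Fin m) ℝ := fun k => patMat (S k)

lemma two_div_ne_zero' (hm : 0 < m) : (2 / (m : ℝ≥0)) ≠ 0 := by positivity

/-- Each induction step redraws the newest weight matrix and pattern, on which the shorter product
does not depend. `S₀` and `C` stay fixed here, since `D_0` is a function of `C`. -/
lemma lintegral_subG_le (hm : 0 < m) (hf : StepBound m f γ) (S₀ : Fin m → Bool)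
    (C : Matrix (Fin m) (Fin dx) ℝ) (u : Fin dx → ℝ) {c : ℝ} (hc : 0 < c) (k : Fin (L + 1)) :
    ∫⁻ p, f (c * sqNorm (subG (patMats (Fin.cons S₀ p.1)) C p.2 k *ᵥ u))
        ∂chainLaw L L m (2 / (m : ℝ≥0)) ≤
      γ ^ (k : ℕ) * f (c * sqNorm (patMat S₀ *ᵥ (C *ᵥ u))) := by
  have hmeas : ∀ k : Fin (L + 1), Measurable fun p : (Fin L → Fin m → Bool) × Layers L m =>
      f (c * sqNorm (subG (patMats (Fin.cons S₀ p.1)) C p.2 k *ᵥ u)) := fun k =>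
    measurable_from_prod_countable_right fun S => measurable_test hf.meas
      ((continuous_subG (patMats (Fin.cons S₀ S)) k).comp
        (Continuous.prodMk (continuous_const (y := C)) continuous_id)) u c
  induction k using Fin.induction with
  | zero => simp [subG_zero, patMats]
  | succ k ih =>
    rw [lintegral_chainLaw_resample k k (hmeas k.succ)]
    calc _ ≤ ∫⁻ p, γ * f (c * sqNorm (subG (patMats (Fin.cons S₀ p.1)) C p.2 k.castSucc *ᵥ u))
          ∂chainLaw L L m (2 / (m : ℝ≥0)) := by
          refine lintegral_mono fun p => ?_
          have h := hf.step (two_div_ne_zero' hm)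
            (subG (patMats (Fin.cons S₀ p.1)) C p.2 k.castSucc *ᵥ u) hc
          rw [layerMean_square hm] at h
          refine le_trans (le_of_eq (lintegral_congr fun ω => ?_)) h
          have e : subG (patMats (Fin.cons S₀ (Function.update p.1 k ω.1))) C
              (Function.update p.2 k ω.2) k.castSucc =
              subG (patMats (Fin.cons S₀ p.1)) C p.2 k.castSucc := by
            refine subG_congr _ (fun l hl => ?_) fun l hl => ?_
            · rw [patMats, patMats, Fin.cons_update, Function.update_of_ne]
              rintro rfl
              exact absurd hl (not_le.2 k.castSucc_lt_succ)
            · rw [Function.update_of_ne]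
              rintro rfl
              exact absurd hl (not_le.2 l.castSucc_lt_succ)
          dsimp only
          rw [layerOut, subG_succ, Function.update_self, e, ← mulVec_mulVec, ← mulVec_mulVec]
          simp [patMats]
      _ = γ * ∫⁻ p, f (c * sqNorm (subG (patMats (Fin.cons S₀ p.1)) C p.2 k.castSucc *ᵥ u))
          ∂chainLaw L L m (2 / (m : ℝ≥0)) := lintegral_const_mul _ (hmeas _)
      _ ≤ γ * (γ ^ (k : ℕ) * f (c * sqNorm (patMat S₀ *ᵥ (C *ᵥ u)))) := mul_le_mul' le_rfl ih
      _ = _ := by rw [Fin.val_succ, pow_succ']; ring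

lemma sqNorm_patMat_le (S : Fin m → Bool) (v : Fin m → ℝ) :
    sqNorm (patMat S *ᵥ v) ≤ sqNorm v := by
  rw [sqNorm_patMat_mulVec]
  refine Finset.sum_le_sum fun j _ => ?_
  split_ifs
  · exact le_rfl
  · positivity

/-- The chain starts with the projection `D_a`, which may shorten `u`, and it may have fewer than
`k` layers: hence the monotonicity of `f` and `1 ≤ γ`. -/
lemma lintegral_subM_le (hm : 0 < m) (hf : StepBound m f γ) (hγ : 1 ≤ γ)
    (hmono : MonotoneOn f (Set.Ici 0)) (u : Fin m → ℝ) {c : ℝ} (hc : 0 < c) (a k : Fin (L + 1)) :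
    ∫⁻ p, f (c * sqNorm (subM (patMats p.1) p.2 a k *ᵥ u))
        ∂chainLaw (L + 1) L m (2 / (m : ℝ≥0)) ≤
      γ ^ (k : ℕ) * f (c * sqNorm u) := by
  have hmeas : ∀ k : Fin (L + 1), Measurable fun p : (Fin (L + 1) → Fin m → Bool) × Layers L m =>
      f (c * sqNorm (subM (patMats p.1) p.2 a k *ᵥ u)) := fun k =>
    measurable_from_prod_countable_right fun S => measurable_test hf.meas
      (continuous_subM (patMats S) a k) u c
  have hle : ∀ v : Fin m → ℝ, sqNorm v ≤ sqNorm u → f (c * sqNorm v) ≤ f (c * sqNorm u) := by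
    intro v hv
    exact hmono (mul_nonneg hc.le (sqNorm_nonneg v)) (mul_nonneg hc.le (sqNorm_nonneg u)) (by gcongr)
  have hstart : ∀ g : (Fin (L + 1) → Fin m → Bool) × Layers L m → Fin m → ℝ, ∀ n : ℕ,
      (∀ p, sqNorm (g p) ≤ sqNorm u) →
      ∫⁻ p, f (c * sqNorm (g p)) ∂chainLaw (L + 1) L m (2 / (m : ℝ≥0)) ≤
        γ ^ n * f (c * sqNorm u) := by
    intro g n hg
    refine (lintegral_mono fun p => hle _ (hg p)).trans ?_
    rw [lintegral_const, measure_univ, mul_one]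
    exact le_mul_of_one_le_left' (one_le_pow₀ hγ)
  induction k using Fin.induction with
  | zero =>
    refine hstart _ _ fun p => ?_
    rw [subM_zero]
    split_ifs
    · exact sqNorm_patMat_le _ _
    · simpa using sqNorm_nonneg u
  | succ k ih =>
    by_cases ha : a = k.succ
    · refine hstart _ _ fun p => ?_
      rw [subM_succ, if_pos ha]
      exact sqNorm_patMat_le _ _
    rw [lintegral_chainLaw_resample k.succ k (hmeas k.succ)]
    calc _ ≤ ∫⁻ p, γ * f (c * sqNorm (subM (patMats p.1) p.2 a k.castSucc *ᵥ u))
          ∂chainLaw (L + 1) L m (2 / (m : ℝ≥0)) := by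
          refine lintegral_mono fun p => ?_
          have h := hf.step (two_div_ne_zero' hm)
            (subM (patMats p.1) p.2 a k.castSucc *ᵥ u) hc
          rw [layerMean_square hm] at h
          refine le_trans (le_of_eq (lintegral_congr fun ω => ?_)) h
          have e : subM (patMats (Function.update p.1 k.succ ω.1)) (Function.update p.2 k ω.2) a
              k.castSucc = subM (patMats p.1) p.2 a k.castSucc := by
            refine subM_congr _ _ (fun l hl => ?_) fun l hl => ?_
            · rw [patMats, patMats, Function.update_of_ne]
              rintro rfl
              exact absurd hl (not_le.2 k.castSucc_lt_succ)
            · rw [Function.update_of_ne]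
              rintro rfl
              exact absurd hl (not_le.2 l.castSucc_lt_succ)
          dsimp only
          rw [layerOut, subM_succ, if_neg ha, Function.update_self, e, ← mulVec_mulVec,
            ← mulVec_mulVec]
          simp [patMats]
      _ = γ * ∫⁻ p, f (c * sqNorm (subM (patMats p.1) p.2 a k.castSucc *ᵥ u))
          ∂chainLaw (L + 1) L m (2 / (m : ℝ≥0)) := lintegral_const_mul _ (hmeas _)
      _ ≤ γ * (γ ^ (k : ℕ) * f (c * sqNorm u)) := mul_le_mul' le_rfl ih
      _ = _ := by rw [Fin.val_succ, pow_succ']; ring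

lemma measurePreserving_swap_pi {α β E : Type*} [Fintype α] [Fintype β] [MeasurableSpace E]
    (μ : Measure E) [IsProbabilityMeasure μ] :
    MeasurePreserving (fun (W : α → β → E) b a => W a b)
      (Measure.pi fun _ : α => Measure.pi fun _ : β => μ)
      (Measure.pi fun _ : β => Measure.pi fun _ : α => μ) := by
  have hm : Measurable fun (W : α → β → E) b a => W a b :=
    measurable_pi_lambda _ fun a => measurable_pi_lambda _ fun b =>
      (measurable_pi_apply a).comp (measurable_pi_apply b)
  refine ⟨hm, ?_⟩
  have h1 := Measure.infinitePi_map_curry (fun (_ : α) (_ : β) => μ)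
  have h2 := Measure.infinitePi_map_curry (fun (_ : β) (_ : α) => μ)
  simp only [Measure.infinitePi_eq_pi] at h1 h2
  have hs := measurePreserving_piCongrLeft (α := fun _ : β × α => E)
    (fun _ => μ) (Equiv.prodComm α β)
  rw [← h1, ← h2, ← hs.map_eq, Measure.map_map hm (MeasurableEquiv.measurable _),
    Measure.map_map (MeasurableEquiv.measurable _) (MeasurableEquiv.measurable _)]
  congr 1

lemma measurePreserving_transpose_gaussMatrix (p q : ℕ) (v : ℝ≥0) :
    MeasurePreserving (fun W : Matrix (Fin p) (Fin q) ℝ => Wᵀ) (gaussMatrix p q v)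
      (gaussMatrix q p v) :=
  measurePreserving_swap_pi (α := Fin p) (β := Fin q) (gaussianReal 0 v)

lemma lintegral_layerLaw_transpose (v : ℝ≥0)
    {h : (Fin m → Bool) × Matrix (Fin m) (Fin dy) ℝ → ℝ≥0∞} (hh : Measurable h) :
    ∫⁻ S, ∫⁻ W, h (S, Wᵀ) ∂gaussMatrix dy m v ∂patLaw m = ∫⁻ ω, h ω ∂layerLaw m dy v := by
  rw [lintegral_layerLaw v hh]
  refine lintegral_congr fun S => ?_
  exact (measurePreserving_transpose_gaussMatrix dy m v).lintegral_comp
    (hh.comp measurable_prodMk_left)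

lemma transpose_patMat (S : Fin m → Bool) : (patMat S)ᵀ = patMat S := by
  rw [patMat, diagonal_transpose]

/-- Read from the output side, `Fᵀ` gains the factor `D Wᵀ` at each step. Gaussian matrices keep
their law type under transposition, so this is again a gated layer, now paired with the pattern on
its input side. -/
lemma lintegral_subF_le_of_fixed (hm : 0 < m) (hf : StepBound m f γ)
    (B : Matrix (Fin dy) (Fin m) ℝ) (u : Fin dy → ℝ) {c : ℝ} (hc : 0 < c) (k : Fin (L + 1)) :
    ∫⁻ p, f (c * sqNorm ((subF (patMats p.1) B p.2 k)ᵀ *ᵥ u))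
        ∂chainLaw (L + 1) L m (2 / (m : ℝ≥0)) ≤
      γ ^ (L - k : ℕ) * ∫⁻ S, f (c * sqNorm (patMat S *ᵥ (Bᵀ *ᵥ u))) ∂patLaw m := by
  have hmeas : ∀ k : Fin (L + 1), Measurable fun p : (Fin (L + 1) → Fin m → Bool) × Layers L m =>
      f (c * sqNorm ((subF (patMats p.1) B p.2 k)ᵀ *ᵥ u)) := fun k =>
    measurable_from_prod_countable_right fun S => measurable_test hf.meas
      (((continuous_subF (patMats S) k).comp
        (Continuous.prodMk (continuous_const (y := B)) continuous_id)).matrix_transpose) u c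
  induction k using Fin.reverseInduction with
  | last =>
    have h1 : MeasurePreserving (fun p : (Fin (L + 1) → Fin m → Bool) × Layers L m =>
        p.1 (Fin.last L)) (chainLaw (L + 1) L m (2 / (m : ℝ≥0))) (patLaw m) :=
      (measurePreserving_eval (fun _ : Fin (L + 1) => patLaw m) (Fin.last L)).comp
        measurePreserving_fst
    rw [← h1.lintegral_comp (measurable_of_countable _)]
    simp only [Fin.val_last, tsub_self, pow_zero, one_mul]
    refine le_of_eq (lintegral_congr fun p => ?_)
    rw [subF_last, transpose_mul, patMats, transpose_patMat, mulVec_mulVec]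
  | cast k ih =>
    rw [lintegral_chainLaw_resample k.castSucc k (hmeas k.castSucc)]
    calc _ ≤ ∫⁻ p, γ * f (c * sqNorm ((subF (patMats p.1) B p.2 k.succ)ᵀ *ᵥ u))
          ∂chainLaw (L + 1) L m (2 / (m : ℝ≥0)) := by
          refine lintegral_mono fun p => ?_
          have h := hf.step (two_div_ne_zero' hm)
            ((subF (patMats p.1) B p.2 k.succ)ᵀ *ᵥ u) hc
          rw [layerMean_square hm] at h
          have hmo : Measurable fun ω => f (c * layerOut (m := m)
              ((subF (patMats p.1) B p.2 k.succ)ᵀ *ᵥ u) ω) :=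
            hf.meas.comp ((measurable_layerOut _).const_mul c)
          have hmt : Measurable fun ω : (Fin m → Bool) × Matrix (Fin m) (Fin m) ℝ =>
              f (c * layerOut (m := m) ((subF (patMats p.1) B p.2 k.succ)ᵀ *ᵥ u) (ω.1, ω.2ᵀ)) :=
            hmo.comp (measurable_fst.prodMk
              ((measurePreserving_transpose_gaussMatrix m m 0).measurable.comp measurable_snd))
          rw [← lintegral_layerLaw_transpose _ hmo, ← lintegral_layerLaw _ hmt] at h
          refine le_trans (le_of_eq (lintegral_congr fun ω => ?_)) h
          have e : subF (patMats (Function.update p.1 k.castSucc ω.1)) B (Function.update p.2 k ω.2)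
              k.succ = subF (patMats p.1) B p.2 k.succ := by
            refine subF_congr _ (fun l hl => ?_) fun l hl => ?_
            · rw [patMats, patMats, Function.update_of_ne]
              rintro rfl
              exact absurd hl (not_le.2 k.castSucc_lt_succ)
            · rw [Function.update_of_ne]
              rintro rfl
              exact absurd hl (not_le.2 l.castSucc_lt_succ)
          dsimp only
          rw [layerOut, subF_castSucc, Function.update_self, e, transpose_mul, transpose_mul,
            ← mulVec_mulVec, ← mulVec_mulVec]
          simp [patMats, transpose_patMat]
      _ = γ * ∫⁻ p, f (c * sqNorm ((subF (patMats p.1) B p.2 k.succ)ᵀ *ᵥ u))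
          ∂chainLaw (L + 1) L m (2 / (m : ℝ≥0)) := lintegral_const_mul _ (hmeas _)
      _ ≤ _ := mul_le_mul' le_rfl ih
      _ = _ := by
        rw [← mul_assoc, ← pow_succ']
        congr 2
        simp only [Fin.val_succ, Fin.val_castSucc]
        omega

lemma lintegral_subF_le (hm : 0 < m) (hf : StepBound m f γ) {v : ℝ≥0} (hv : v ≠ 0)
    (u : Fin dy → ℝ) {c : ℝ} (hc : 0 < c) (k : Fin (L + 1)) :
    ∫⁻ B, ∫⁻ p, f (c * sqNorm ((subF (patMats p.1) B p.2 k)ᵀ *ᵥ u))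
        ∂chainLaw (L + 1) L m (2 / (m : ℝ≥0)) ∂gaussMatrix dy m v ≤
      γ ^ (L - k + 1 : ℕ) * f (c * layerMean m v u) := by
  have hmo : Measurable fun ω => f (c * layerOut (m := m) u ω) :=
    hf.meas.comp ((measurable_layerOut _).const_mul c)
  have hmS : ∀ S : Fin m → Bool, Measurable fun B : Matrix (Fin dy) (Fin m) ℝ =>
      f (c * sqNorm (patMat S *ᵥ (Bᵀ *ᵥ u))) := by
    intro S
    simp only [mulVec_mulVec]
    exact measurable_test hf.meas (continuous_const.matrix_mul continuous_id.matrix_transpose) u c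
  have hu : Measurable fun q : (Fin m → Bool) × Matrix (Fin dy) (Fin m) ℝ =>
      f (c * sqNorm (patMat q.1 *ᵥ (q.2ᵀ *ᵥ u))) := measurable_from_prod_countable_right hmS
  have h := hf.step hv u hc
  rw [← lintegral_layerLaw_transpose _ hmo] at h
  calc _ ≤ ∫⁻ B, γ ^ (L - k : ℕ) * ∫⁻ S, f (c * sqNorm (patMat S *ᵥ (Bᵀ *ᵥ u))) ∂patLaw m
        ∂gaussMatrix dy m v := lintegral_mono fun B => lintegral_subF_le_of_fixed hm hf B u hc k
    _ = γ ^ (L - k : ℕ) * ∫⁻ B, ∫⁻ S, f (c * sqNorm (patMat S *ᵥ (Bᵀ *ᵥ u))) ∂patLaw m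
        ∂gaussMatrix dy m v := lintegral_const_mul _ hu.lintegral_prod_left'
    _ ≤ γ ^ (L - k : ℕ) * (γ * f (c * layerMean m v u)) := by
        refine mul_le_mul' le_rfl ?_
        rw [lintegral_lintegral_swap]
        · exact h
        · exact (hu.comp measurable_swap).aemeasurable
    _ = _ := by rw [pow_succ, mul_assoc]

end Chains


/-! ### Nets on spheres and extremal values of quadratic forms. -/

/-- Volume comparison: the balls of radius `ε/2` about the points are disjoint and lie in the ball
of radius `1 + ε/2`. -/
lemma card_le_of_separated_of_norm_le_one {E : Type*} [NormedAddCommGroup E] [NormedSpace ℝ E]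
    [FiniteDimensional ℝ E] {ε : ℝ} (hε : 0 < ε) (s : Finset E) (hs : ∀ c ∈ s, ‖c‖ ≤ 1)
    (h : ∀ c ∈ s, ∀ d ∈ s, c ≠ d → ε ≤ ‖c - d‖) :
    (s.card : ℝ) ≤ (1 + 2 / ε) ^ Module.finrank ℝ E := by
  borelize E
  let μ : Measure E := Measure.addHaar
  set δ : ℝ := ε / 2 with hδ
  set ρ : ℝ := 1 + ε / 2 with hρ
  have δpos : 0 < δ := by positivity
  have ρpos : 0 < ρ := by positivity
  have D : Set.Pairwise (s : Set E) (Function.onFun Disjoint fun c => Metric.ball (c : E) δ) := by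
    rintro c hc d hd hcd
    apply Metric.ball_disjoint_ball
    rw [dist_eq_norm]
    have := h c hc d hd hcd
    linarith
  have A_subset : (⋃ c ∈ s, Metric.ball (c : E) δ) ⊆ Metric.ball (0 : E) ρ := by
    refine Set.iUnion₂_subset fun x hx => Metric.ball_subset_ball' ?_
    rw [dist_zero_right]
    linarith [hs x hx]
  have I : (s.card : ℝ≥0∞) * ENNReal.ofReal (δ ^ Module.finrank ℝ E) * μ (Metric.ball 0 1) ≤
      ENNReal.ofReal (ρ ^ Module.finrank ℝ E) * μ (Metric.ball 0 1) :=
    calc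
      _ = μ (⋃ c ∈ s, Metric.ball (c : E) δ) := by
        rw [measure_biUnion_finset D fun c _ => measurableSet_ball]
        simp only [μ.addHaar_ball_of_pos _ δpos]
        simp only [Finset.sum_const, nsmul_eq_mul, mul_assoc]
      _ ≤ μ (Metric.ball (0 : E) ρ) := measure_mono A_subset
      _ = _ := by simp only [μ.addHaar_ball_of_pos _ ρpos]
  have J : (s.card : ℝ≥0∞) * ENNReal.ofReal (δ ^ Module.finrank ℝ E) ≤
      ENNReal.ofReal (ρ ^ Module.finrank ℝ E) :=
    (ENNReal.mul_le_mul_iff_left (Metric.measure_ball_pos _ _ zero_lt_one).ne'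
      measure_ball_lt_top.ne).1 I
  have K := ENNReal.toReal_le_of_le_ofReal (pow_nonneg ρpos.le _) J
  rw [ENNReal.toReal_mul, ENNReal.toReal_natCast, ENNReal.toReal_ofReal (by positivity)] at K
  have e : (1 : ℝ) + 2 / ε = ρ / δ := by rw [hρ, hδ]; field_simp; ring
  rw [e, div_pow, le_div_iff₀ (by positivity)]
  exact K

/-- A separated subset of the sphere of maximal cardinality is a net, since an uncovered point could
be added to it. -/
lemma exists_sphere_net {E : Type*} [NormedAddCommGroup E] [NormedSpace ℝ E]
    [FiniteDimensional ℝ E] {ε : ℝ} (hε : 0 < ε) :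
    ∃ s : Finset E, (s.card : ℝ) ≤ (1 + 2 / ε) ^ Module.finrank ℝ E ∧ (∀ c ∈ s, ‖c‖ = 1) ∧
      ∀ u : E, ‖u‖ = 1 → ∃ c ∈ s, ‖c - u‖ ≤ ε := by
  classical
  let P : Finset E → Prop := fun s =>
    (∀ c ∈ s, ‖c‖ = 1) ∧ ∀ c ∈ s, ∀ d ∈ s, c ≠ d → ε ≤ ‖c - d‖
  have hcard : ∀ s, P s → (s.card : ℝ) ≤ (1 + 2 / ε) ^ Module.finrank ℝ E := fun s hs =>
    card_le_of_separated_of_norm_le_one hε s (fun c hc => (hs.1 c hc).le) hs.2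
  have hbdd : BddAbove {n : ℕ | ∃ s, P s ∧ s.card = n} := by
    refine ⟨⌊(1 + 2 / ε) ^ Module.finrank ℝ E⌋₊, ?_⟩
    rintro n ⟨s, hs, rfl⟩
    exact Nat.le_floor (hcard s hs)
  have hne : {n : ℕ | ∃ s, P s ∧ s.card = n}.Nonempty := ⟨0, ∅, by simp [P], rfl⟩
  obtain ⟨s, hs, hsc⟩ := Nat.sSup_mem hne hbdd
  refine ⟨s, hcard s hs, hs.1, fun u hu => ?_⟩
  by_contra! hcon
  have hus : u ∉ s := fun h => by
    have := hcon u h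
    rw [sub_self, norm_zero] at this
    linarith
  have hP : P (insert u s) := by
    refine ⟨fun c hc => ?_, fun c hc d hd hcd => ?_⟩
    · rcases Finset.mem_insert.1 hc with rfl | hc
      · exact hu
      · exact hs.1 c hc
    · rcases Finset.mem_insert.1 hc with hc' | hc' <;>
        rcases Finset.mem_insert.1 hd with hd' | hd'
      · exact absurd (hc'.trans hd'.symm) hcd
      · rw [hc', norm_sub_rev]; exact (hcon d hd').le
      · rw [hd']; exact (hcon c hc').le
      · exact hs.2 c hc' d hd' hcd
  have hle : (insert u s).card ≤ sSup {n : ℕ | ∃ s, P s ∧ s.card = n} :=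
    le_csSup hbdd ⟨_, hP, rfl⟩
  rw [Finset.card_insert_of_notMem hus, hsc] at hle
  omega

/-- Vectors supported in `T`. -/
def SuppIn {m : ℕ} (T : Finset (Fin m)) (u : Fin m → ℝ) : Prop := ∀ a ∉ T, u a = 0

lemma sqNorm_eq_norm_sq {d : ℕ} (v : Fin d → ℝ) : sqNorm v = ‖WithLp.toLp 2 v‖ ^ 2 := by
  rw [EuclideanSpace.real_norm_sq_eq]; rfl

lemma exists_net {m : ℕ} (T : Finset (Fin m)) {ε : ℝ} (hε : 0 < ε) :
    ∃ N : Finset (Fin m → ℝ), (N.card : ℝ) ≤ (1 + 2 / ε) ^ T.card ∧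
      (∀ v ∈ N, SuppIn T v ∧ sqNorm v = 1) ∧
      ∀ u, SuppIn T u → sqNorm u = 1 → ∃ v ∈ N, sqNorm (v - u) ≤ ε ^ 2 := by
  classical
  obtain ⟨s, hs, hs1, hs2⟩ := exists_sphere_net (E := EuclideanSpace ℝ T) hε
  let ext : EuclideanSpace ℝ T → Fin m → ℝ := fun v a => if h : a ∈ T then v ⟨a, h⟩ else 0
  have hsq : ∀ v, sqNorm (ext v) = ‖v‖ ^ 2 := by
    intro v
    rw [EuclideanSpace.real_norm_sq_eq, sqNorm, ← Finset.sum_subset (Finset.subset_univ T),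
      ← Finset.sum_coe_sort T]
    · refine Finset.sum_congr rfl fun a _ => ?_
      simp [ext]
    · intro a _ ha
      simp [ext, ha]
  have hsupp : ∀ v, SuppIn T (ext v) := fun v a ha => by simp [ext, ha]
  refine ⟨s.image ext, ?_, ?_, ?_⟩
  · refine le_trans (by exact_mod_cast Finset.card_image_le) (hs.trans ?_)
    simp
  · intro v hv
    obtain ⟨w, hw, rfl⟩ := Finset.mem_image.1 hv
    exact ⟨hsupp w, by rw [hsq, hs1 w hw, one_pow]⟩
  · intro u huT hu
    set w : EuclideanSpace ℝ T := WithLp.toLp 2 fun a => u a with hw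
    have hwu : ext w = u := by
      funext a
      by_cases ha : a ∈ T
      · simp [ext, ha, hw]
      · simp [ext, ha, huT a ha]
    have hw1 : ‖w‖ = 1 := by
      have := hsq w
      rw [hwu, hu] at this
      exact (pow_eq_one_iff_of_nonneg (norm_nonneg _) two_ne_zero).1 this.symm
    obtain ⟨c, hc, hcw⟩ := hs2 w hw1
    refine ⟨ext c, Finset.mem_image_of_mem _ hc, ?_⟩
    have : ext c - u = ext (c - w) := by
      funext a
      rw [← hwu]
      by_cases ha : a ∈ T <;> simp [ext, ha]
    rw [this, hsq]
    gcongr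

lemma sqNorm_add_smul {d : ℕ} (u w : Fin d → ℝ) (t : ℝ) :
    sqNorm (u + t • w) = sqNorm u + t * (2 * (u ⬝ᵥ w)) + t * t * sqNorm w := by
  simp only [sqNorm, dotProduct, Finset.mul_sum, ← Finset.sum_add_distrib]
  refine Finset.sum_congr rfl fun j _ => ?_
  simp only [Pi.add_apply, Pi.smul_apply, smul_eq_mul]
  ring

lemma sqNorm_smul {d : ℕ} (t : ℝ) (w : Fin d → ℝ) : sqNorm (t • w) = t ^ 2 * sqNorm w := by
  simp [sqNorm, Finset.mul_sum, mul_pow]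

lemma SuppIn.add_smul {m : ℕ} {T : Finset (Fin m)} {u w : Fin m → ℝ} (hu : SuppIn T u)
    (hw : SuppIn T w) (t : ℝ) : SuppIn T (u + t • w) := fun a ha => by
  simp [hu a ha, hw a ha]

lemma SuppIn.sub {m : ℕ} {T : Finset (Fin m)} {u w : Fin m → ℝ} (hu : SuppIn T u)
    (hw : SuppIn T w) : SuppIn T (u - w) := fun a ha => by
  simp [hu a ha, hw a ha]

/-- Translating a nonnegative quadratic form by a zero does not change it. -/
lemma quad_eq_of_zero {m p : ℕ} {T : Finset (Fin m)} (A : Matrix (Fin p) (Fin m) ℝ) {c₁ c₂ : ℝ}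
    (hQ : ∀ x, SuppIn T x → 0 ≤ c₁ * sqNorm x + c₂ * sqNorm (A *ᵥ x)) {u v : Fin m → ℝ}
    (hu : SuppIn T u) (hv : SuppIn T v) (h0 : c₁ * sqNorm u + c₂ * sqNorm (A *ᵥ u) = 0) :
    c₁ * sqNorm v + c₂ * sqNorm (A *ᵥ v) =
      c₁ * sqNorm (v - u) + c₂ * sqNorm (A *ᵥ (v - u)) := by
  set w := v - u
  have hw : SuppIn T w := hv.sub hu
  have hexp : ∀ t : ℝ, c₁ * sqNorm (u + t • w) + c₂ * sqNorm (A *ᵥ (u + t • w)) =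
      (c₁ * sqNorm w + c₂ * sqNorm (A *ᵥ w)) * (t * t) +
        (2 * (c₁ * (u ⬝ᵥ w) + c₂ * ((A *ᵥ u) ⬝ᵥ (A *ᵥ w)))) * t + 0 := by
    intro t
    rw [mulVec_add, mulVec_smul, sqNorm_add_smul, sqNorm_add_smul]
    linear_combination h0
  -- A nonnegative quadratic in `t` without constant term has no linear term either.
  have hd := discrim_le_zero fun t => (hexp t) ▸ hQ _ (hu.add_smul hw t)
  have hb : 2 * (c₁ * (u ⬝ᵥ w) + c₂ * ((A *ᵥ u) ⬝ᵥ (A *ᵥ w))) = 0 := by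
    rw [discrim, mul_zero, sub_zero] at hd
    exact pow_eq_zero_iff two_ne_zero |>.1 (le_antisymm hd (sq_nonneg _))
  have h1 := hexp 1
  rw [one_smul, show u + w = v by simp [w], hb] at h1
  rw [h1]; ring

lemma isCompact_sphere_suppIn {m : ℕ} (T : Finset (Fin m)) :
    IsCompact {u : Fin m → ℝ | SuppIn T u ∧ sqNorm u = 1} := by
  refine Metric.isCompact_of_isClosed_isBounded ?_ ?_
  · refine IsClosed.inter ?_ (isClosed_eq continuous_sqNorm continuous_const)
    have : {u : Fin m → ℝ | SuppIn T u} = ⋂ a, ⋂ (_ : a ∉ T), {u | u a = 0} := by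
      ext; simp [SuppIn]
    change IsClosed {u : Fin m → ℝ | SuppIn T u}
    rw [this]
    exact isClosed_iInter fun a => isClosed_iInter fun _ =>
      isClosed_eq (continuous_apply a) continuous_const
  · refine (Metric.isBounded_closedBall (x := (0 : Fin m → ℝ)) (r := 1)).subset ?_
    rintro u ⟨-, hu⟩
    rw [mem_closedBall_zero_iff, pi_norm_le_iff_of_nonneg zero_le_one]
    intro a
    have : u a ^ 2 ≤ sqNorm u :=
      Finset.single_le_sum (f := fun a => u a ^ 2) (fun _ _ => sq_nonneg _) (Finset.mem_univ a)
    rw [hu] at this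
    rw [Real.norm_eq_abs]
    exact (sq_le_one_iff_abs_le_one _).1 this

lemma exists_unit_multiple {m : ℕ} {T : Finset (Fin m)} {u : Fin m → ℝ} (hu : SuppIn T u)
    (h0 : u ≠ 0) : ∃ w, SuppIn T w ∧ sqNorm w = 1 ∧ u = √(sqNorm u) • w := by
  have h1 : 0 < sqNorm u := lt_of_le_of_ne (sqNorm_nonneg u) fun h => h0 (sqNorm_eq_zero.1 h.symm)
  have h2 : 0 < √(sqNorm u) := Real.sqrt_pos.2 h1
  refine ⟨(√(sqNorm u))⁻¹ • u, fun a ha => by simp [hu a ha], ?_, ?_⟩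
  · rw [sqNorm_smul, inv_pow, Real.sq_sqrt h1.le, inv_mul_cancel₀ h1.ne']
  · rw [smul_smul, mul_inv_cancel₀ h2.ne', one_smul]

lemma quad_scale {m p : ℕ} {T : Finset (Fin m)} (A : Matrix (Fin p) (Fin m) ℝ) {c₁ c₂ : ℝ}
    (h : ∀ w, SuppIn T w → sqNorm w = 1 → 0 ≤ c₁ * sqNorm w + c₂ * sqNorm (A *ᵥ w))
    (u : Fin m → ℝ) (hu : SuppIn T u) : 0 ≤ c₁ * sqNorm u + c₂ * sqNorm (A *ᵥ u) := by
  by_cases h0 : u = 0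
  · simp [h0]
  obtain ⟨w, hw, hw1, e⟩ := exists_unit_multiple hu h0
  rw [e, mulVec_smul, sqNorm_smul, sqNorm_smul]
  nlinarith [h w hw hw1, sq_nonneg √(sqNorm u)]

/-- At a maximizer `w` with value `μ`, the form `μ‖x‖² - ‖Ax‖²` is nonnegative and vanishes, so for
a net point `v` near `w` it equals its value at `v - w`, at most `μ ε²`. The loss is thus quadratic
in `ε`, not linear. -/
lemma sqNorm_mulVec_le_of_net {m p : ℕ} {T : Finset (Fin m)} (A : Matrix (Fin p) (Fin m) ℝ)
    {ε a : ℝ} (hε : ε ^ 2 < 1) {N : Finset (Fin m → ℝ)}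
    (hN1 : ∀ v ∈ N, SuppIn T v ∧ sqNorm v = 1)
    (hN : ∀ u, SuppIn T u → sqNorm u = 1 → ∃ v ∈ N, sqNorm (v - u) ≤ ε ^ 2)
    (ha : ∀ v ∈ N, sqNorm (A *ᵥ v) ≤ a) {u : Fin m → ℝ} (hu : SuppIn T u) :
    sqNorm (A *ᵥ u) ≤ a / (1 - ε ^ 2) * sqNorm u := by
  by_cases hu0 : u = 0
  · simp [hu0]
  obtain ⟨w₀, hw₀, hw₀1, -⟩ := exists_unit_multiple hu hu0
  have hcont : Continuous fun x : Fin m → ℝ => sqNorm (A *ᵥ x) :=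
    continuous_sqNorm.comp (continuous_const.matrix_mulVec continuous_id)
  obtain ⟨w, ⟨hw, hw1⟩, hmax⟩ := (isCompact_sphere_suppIn T).exists_isMaxOn ⟨w₀, hw₀, hw₀1⟩
    hcont.continuousOn
  set μ := sqNorm (A *ᵥ w) with hμ
  have hQ : ∀ x, SuppIn T x → 0 ≤ μ * sqNorm x + (-1) * sqNorm (A *ᵥ x) := by
    refine quad_scale A fun x hx hx1 => ?_
    have : sqNorm (A *ᵥ x) ≤ μ := hmax ⟨hx, hx1⟩
    rw [hx1]; linarith
  obtain ⟨v, hv, hvw⟩ := hN w hw hw1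
  have h1 := quad_eq_of_zero A hQ hw (hN1 v hv).1 (by rw [hw1, ← hμ]; ring)
  rw [(hN1 v hv).2] at h1
  have h2 := ha v hv
  have h3 : μ * sqNorm (v - w) ≤ μ * ε ^ 2 :=
    mul_le_mul_of_nonneg_left hvw (sqNorm_nonneg _)
  have h4 := sqNorm_nonneg (A *ᵥ (v - w))
  have h5 : μ ≤ a / (1 - ε ^ 2) := by
    rw [le_div_iff₀ (by linarith)]; linarith
  have h6 := hQ u hu
  have h7 := mul_le_mul_of_nonneg_right h5 (sqNorm_nonneg u)
  linarith

/-- The same argument at a minimizer, with the form `‖Ax‖² - μ‖x‖²`; its value at `v - w` is at most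
`M ε²`. -/
lemma le_sqNorm_mulVec_of_net {m p : ℕ} {T : Finset (Fin m)} (A : Matrix (Fin p) (Fin m) ℝ)
    {ε b M : ℝ} {N : Finset (Fin m → ℝ)}
    (hN1 : ∀ v ∈ N, SuppIn T v ∧ sqNorm v = 1)
    (hN : ∀ u, SuppIn T u → sqNorm u = 1 → ∃ v ∈ N, sqNorm (v - u) ≤ ε ^ 2)
    (hb : ∀ v ∈ N, b ≤ sqNorm (A *ᵥ v))
    (hM : ∀ u, SuppIn T u → sqNorm (A *ᵥ u) ≤ M * sqNorm u) (hM0 : 0 ≤ M)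
    {u : Fin m → ℝ} (hu : SuppIn T u) :
    (b - ε ^ 2 * M) * sqNorm u ≤ sqNorm (A *ᵥ u) := by
  by_cases hu0 : u = 0
  · simp [hu0]
  obtain ⟨w₀, hw₀, hw₀1, -⟩ := exists_unit_multiple hu hu0
  have hcont : Continuous fun x : Fin m → ℝ => sqNorm (A *ᵥ x) :=
    continuous_sqNorm.comp (continuous_const.matrix_mulVec continuous_id)
  obtain ⟨w, ⟨hw, hw1⟩, hmin⟩ := (isCompact_sphere_suppIn T).exists_isMinOn ⟨w₀, hw₀, hw₀1⟩
    hcont.continuousOn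
  set μ := sqNorm (A *ᵥ w) with hμ
  have hμ0 : 0 ≤ μ := sqNorm_nonneg _
  have hQ : ∀ x, SuppIn T x → 0 ≤ (-μ) * sqNorm x + 1 * sqNorm (A *ᵥ x) := by
    refine quad_scale A fun x hx hx1 => ?_
    have : μ ≤ sqNorm (A *ᵥ x) := hmin ⟨hx, hx1⟩
    rw [hx1]; linarith
  obtain ⟨v, hv, hvw⟩ := hN w hw hw1
  have h1 := quad_eq_of_zero A hQ hw (hN1 v hv).1 (by rw [hw1, ← hμ]; ring)
  rw [(hN1 v hv).2] at h1
  have h2 := hb v hv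
  have h3 := hM _ ((hN1 v hv).1.sub hw)
  have h4 : M * sqNorm (v - w) ≤ M * ε ^ 2 := mul_le_mul_of_nonneg_left hvw hM0
  have h5 : 0 ≤ μ * sqNorm (v - w) := mul_nonneg hμ0 (sqNorm_nonneg _)
  have h6 := hQ u hu
  have h7 : b - ε ^ 2 * M ≤ μ := by linarith
  have h8 := mul_le_mul_of_nonneg_right h7 (sqNorm_nonneg u)
  linarith


/-! ### From length distortion to operator norms and eigenvalues. -/

section Spectrum

variable {p q : ℕ}

lemma sqrt_sqNorm {d : ℕ} (v : Fin d → ℝ) : √(sqNorm v) = ‖WithLp.toLp 2 v‖ := by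
  rw [sqNorm_eq_norm_sq, Real.sqrt_sq (norm_nonneg _)]

lemma dotProduct_le_sqrt {d : ℕ} (u v : Fin d → ℝ) : u ⬝ᵥ v ≤ √(sqNorm u) * √(sqNorm v) :=
  Real.sum_mul_le_sqrt_mul_sqrt _ _ _

lemma sqNorm_eq_dotProduct {d : ℕ} (v : Fin d → ℝ) : sqNorm v = v ⬝ᵥ v := by
  simp [sqNorm, dotProduct, pow_two]

lemma sqNorm_transpose_mulVec (A : Matrix (Fin p) (Fin q) ℝ) (u : Fin p → ℝ) :
    sqNorm (Aᵀ *ᵥ u) = u ⬝ᵥ (A *ᵥ (Aᵀ *ᵥ u)) := by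
  rw [sqNorm_eq_dotProduct, dotProduct_mulVec u, ← mulVec_transpose]

/-- `A` stretches Euclidean lengths by at most `c`. -/
structure OpBound (A : Matrix (Fin p) (Fin q) ℝ) (c : ℝ) : Prop where
  nonneg : 0 ≤ c
  le : ∀ u, √(sqNorm (A *ᵥ u)) ≤ c * √(sqNorm u)

lemma le_of_sqrt_mul_self_le {x y : ℝ} (hx : 0 ≤ x) (hy : 0 ≤ y) (h : x ≤ y * √x) : √x ≤ y := by
  rcases (Real.sqrt_nonneg x).eq_or_lt with h0 | h0
  · rwa [← h0]
  · nth_rewrite 1 [← Real.mul_self_sqrt hx] at h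
    exact le_of_mul_le_mul_right h h0

lemma OpBound.transpose {A : Matrix (Fin p) (Fin q) ℝ} {c : ℝ} (h : OpBound A c) :
    OpBound Aᵀ c := by
  refine ⟨h.nonneg, fun u => le_of_sqrt_mul_self_le (sqNorm_nonneg _)
    (mul_nonneg h.nonneg (Real.sqrt_nonneg _)) ?_⟩
  calc sqNorm (Aᵀ *ᵥ u) = u ⬝ᵥ (A *ᵥ (Aᵀ *ᵥ u)) := sqNorm_transpose_mulVec A u
    _ ≤ √(sqNorm u) * √(sqNorm (A *ᵥ (Aᵀ *ᵥ u))) := dotProduct_le_sqrt _ _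
    _ ≤ √(sqNorm u) * (c * √(sqNorm (Aᵀ *ᵥ u))) := by gcongr; exact h.le _
    _ = _ := by ring

lemma opBound_specNorm (A : Matrix (Fin p) (Fin q) ℝ) : OpBound A (specNorm A) := by
  refine ⟨NNReal.coe_nonneg _, fun u => ?_⟩
  rw [sqrt_sqNorm, sqrt_sqNorm]
  exact (Matrix.toEuclideanLin A).toContinuousLinearMap.le_opNorm (WithLp.toLp 2 u)

lemma spectrumWithin_of_sqNorm {A : Matrix (Fin p) (Fin q) ℝ} {lo hi : ℝ} (hhi : 0 ≤ hi)
    (h : ∀ u, lo * sqNorm u ≤ sqNorm (A *ᵥ u) ∧ sqNorm (A *ᵥ u) ≤ hi * sqNorm u) :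
    SpectrumWithin (Aᵀ * A) lo hi := by
  constructor
  · refine ContinuousLinearMap.opNorm_le_bound _ hhi fun v => ?_
    obtain ⟨u, rfl⟩ : ∃ u, WithLp.toLp 2 u = v := ⟨_, rfl⟩
    change ‖WithLp.toLp 2 ((Aᵀ * A) *ᵥ u)‖ ≤ hi * ‖WithLp.toLp 2 u‖
    rw [← sqrt_sqNorm, ← sqrt_sqNorm, ← mulVec_mulVec]
    have hs : ∀ u, √(sqNorm (A *ᵥ u)) ≤ √hi * √(sqNorm u) := fun u => by
      rw [← Real.sqrt_mul hhi]
      exact Real.sqrt_le_sqrt (h u).2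
    have hA : OpBound A √hi := ⟨Real.sqrt_nonneg _, hs⟩
    calc √(sqNorm (Aᵀ *ᵥ (A *ᵥ u))) ≤ √hi * √(sqNorm (A *ᵥ u)) := hA.transpose.le _
      _ ≤ √hi * (√hi * √(sqNorm u)) := by gcongr; exact hs u
      _ = _ := by rw [← mul_assoc, Real.mul_self_sqrt hhi]
  · intro ev hev
    obtain ⟨u, hu⟩ := hev.exists_hasEigenvector
    have h1 : (Aᵀ * A) *ᵥ u = ev • u := by
      have := hu.apply_eq_smul
      rwa [Matrix.toLin'_apply] at this
    have h2 : 0 < sqNorm u :=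
      lt_of_le_of_ne (sqNorm_nonneg u) fun h => hu.2 (sqNorm_eq_zero.1 h.symm)
    have h3 : sqNorm (A *ᵥ u) = ev * sqNorm u := by
      have := sqNorm_eq_dotProduct (A *ᵥ u)
      rw [this, dotProduct_mulVec, ← mulVec_transpose, mulVec_mulVec, h1, smul_dotProduct,
        ← sqNorm_eq_dotProduct, smul_eq_mul]
    obtain ⟨h4, h5⟩ := h u
    rw [h3] at h4 h5
    exact ⟨le_of_mul_le_mul_right h4 h2, le_of_mul_le_mul_right h5 h2⟩

end Spectrum

/-! ### Telescoping and stability under changes of the weights. -/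

section Telescope

variable {L m dx dy : ℕ} (D : Fin (L + 1) → Matrix (Fin m) (Fin m) ℝ)
  (C : Matrix (Fin m) (Fin dx) ℝ) (B : Matrix (Fin dy) (Fin m) ℝ) (W W' : Layers L m)

lemma subM_of_lt {a b : Fin (L + 1)} (h : b < a) : subM D W a b = 0 := by
  induction b using Fin.induction with
  | zero => rw [subM_zero, if_neg h.ne']
  | succ k ih => rw [subM_succ, if_neg h.ne', ih (k.castSucc_lt_succ.trans h), mul_zero]

lemma subM_self (a : Fin (L + 1)) : subM D W a a = D a := by
  refine Fin.cases ?_ (fun k => ?_) a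
  · rw [subM_zero, if_pos rfl]
  · rw [subM_succ, if_pos rfl]

/-- The recursion at the input end, as `subF` needs it; the definition of `subM` unfolds at the
output end. -/
lemma subM_castSucc (k : Fin L) (b : Fin (L + 1)) : subM D W k.castSucc b =
    subM D W k.succ b * W k * D k.castSucc + if b = k.castSucc then D k.castSucc else 0 := by
  induction b using Fin.induction with
  | zero =>
    rw [subM_of_lt D W k.succ_pos, subM_zero]
    by_cases h : k.castSucc = 0
    · simp [h]
    · simp [h, Ne.symm h]
  | succ b ih =>
    rcases lt_trichotomy b k with h | h | h
    · have h1 : b.succ < k.succ := Fin.succ_lt_succ_iff.2 h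
      rw [subM_of_lt D W h1]
      by_cases h2 : b.succ = k.castSucc
      · rw [← h2, subM_self]; simp
      · have h3 : b.succ < k.castSucc := lt_of_le_of_ne (by
          rw [Fin.le_def, Fin.val_succ, Fin.val_castSucc]; exact h) h2
        rw [subM_of_lt D W h3]; simp [h2]
    · subst h
      rw [subM_self, subM_succ, if_neg b.castSucc_lt_succ.ne, subM_self,
        if_neg b.castSucc_lt_succ.ne', add_zero]
    · have h1 : k.castSucc ≠ b.succ :=
        (lt_trans (Fin.castSucc_lt_castSucc_iff.2 h) b.castSucc_lt_succ).ne
      have h2 : k.succ ≠ b.succ := (Fin.succ_lt_succ_iff.2 h).ne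
      have h3 : b.castSucc ≠ k.castSucc := (Fin.castSucc_lt_castSucc_iff.2 h).ne'
      rw [subM_succ, if_neg h1, ih, subM_succ, if_neg h2, if_neg h3, if_neg h1.symm]
      simp only [add_zero, Matrix.mul_assoc]

/-- In each term the factors after the changed layer carry the old weights and those before it the
new ones. As `subM` vanishes out of order, the sum may run over all layers. -/
lemma subG_telescope (k : Fin (L + 1)) : subG D C W' k = subG D C W k +
    ∑ j : Fin L, subM D W j.succ k * (W' j - W j) * subG D C W' j.castSucc := by
  induction k using Fin.induction with
  | zero => simp [subG_zero, subM_of_lt]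
  | succ k ih =>
    have h : ∀ j : Fin L, subM D W j.succ k.succ * (W' j - W j) * subG D C W' j.castSucc =
        D k.succ * W k * (subM D W j.succ k.castSucc * (W' j - W j) * subG D C W' j.castSucc) +
          if j = k then D k.succ * (W' j - W j) * subG D C W' j.castSucc else 0 := by
      intro j
      rw [subM_succ]
      by_cases hj : j = k
      · subst hj
        rw [subM_of_lt D W j.castSucc_lt_succ]; simp
      · rw [if_neg (fun h => hj (Fin.succ_injective _ h)), if_neg hj, add_zero]
        simp only [Matrix.mul_assoc]
    rw [subG_succ, subG_succ, Finset.sum_congr rfl fun j _ => h j, Finset.sum_add_distrib,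
      ← Matrix.mul_sum, Finset.sum_ite_eq' Finset.univ k, if_pos (Finset.mem_univ _), ← add_assoc,
      ← Matrix.mul_add, ← ih]
    simp only [Matrix.mul_sub, Matrix.sub_mul]
    abel

lemma subF_telescope (k : Fin (L + 1)) : subF D B W' k = subF D B W k +
    ∑ l : Fin L, subF D B W' l.succ * (W' l - W l) * subM D W k l.castSucc := by
  induction k using Fin.reverseInduction with
  | last => simp [subF_last, subM_of_lt D W (Fin.castSucc_lt_last _)]
  | cast k ih =>
    have h : ∀ l : Fin L, subF D B W' l.succ * (W' l - W l) * subM D W k.castSucc l.castSucc =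
        (subF D B W' l.succ * (W' l - W l) * subM D W k.succ l.castSucc) * (W k * D k.castSucc) +
          if l = k then subF D B W' l.succ * (W' l - W l) * D k.castSucc else 0 := by
      intro l
      rw [subM_castSucc]
      by_cases hl : l = k
      · subst hl
        simp only [if_true, Matrix.mul_add, Matrix.mul_assoc]
      · rw [if_neg (fun h => hl (Fin.castSucc_injective _ h)), if_neg hl, add_zero, add_zero]
        simp only [Matrix.mul_assoc]
    rw [subF_castSucc, subF_castSucc, Finset.sum_congr rfl fun j _ => h j, Finset.sum_add_distrib,
      ← Matrix.sum_mul, Finset.sum_ite_eq' Finset.univ k, if_pos (Finset.mem_univ _), ← add_assoc,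
      Matrix.mul_assoc (subF D B W k.succ), ← Matrix.add_mul, ← ih]
    simp only [Matrix.mul_sub, Matrix.sub_mul, Matrix.mul_assoc]
    abel

end Telescope

section Perturb

variable {L m dx dy d : ℕ}

/-- At the largest `x k₀` the hypothesis reads `x k₀ ≤ g + δ x k₀`, so `x k₀ ≤ g/(1 - δ)`. -/
lemma sum_le_of_self_bound {a x : Fin (L + 1) → ℝ} {σ : Fin L → Fin (L + 1)} {e δ g : ℝ}
    (he : 0 ≤ e) (hδ : L * e ≤ δ) (hδ1 : δ < 1) (ha : ∀ k, a k ≤ g)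
    (hx : ∀ k, x k ≤ a k + ∑ j, e * x (σ j)) (hx0 : ∀ k, 0 ≤ x k) :
    ∑ j, e * x (σ j) ≤ δ / (1 - δ) * g := by
  obtain ⟨k₀, -, hk₀⟩ := Finset.exists_max_image Finset.univ x Finset.univ_nonempty
  have h1 : ∑ j, e * x (σ j) ≤ δ * x k₀ := by
    calc ∑ j, e * x (σ j) ≤ ∑ _j : Fin L, e * x k₀ := by
          refine Finset.sum_le_sum fun j _ => ?_
          have := hk₀ (σ j) (Finset.mem_univ _)
          gcongr
      _ = L * e * x k₀ := by simp [mul_assoc]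
      _ ≤ δ * x k₀ := mul_le_mul_of_nonneg_right hδ (hx0 _)
  have h2 := hx k₀
  have h3 := ha k₀
  have hδ0 : 0 ≤ δ := le_trans (by positivity) hδ
  have h4 : x k₀ ≤ g / (1 - δ) := by
    rw [le_div_iff₀ (by linarith)]; linarith
  calc _ ≤ δ * x k₀ := h1
    _ ≤ δ * (g / (1 - δ)) := by gcongr
    _ = _ := by ring

lemma sqrt_sqNorm_add_le (u v : Fin d → ℝ) :
    √(sqNorm (u + v)) ≤ √(sqNorm u) + √(sqNorm v) := by
  simp only [sqrt_sqNorm, WithLp.toLp_add]; exact norm_add_le _ _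

lemma sqrt_sqNorm_sub_le (u v : Fin d → ℝ) :
    √(sqNorm u) - √(sqNorm v) ≤ √(sqNorm (u + v)) := by
  simp only [sqrt_sqNorm, WithLp.toLp_add]
  have := norm_sub_le_norm_add (WithLp.toLp 2 u) (WithLp.toLp 2 v)
  exact this

lemma sqrt_sqNorm_sum_le {ι : Type*} (s : Finset ι) (f : ι → Fin d → ℝ) :
    √(sqNorm (∑ i ∈ s, f i)) ≤ ∑ i ∈ s, √(sqNorm (f i)) := by
  simp only [sqrt_sqNorm, WithLp.toLp_sum]; exact norm_sum_le _ _

lemma sqrt_mulVec_near {p : ℕ} {δ g : ℝ} {v v' w : Fin p → ℝ} (hv : v' = v + w)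
    (hw : √(sqNorm w) ≤ δ / (1 - δ) * g) :
    √(sqNorm v) - δ / (1 - δ) * g ≤ √(sqNorm v') ∧
      √(sqNorm v') ≤ √(sqNorm v) + δ / (1 - δ) * g := by
  subst hv
  have h1 := sqrt_sqNorm_add_le v w
  have h2 := sqrt_sqNorm_sub_le v w
  constructor <;> linarith

variable {D : Fin (L + 1) → Matrix (Fin m) (Fin m) ℝ} {C : Matrix (Fin m) (Fin dx) ℝ}
  {B : Matrix (Fin dy) (Fin m) ℝ} {W W' : Layers L m} {A τ δ g : ℝ}

/-- Here every partial product starts at some `j.succ ≠ 0`; in `subF_near` every one ends before the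
last layer. Excluding the full product matters for `L = 1`, where all others are single projections
or zero. -/
lemma subG_near (hA : 0 ≤ A) (hM : ∀ j k, (j, k) ≠ (0, Fin.last L) → OpBound (subM D W j k) A)
    (hτ : 0 ≤ τ) (hW : ∀ k, specNorm (W' k - W k) ≤ τ) (hδ : L * (A * τ) ≤ δ) (hδ1 : δ < 1)
    (u : Fin dx → ℝ) (hu : ∀ k, √(sqNorm (subG D C W k *ᵥ u)) ≤ g)
    (k : Fin (L + 1)) :
    √(sqNorm (subG D C W k *ᵥ u)) - δ / (1 - δ) * g ≤ √(sqNorm (subG D C W' k *ᵥ u)) ∧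
      √(sqNorm (subG D C W' k *ᵥ u)) ≤ √(sqNorm (subG D C W k *ᵥ u)) + δ / (1 - δ) * g := by
  have htel : ∀ k, subG D C W' k *ᵥ u = subG D C W k *ᵥ u +
      ∑ j : Fin L, subM D W j.succ k *ᵥ ((W' j - W j) *ᵥ (subG D C W' j.castSucc *ᵥ u)) := by
    intro k
    rw [subG_telescope D C W W' k, add_mulVec, sum_mulVec]
    simp only [mulVec_mulVec, Matrix.mul_assoc]
  have hsum : ∀ k, √(sqNorm (∑ j : Fin L, subM D W j.succ k *ᵥ
      ((W' j - W j) *ᵥ (subG D C W' j.castSucc *ᵥ u)))) ≤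
      ∑ j : Fin L, A * τ * √(sqNorm (subG D C W' j.castSucc *ᵥ u)) := by
    intro k
    refine (sqrt_sqNorm_sum_le _ _).trans (Finset.sum_le_sum fun j _ => ?_)
    refine ((hM j.succ k (by simp [Fin.succ_ne_zero])).le _).trans ?_
    rw [mul_assoc]
    refine mul_le_mul_of_nonneg_left (((opBound_specNorm _).le _).trans ?_) hA
    exact mul_le_mul_of_nonneg_right (hW j) (Real.sqrt_nonneg _)
  refine sqrt_mulVec_near (htel k) ((hsum k).trans (sum_le_of_self_bound
    (x := fun k => √(sqNorm (subG D C W' k *ᵥ u))) (by positivity) hδ hδ1 hu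
      (fun k => ?_) fun k => Real.sqrt_nonneg _))
  nth_rewrite 1 [htel k]
  exact (sqrt_sqNorm_add_le _ _).trans (add_le_add le_rfl (hsum k))

lemma subF_near (hA : 0 ≤ A) (hM : ∀ j k, (j, k) ≠ (0, Fin.last L) → OpBound (subM D W j k) A)
    (hτ : 0 ≤ τ) (hW : ∀ k, specNorm (W' k - W k) ≤ τ) (hδ : L * (A * τ) ≤ δ) (hδ1 : δ < 1)
    (u : Fin dy → ℝ) (hu : ∀ k, √(sqNorm ((subF D B W k)ᵀ *ᵥ u)) ≤ g)
    (k : Fin (L + 1)) :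
    √(sqNorm ((subF D B W k)ᵀ *ᵥ u)) - δ / (1 - δ) * g ≤ √(sqNorm ((subF D B W' k)ᵀ *ᵥ u)) ∧
      √(sqNorm ((subF D B W' k)ᵀ *ᵥ u)) ≤ √(sqNorm ((subF D B W k)ᵀ *ᵥ u)) + δ / (1 - δ) * g := by
  have htel : ∀ k, (subF D B W' k)ᵀ *ᵥ u = (subF D B W k)ᵀ *ᵥ u +
      ∑ l : Fin L, (subM D W k l.castSucc)ᵀ *ᵥ
        ((W' l - W l)ᵀ *ᵥ ((subF D B W' l.succ)ᵀ *ᵥ u)) := by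
    intro k
    rw [subF_telescope D B W W' k, transpose_add, add_mulVec, transpose_sum, sum_mulVec]
    simp only [mulVec_mulVec, Matrix.mul_assoc, transpose_mul]
  have hsum : ∀ k, √(sqNorm (∑ l : Fin L, (subM D W k l.castSucc)ᵀ *ᵥ
        ((W' l - W l)ᵀ *ᵥ ((subF D B W' l.succ)ᵀ *ᵥ u)))) ≤
      ∑ l : Fin L, A * τ * √(sqNorm ((subF D B W' l.succ)ᵀ *ᵥ u)) := by
    intro k
    refine (sqrt_sqNorm_sum_le _ _).trans (Finset.sum_le_sum fun l _ => ?_)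
    refine ((hM k l.castSucc (by simp [(Fin.castSucc_lt_last l).ne])).transpose.le _).trans ?_
    rw [mul_assoc]
    refine mul_le_mul_of_nonneg_left (((opBound_specNorm _).transpose.le _).trans ?_) hA
    exact mul_le_mul_of_nonneg_right (hW l) (Real.sqrt_nonneg _)
  refine sqrt_mulVec_near (htel k) ((hsum k).trans (sum_le_of_self_bound
    (x := fun k => √(sqNorm ((subF D B W' k)ᵀ *ᵥ u))) (by positivity) hδ hδ1 hu
      (fun k => ?_) fun k => Real.sqrt_nonneg _))
  nth_rewrite 1 [htel k]
  exact (sqrt_sqNorm_add_le _ _).trans (add_le_add le_rfl (hsum k))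

end Perturb


/-! ### Choice of exponents and thresholds. -/

lemma StepBound.mono {m : ℕ} {f : ℝ → ℝ≥0∞} {γ γ' : ℝ≥0∞} (h : StepBound m f γ) (hγ : γ ≤ γ') :
    StepBound m f γ' :=
  ⟨h.meas, fun hv u _ hc => (h.step hv u hc).trans (mul_le_mul' hγ le_rfl)⟩

lemma le_log_41_div_10 : (1.41 : ℝ) ≤ Real.log 4.1 := by
  have h1 : Real.log 4.1 = 2 * Real.log 2 + Real.log 1.025 := by
    rw [← Real.log_rpow two_pos, ← Real.log_mul (by positivity) (by norm_num)]
    norm_num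
  have h2 := Real.one_sub_inv_le_log_of_pos (x := 1.025) (by norm_num)
  have h3 := Real.log_two_gt_d9
  norm_num at h2 h1 ⊢
  linarith

lemma le_log_seven : (1.936 : ℝ) ≤ Real.log 7 := by
  have h1 : Real.log 7 = 3 * Real.log 2 + Real.log (7 / 8) := by
    rw [← Real.log_rpow two_pos, ← Real.log_mul (by positivity) (by norm_num)]
    norm_num
  have h2 := Real.one_sub_inv_le_log_of_pos (x := 7 / 8) (by norm_num)
  have h3 := Real.log_two_gt_d9
  norm_num at h2
  linarith

lemma le_log_11_div_2 : (1.658 : ℝ) ≤ Real.log (11 / 2) := by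
  have h1 : Real.log (11 / 2) = 2 * Real.log 2 + Real.log (11 / 8) := by
    rw [← Real.log_rpow two_pos, ← Real.log_mul (by positivity) (by norm_num)]
    norm_num
  have h2 := Real.one_sub_inv_le_log_of_pos (x := 11 / 8) (by norm_num)
  have h3 := Real.log_two_gt_d9
  norm_num at h2
  linarith

lemma log_five_le : Real.log 5 ≤ 1.62 := by
  have h1 : 3 * Real.log 5 ≤ 7 * Real.log 2 := by
    rw [← Real.log_rpow two_pos, ← Real.log_rpow (by norm_num : (0 : ℝ) < 5)]
    exact Real.log_le_log (by positivity) (by norm_num)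
  have h3 := Real.log_two_lt_d9
  linarith

/-- With `q = 1/(3L)`, the cost of `L + 1` layers and the gain at level `4.1` are both of order
`m/L`; the difference covers `m/(8L)`, with little to spare at `L = 1`. -/
lemma exists_upper_test {L m : ℕ} (hL : 1 ≤ L) (hm : 0 < m) : ∃ p γ : ℝ, 0 ≤ p ∧ 1 ≤ γ ∧
    StepBound m (fun y => ENNReal.ofReal (y ^ p)) (ENNReal.ofReal γ) ∧
    γ ^ (L + 1) ≤ Real.exp (-(m / (8 * L))) * 4.1 ^ p := by
  have hL' : (1 : ℝ) ≤ L := by exact_mod_cast hL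
  set t : ℝ := 1 / L with ht
  have ht0 : 0 < t := by positivity
  have ht1 : t ≤ 1 := by rw [ht, div_le_one (by linarith)]; exact hL'
  have htL : (L : ℝ) * t = 1 := by rw [ht]; field_simp
  have hq : (0 : ℝ) < t / 3 := by positivity
  have hR := rateUp_le hq.le (by linarith : t / 3 ≤ 1 / 3)
  refine ⟨m * (t / 3 * (1 + t / 3) / 2), Real.exp (m * (5 / 8 * (t / 3) ^ 2 * (1 + t / 3))),
    by positivity, Real.one_le_exp (by positivity), (stepBound_rpow hm hq).mono ?_, ?_⟩
  · gcongr
  · rw [← Real.exp_nat_mul, Real.rpow_def_of_pos (by norm_num), ← Real.exp_add, Real.exp_le_exp]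
    have h1 := le_log_41_div_10
    have e1 : (m : ℝ) / (8 * L) = m * (t / 8) := by rw [ht]; field_simp
    have h2 : (L : ℝ) * (t * t) = t := by rw [← mul_assoc, htL, one_mul]
    have h3 : ((L + 1 : ℕ) : ℝ) * (5 / 8 * (t / 3) ^ 2 * (1 + t / 3)) ≤
        -(t / 8) + 1.41 * (t / 3 * (1 + t / 3) / 2) := by
      push_cast
      have : ((L : ℝ) + 1) * (5 / 8 * (t / 3) ^ 2 * (1 + t / 3)) =
          5 / 72 * (1 + t / 3) * (t + t * t) := by linear_combination 5 / 72 * (1 + t / 3) * h2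
      rw [this]
      nlinarith [mul_nonneg ht0.le (sub_nonneg.2 ht1),
        mul_nonneg (mul_nonneg ht0.le ht0.le) (sub_nonneg.2 ht1)]
    have h4 : (1.41 : ℝ) * (t / 3 * (1 + t / 3) / 2) ≤
        Real.log 4.1 * (t / 3 * (1 + t / 3) / 2) := by gcongr
    have h5 := mul_le_mul_of_nonneg_left (h3.trans (add_le_add le_rfl h4)) (Nat.cast_nonneg' m)
    rw [e1]
    linarith

lemma exists_block_test {L m : ℕ} (hL : 2 ≤ L) (hm : 0 < m) {θ : ℝ} (hθ : 0 < θ) (hθ1 : θ < 1 / 2) :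
    ∃ p γ : ℝ, 0 ≤ p ∧ 1 ≤ γ ∧
    StepBound m (fun y => ENNReal.ofReal (y ^ p)) (ENNReal.ofReal γ) ∧
    γ ^ L ≤ Real.exp (-(16 / 15 * θ * m / L)) * Real.exp (4 * θ + 2 / 3) ^ p := by
  have hL' : (2 : ℝ) ≤ L := by exact_mod_cast hL
  set l : ℝ := 4 * θ + 2 / 3 with hl
  -- Minimizes the leading part `5Lq²/8 - lq/2` of the exponent, with minimum `-l²/(10L)`.
  set q : ℝ := 2 * l / (5 * L) with hq
  have hq0 : 0 < q := by positivity
  have hq1 : q ≤ 3 / 5 := by rw [hq, div_le_iff₀ (by positivity)]; linarith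
  have hlq : l = 5 * L * q / 2 := by rw [hq]; field_simp
  have hR := rateUp_le' hq0.le hq1
  refine ⟨m * (q * (1 + q) / 2), Real.exp (m * (5 / 8 * q ^ 2 * (1 + 2 * q))),
    by positivity, Real.one_le_exp (by positivity), (stepBound_rpow hm hq0).mono ?_, ?_⟩
  · gcongr
  · rw [← Real.exp_nat_mul, ← Real.exp_mul, ← Real.exp_add, Real.exp_le_exp]
    have h1 : 16 / 15 * θ / L ≤ l ^ 2 / (10 * L) := by
      rw [div_le_div_iff₀ (by positivity) (by positivity)]
      -- Arithmetic–geometric mean for the two summands of `l`.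
      have : 32 / 3 * θ ≤ l ^ 2 := by rw [hl]; nlinarith [sq_nonneg (4 * θ - 2 / 3)]
      nlinarith
    have h2 : l ^ 2 / (10 * L) = 5 / 8 * L * q ^ 2 := by rw [hlq]; field_simp; ring
    have h3 : m * (16 / 15 * θ / L) ≤ m * (5 / 8 * L * q ^ 2) := by
      rw [← h2]; gcongr
    have h4 : 16 / 15 * θ * m / L = m * (16 / 15 * θ / L) := by ring
    rw [h4, hlq]
    nlinarith

/-- A single layer only affords the lower threshold `1/7`; its much smaller perturbation error makes
up for this in `Good.spectrumWithin`. -/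
lemma lower_rate {L : ℕ} (hL : 1 ≤ L) : ∃ b E : ℝ, 1 / 7 ≤ b ∧ (2 ≤ L → 2 / 11 ≤ b) ∧ b < 1 ∧
    0 ≤ E ∧ rateLow (1 / L / 3) ≤ E ∧
    (L + 1) * E + 1 / L / 8 ≤ 1 / L / 3 * (1 - 1 / L / 3) / 2 * -Real.log b := by
  rcases hL.eq_or_lt with rfl | h2
  · refine ⟨1 / 7, 447 / 10000, le_rfl, fun h => absurd h (by norm_num), by norm_num, by norm_num,
      ?_, ?_⟩
    · have := rateLow_one_third_le
      norm_num at this ⊢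
      exact this
    · rw [one_div (7 : ℝ), Real.log_inv, neg_neg]
      have := le_log_seven
      norm_num at this ⊢
      linarith
  · have hL' : (2 : ℝ) ≤ L := by exact_mod_cast h2
    set t : ℝ := 1 / L with ht
    have ht0 : 0 < t := by positivity
    have ht1 : t ≤ 1 / 2 := by rw [ht]; exact one_div_le_one_div_of_le two_pos hL'
    have htL : (L : ℝ) * t = 1 := by rw [ht]; field_simp
    refine ⟨2 / 11, 5 / 8 * (t / 3) ^ 2, by norm_num, fun _ => le_rfl, by norm_num, by positivity,
      rateLow_le (by positivity) (by linarith), ?_⟩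
    rw [show (2 / 11 : ℝ) = (11 / 2)⁻¹ by norm_num, Real.log_inv, neg_neg]
    have h1 := le_log_11_div_2
    have h3 : t / 3 * (1 - t / 3) / 2 * 1.658 ≤ t / 3 * (1 - t / 3) / 2 * Real.log (11 / 2) := by
      refine mul_le_mul_of_nonneg_left h1 (div_nonneg (mul_nonneg (by positivity) ?_) zero_le_two)
      linarith
    have h4 : ((L : ℝ) + 1) * (5 / 8 * (t / 3) ^ 2) = 5 / 72 * (t + t * t) := by
      linear_combination 5 / 72 * t * htL
    rw [h4]
    nlinarith

lemma exists_lower_test {L m : ℕ} (hL : 1 ≤ L) (hs : 48 * L < √(m : ℝ)) : ∃ b p γ : ℝ,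
    1 / 7 ≤ b ∧ (2 ≤ L → 2 / 11 ≤ b) ∧ b < 1 ∧ 0 ≤ p ∧ 1 ≤ γ ∧
    StepBound m (lowTest b p) (ENNReal.ofReal γ) ∧
    γ ^ (L + 1) * b ^ p ≤ Real.exp (2 * √m - m / (8 * L)) := by
  have hL' : (1 : ℝ) ≤ L := by exact_mod_cast hL
  obtain ⟨b, E, hb, hb2, hb1, hE, hrate, hexp⟩ := lower_rate hL
  set t : ℝ := 1 / L with ht
  have ht0 : 0 < t := by positivity
  have ht1 : t ≤ 1 := by rw [ht, div_le_one (by linarith)]; exact hL'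
  have htL : (L : ℝ) * t = 1 := by rw [ht]; field_simp
  set s : ℝ := √m with hs'
  have hs0 : 0 < s := by linarith
  have hss : s * s = m := Real.mul_self_sqrt (Nat.cast_nonneg' m)
  have hm : 0 < m := by
    rw [← Nat.cast_pos (α := ℝ), ← hss]; positivity
  set r : ℝ := t / 3 * (1 - t / 3) / 2 with hr
  have hr0 : t / 9 ≤ r := by rw [hr]; nlinarith
  have hr1 : r ≤ t / 6 := by rw [hr]; nlinarith
  have hst : 48 < s * t := by nlinarith
  have hh : s / 2 < m * r := by
    rw [← hss, mul_assoc]; nlinarith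
  have hb0 : 0 < b := by linarith
  have hU0 : 0 ≤ -Real.log b := by
    have := Real.log_nonpos hb0.le hb1.le; linarith
  have hU : -Real.log b ≤ 2 := by
    have h7 : Real.log 7 ≤ 2 := by
      rw [Real.log_le_iff_le_exp (by norm_num)]
      have := Real.exp_one_gt_d9
      rw [show (2 : ℝ) = 1 + 1 by norm_num, Real.exp_add]
      nlinarith
    have := Real.log_le_log (by norm_num) hb
    rw [one_div, Real.log_inv] at this
    linarith
  -- The exponent is lowered by `h = √m/2`. Then `(1 + Q)^(L+1) ≤ exp √m` and `b^(-h) ≤ exp √m`,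
  -- which together give the `2√m`.
  set Q : ℝ := (m * r - s / 2) / (s / 2) with hQ
  have hQ0 : 0 ≤ Q := div_nonneg (by linarith) (by linarith)
  have hQ1 : Q ≤ s * t / 3 - 1 := by
    rw [hQ, div_le_iff₀ (by linarith), ← hss]; nlinarith
  refine ⟨b, m * r - s / 2, (1 + Q) * Real.exp (m * E), hb, hb2, hb1, by linarith, ?_, ?_, ?_⟩
  · have := Real.one_le_exp (x := m * E) (by positivity)
    nlinarith
  · refine (stepBound_lowTest hm (by positivity : 0 < t / 3) (by linarith) ?_ (half_pos hs0) hh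
      hrate).mono (ENNReal.ofReal_le_ofReal ?_)
    · have : (t / 3) ^ 3 ≤ (1 / 3) ^ 3 := by gcongr
      linarith
    · have := Real.one_le_exp (x := m * E) (by positivity)
      nlinarith
  · calc ((1 + Q) * Real.exp (m * E)) ^ (L + 1) * b ^ (m * r - s / 2)
        ≤ (Real.exp Q * Real.exp (m * E)) ^ (L + 1) * b ^ (m * r - s / 2) := by
          gcongr
          linarith [Real.add_one_le_exp Q]
      _ = Real.exp ((L + 1) * (Q + m * E) + Real.log b * (m * r - s / 2)) := by
          rw [← Real.exp_add, ← Real.exp_nat_mul, Real.rpow_def_of_pos hb0, ← Real.exp_add]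
          push_cast; rfl
      _ ≤ _ := by
          rw [Real.exp_le_exp]
          have e1 : (m : ℝ) / (8 * L) = m * (t / 8) := by rw [ht]; field_simp
          have h1 := mul_le_mul_of_nonneg_left hexp (Nat.cast_nonneg' (α := ℝ) m)
          have h2 : (L + 1) * Q ≤ s := by
            calc (L + 1) * Q ≤ (2 * L) * (s * t / 3) := by gcongr <;> linarith
              _ = 2 / 3 * s := by linear_combination 2 / 3 * s * htL
              _ ≤ s := by linarith
          have h3 : -Real.log b * (s / 2) ≤ 2 * (s / 2) := by gcongr
          rw [e1]
          linarith


/-! ### Transfer of the chain estimates to the initialization law. -/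

section InitLaw

variable {L m dx dy : ℕ} {f : ℝ → ℝ≥0∞} {γ : ℝ≥0∞}

instance : IsProbabilityMeasure (initLaw L m dx dy) := by
  unfold initLaw; infer_instance

lemma lintegral_initLaw {f : Init L m dx dy → ℝ≥0∞} (hf : Measurable f) :
    ∫⁻ ω, f ω ∂initLaw L m dx dy =
      ∫⁻ C, ∫⁻ B, ∫⁻ W, ∫⁻ Ψ, f (W, Ψ, C, B) ∂layersLaw L m (2 / (m : ℝ≥0))
        ∂layersLaw L m (2 / (m : ℝ≥0)) ∂gaussMatrix dy m (2 / (dy : ℝ≥0))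
        ∂gaussMatrix m dx (2 / (dx : ℝ≥0)) := by
  change ∫⁻ ω, f ω ∂(layersLaw L m (2 / (m : ℝ≥0))).prod ((layersLaw L m (2 / (m : ℝ≥0))).prod
    ((gaussMatrix m dx (2 / (dx : ℝ≥0))).prod (gaussMatrix dy m (2 / (dy : ℝ≥0))))) = _
  have h1 : Measurable fun p : Layers L m × Matrix (Fin m) (Fin dx) ℝ × Matrix (Fin dy) (Fin m) ℝ =>
      ∫⁻ W, f (W, p) ∂layersLaw L m (2 / (m : ℝ≥0)) := hf.lintegral_prod_left'
  rw [lintegral_prod_symm _ hf.aemeasurable, lintegral_prod_symm _ h1.aemeasurable, lintegral_prod]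
  · refine lintegral_congr fun C => lintegral_congr fun B => ?_
    rw [lintegral_lintegral_swap]
    refine (hf.comp ?_).aemeasurable
    exact measurable_snd.prodMk (measurable_fst.prodMk measurable_const)
  · exact h1.lintegral_prod_left'.aemeasurable

/-- Activation patterns of all layers on the input `x`. -/
noncomputable def actPats (ω : Init L m dx dy) (x : Fin dx → ℝ) : Fin (L + 1) → Fin m → Bool :=
  Fin.cons (pat (ω.C *ᵥ x)) (featPat ω.Ψ (relu (ω.C *ᵥ x)))

lemma act_eq_patMats (ω : Init L m dx dy) (x : Fin dx → ℝ) :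
    act ω.Ψ ω.C x = patMats (actPats ω x) := by
  funext k
  rw [act, gate_eq_patMat, feature_eq_feat, patMats, actPats]
  refine Fin.cases ?_ (fun l => ?_) k
  · simp [pat_relu]
  · simp [featPat]

lemma measurable_Ψ : Measurable (Init.Ψ : Init L m dx dy → Layers L m) :=
  measurable_fst.comp measurable_snd

lemma measurable_C : Measurable (Init.C : Init L m dx dy → Matrix (Fin m) (Fin dx) ℝ) :=
  measurable_fst.comp (measurable_snd.comp measurable_snd)

lemma measurable_relu_C (x : Fin dx → ℝ) :
    Measurable fun ω : Init L m dx dy => relu (ω.C *ᵥ x) :=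
  continuous_relu.measurable.comp ((measurable_mulVec_const x).comp measurable_C)

lemma measurable_actPats (x : Fin dx → ℝ) :
    Measurable fun ω : Init L m dx dy => actPats ω x := by
  refine measurable_pi_lambda _ fun k => ?_
  refine Fin.cases ?_ (fun l => ?_) k
  · exact measurable_pat.comp ((measurable_mulVec_const x).comp measurable_C)
  · exact (measurable_pi_apply l).comp
      (measurable_featPat.comp (measurable_Ψ.prodMk (measurable_relu_C x)))

/-- No feature of the input `x` before the last layer vanishes. -/
def Alive (ω : Init L m dx dy) (x : Fin dx → ℝ) : Prop :=
  ∀ l : Fin L, feat ω.Ψ (relu (ω.C *ᵥ x)) l.castSucc ≠ 0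

lemma initLaw_not_alive_le (hm : 0 < m) (hd : 0 < dx) {x : Fin dx → ℝ} (hx : x ≠ 0) :
    initLaw L m dx dy {ω | ¬ Alive ω x} ≤ (L + 1) * (2 : ℝ≥0∞)⁻¹ ^ m := by
  have hS : MeasurableSet {ω : Init L m dx dy | ¬ Alive ω x} :=
    ((measurable_Ψ.prodMk (measurable_relu_C x)) measurableSet_alive).compl
  have hA : MeasurableSet {C : Matrix (Fin m) (Fin dx) ℝ | relu (C *ᵥ x) = 0} :=
    (continuous_relu.measurable.comp (measurable_mulVec_const x)) (MeasurableSet.singleton 0)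
  rw [← lintegral_indicator_one hS, lintegral_initLaw (measurable_one.indicator hS)]
  calc _ ≤ ∫⁻ C, ∫⁻ B, ∫⁻ W, ({C : Matrix (Fin m) (Fin dx) ℝ | relu (C *ᵥ x) = 0}.indicator 1 C +
        L * (2 : ℝ≥0∞)⁻¹ ^ m) ∂layersLaw L m (2 / (m : ℝ≥0))
        ∂gaussMatrix dy m (2 / (dy : ℝ≥0)) ∂gaussMatrix m dx (2 / (dx : ℝ≥0)) := by
        refine lintegral_mono fun C => lintegral_mono fun B => lintegral_mono fun W => ?_
        by_cases h0 : relu (C *ᵥ x) = 0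
        · rw [Set.indicator_of_mem (s := {C : Matrix (Fin m) (Fin dx) ℝ | relu (C *ᵥ x) = 0}) h0]
          refine le_add_right ((lintegral_mono fun Ψ => Set.indicator_le_self' (by simp) _).trans ?_)
          simp
        · refine le_add_left (le_trans ?_ (layersLaw_dead_le (two_div_ne_zero' hm) h0))
          have hS' : MeasurableSet
              {Ψ : Layers L m | ¬ ∀ l : Fin L, feat Ψ (relu (C *ᵥ x)) l.castSucc ≠ 0} :=
            ((measurable_id.prodMk measurable_const) measurableSet_alive).compl
          rw [← lintegral_indicator_one hS']
          rfl
    _ = _ := by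
        simp only [lintegral_const, measure_univ, mul_one]
        rw [lintegral_add_right _ measurable_const, lintegral_indicator_one hA,
          gaussMatrix_relu_eq_zero (two_div_ne_zero' hd) hx]
        simp [add_mul, add_comm]

lemma measurable_onAlive_act (x : Fin dx → ℝ)
    {Γ : (Fin (L + 1) → Fin m → Bool) → Layers L m × Matrix (Fin m) (Fin dx) ℝ ×
      Matrix (Fin dy) (Fin m) ℝ → ℝ≥0∞} (hΓ : ∀ S, Measurable (Γ S)) :
    Measurable fun ω : Init L m dx dy =>
      onAlive ω.Ψ (relu (ω.C *ᵥ x)) (Γ (actPats ω x) (ω.W₁, ω.C, ω.B)) := by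
  have hΓ' : Measurable fun q : (Fin (L + 1) → Fin m → Bool) × Layers L m ×
      Matrix (Fin m) (Fin dx) ℝ × Matrix (Fin dy) (Fin m) ℝ => Γ q.1 q.2 :=
    measurable_from_prod_countable_right hΓ
  have hB : Measurable (Init.B : Init L m dx dy → _) :=
    measurable_snd.comp (measurable_snd.comp measurable_snd)
  exact measurable_onAlive measurable_Ψ (measurable_relu_C x)
    (hΓ'.comp ((measurable_actPats x).prodMk (measurable_fst.prodMk (measurable_C.prodMk hB))))

lemma initLaw_alive_le {x : Fin dx → ℝ}
    {Γ : (Fin (L + 1) → Fin m → Bool) → Layers L m × Matrix (Fin m) (Fin dx) ℝ ×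
      Matrix (Fin dy) (Fin m) ℝ → ℝ≥0∞} (hΓ : ∀ S, Measurable (Γ S)) {t ε : ℝ} (ht : 0 < t)
    (h : ∫⁻ ω, onAlive ω.Ψ (relu (ω.C *ᵥ x)) (Γ (actPats ω x) (ω.W₁, ω.C, ω.B))
      ∂initLaw L m dx dy ≤ ENNReal.ofReal ε) :
    initLaw L m dx dy {ω | Alive ω x ∧ ENNReal.ofReal t ≤ Γ (actPats ω x) (ω.W₁, ω.C, ω.B)} ≤
      ENNReal.ofReal (ε / t) := by
  rw [ENNReal.ofReal_div_of_pos ht]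
  refine le_trans (measure_mono fun ω hω => ?_) ((meas_ge_le_lintegral_div
    (measurable_onAlive_act x hΓ).aemeasurable (by simpa using ht) ENNReal.ofReal_ne_top).trans
    (ENNReal.div_le_div_right h _))
  rw [Set.mem_ofPred_eq, onAlive, if_pos (show ∀ l, _ from hω.1)]
  exact hω.2

/-- Given `C`, the patterns of layers `1, …, L` become uniform; the pattern of `C x` stays tied to
`C`. -/
lemma lintegral_initLaw_onAlive_le (hm : 0 < m) (x : Fin dx → ℝ)
    {Γ : (Fin (L + 1) → Fin m → Bool) → Layers L m × Matrix (Fin m) (Fin dx) ℝ ×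
      Matrix (Fin dy) (Fin m) ℝ → ℝ≥0∞} (hΓ : ∀ S, Measurable (Γ S)) :
    ∫⁻ ω, onAlive ω.Ψ (relu (ω.C *ᵥ x)) (Γ (actPats ω x) (ω.W₁, ω.C, ω.B)) ∂initLaw L m dx dy ≤
      ∫⁻ C, ∫⁻ B, ∫⁻ p, Γ (Fin.cons (pat (C *ᵥ x)) p.1) (p.2, C, B)
        ∂chainLaw L L m (2 / (m : ℝ≥0)) ∂gaussMatrix dy m (2 / (dy : ℝ≥0))
        ∂gaussMatrix m dx (2 / (dx : ℝ≥0)) := by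
  rw [lintegral_initLaw (measurable_onAlive_act x hΓ)]
  refine lintegral_mono fun C => lintegral_mono fun B => ?_
  rw [chainLaw, lintegral_prod_symm]
  · refine lintegral_mono fun W => ?_
    exact lintegral_onAlive_featPat_le (two_div_ne_zero' hm) (relu (C *ᵥ x))
      fun S => Γ (Fin.cons (pat (C *ᵥ x)) S) (W, C, B)
  · refine Measurable.aemeasurable (measurable_from_prod_countable_right
      (f := fun p : (Fin L → Fin m → Bool) × Layers L m =>
        Γ (Fin.cons (pat (C *ᵥ x)) p.1) (p.2, C, B)) fun S => ?_)
    exact (hΓ (Fin.cons (pat (C *ᵥ x)) S)).comp (measurable_id.prodMk measurable_const)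

/-- When the integrand sees `C` only through its pattern, that pattern is uniform as well. -/
lemma lintegral_initLaw_onAlive_le' (hm : 0 < m) (hd : 0 < dx) {x : Fin dx → ℝ} (hx : x ≠ 0)
    {Γ : (Fin (L + 1) → Fin m → Bool) → Layers L m × Matrix (Fin dy) (Fin m) ℝ → ℝ≥0∞}
    (hΓ : ∀ S, Measurable (Γ S)) :
    ∫⁻ ω, onAlive ω.Ψ (relu (ω.C *ᵥ x)) (Γ (actPats ω x) (ω.W₁, ω.B)) ∂initLaw L m dx dy ≤
      ∫⁻ B, ∫⁻ p, Γ p.1 (p.2, B) ∂chainLaw (L + 1) L m (2 / (m : ℝ≥0))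
        ∂gaussMatrix dy m (2 / (dy : ℝ≥0)) := by
  refine (lintegral_initLaw_onAlive_le hm x (Γ := fun S q => Γ S (q.1, q.2.2)) fun S =>
    (hΓ S).comp (measurable_fst.prodMk (measurable_snd.comp measurable_snd))).trans (le_of_eq ?_)
  have hBp : ∀ S₀ : Fin m → Bool, Measurable fun q : Matrix (Fin dy) (Fin m) ℝ ×
      ((Fin L → Fin m → Bool) × Layers L m) => Γ (Fin.cons S₀ q.2.1) (q.2.2, q.1) := by
    intro S₀
    have h1 : Measurable fun q : (Fin (L + 1) → Fin m → Bool) × Layers L m ×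
        Matrix (Fin dy) (Fin m) ℝ => Γ q.1 q.2 := measurable_from_prod_countable_right hΓ
    refine h1.comp (Measurable.prodMk ?_ ?_)
    · exact (measurable_of_countable fun r : Fin L → Fin m → Bool =>
        (Fin.cons S₀ r : Fin (L + 1) → Fin m → Bool)).comp (measurable_fst.comp measurable_snd)
    · exact (measurable_snd.comp measurable_snd).prodMk measurable_fst
  rw [lintegral_pat_mulVec (two_div_ne_zero' hd) hx
    (fun S₀ _ => ∫⁻ B, ∫⁻ p, Γ (Fin.cons S₀ p.1) (p.2, B) ∂chainLaw L L m (2 / (m : ℝ≥0))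
      ∂gaussMatrix dy m (2 / (dy : ℝ≥0))) (fun _ => measurable_const) fun _ _ _ => rfl]
  simp only [lintegral_const, measure_univ, mul_one]
  rw [lintegral_lintegral_swap]
  · refine lintegral_congr fun B => ?_
    have h2 : Measurable fun p : (Fin (L + 1) → Fin m → Bool) × Layers L m => Γ p.1 (p.2, B) := by
      refine measurable_from_prod_countable_right fun S => ?_
      exact (hΓ S).comp (measurable_id.prodMk measurable_const)
    rw [chainLaw.eq_1 (L + 1), lintegral_prod _ h2.aemeasurable, lintegral_patsLaw_succ]
    refine lintegral_congr fun A => ?_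
    have h3 : Measurable fun p : (Fin L → Fin m → Bool) × Layers L m =>
        Γ (Fin.cons A p.1) (p.2, B) := (hBp A).comp measurable_prodMk_left
    rw [chainLaw, lintegral_prod _ h3.aemeasurable]
  · exact (measurable_from_prod_countable_right fun S₀ =>
      (hBp S₀).lintegral_prod_right').aemeasurable

lemma initLaw_matG_le (hm : 0 < m) (hd : 0 < dx) {γ t : ℝ} (hγ : 0 ≤ γ)
    (hf : StepBound m f (ENNReal.ofReal γ)) (ht : 0 < t) {x : Fin dx → ℝ} (hx : x ≠ 0)
    {u : Fin dx → ℝ} (hu : sqNorm u = 1) {c s : ℝ} (hc : 0 < c)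
    (hs : f (c * (m / dx)) = ENNReal.ofReal s) (k : Fin (L + 1)) :
    initLaw L m dx dy {ω | Alive ω x ∧
      ENNReal.ofReal t ≤ f (c * sqNorm (matG ω x ω.W₁ k *ᵥ u))} ≤
        ENNReal.ofReal (γ ^ (k + 1 : ℕ) * s / t) := by
  have h1 : ∀ ω : Init L m dx dy, matG ω x ω.W₁ k = subG (patMats (actPats ω x)) ω.C ω.W₁ k :=
    fun ω => by rw [matG, act_eq_patMats]
  simp only [h1]
  have hΓ : ∀ S, Measurable fun q : Layers L m × Matrix (Fin m) (Fin dx) ℝ ×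
      Matrix (Fin dy) (Fin m) ℝ => f (c * sqNorm (subG (patMats S) q.2.1 q.1 k *ᵥ u)) := by
    intro S
    have h2 : Measurable fun p : Matrix (Fin m) (Fin dx) ℝ × Layers L m =>
      f (c * sqNorm (subG (patMats S) p.1 p.2 k *ᵥ u)) :=
        measurable_test hf.meas (continuous_subG (patMats S) k) u c
    have h3 : Measurable fun q : Layers L m × Matrix (Fin m) (Fin dx) ℝ ×
        Matrix (Fin dy) (Fin m) ℝ => (q.2.1, q.1) :=
      (measurable_fst.comp measurable_snd).prodMk measurable_fst
    have h4 := h2.comp h3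
    exact h4
  refine initLaw_alive_le (Γ := fun S q => f (c * sqNorm (subG (patMats S) q.2.1 q.1 k *ᵥ u)))
    hΓ ht ((lintegral_initLaw_onAlive_le hm x hΓ).trans ?_)
  have hmS : ∀ S : Fin m → Bool, Measurable fun C : Matrix (Fin m) (Fin dx) ℝ =>
      f (c * sqNorm (patMat S *ᵥ (C *ᵥ u))) := by
    intro S
    simp only [mulVec_mulVec]
    exact measurable_test hf.meas (continuous_const.matrix_mul continuous_id) u c
  have hml : Measurable fun ω : (Fin m → Bool) × Matrix (Fin m) (Fin dx) ℝ =>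
      f (c * layerOut u ω) := hf.meas.comp ((measurable_layerOut u).const_mul c)
  calc _ ≤ ∫⁻ C, ∫⁻ _B : Matrix (Fin dy) (Fin m) ℝ,
        ENNReal.ofReal γ ^ (k : ℕ) * f (c * sqNorm (patMat (pat (C *ᵥ x)) *ᵥ (C *ᵥ u)))
        ∂gaussMatrix dy m (2 / (dy : ℝ≥0)) ∂gaussMatrix m dx (2 / (dx : ℝ≥0)) :=
        lintegral_mono fun C => lintegral_mono fun B =>
          lintegral_subG_le hm hf (pat (C *ᵥ x)) C u hc k
    _ = ∫⁻ C, ENNReal.ofReal γ ^ (k : ℕ) * f (c * sqNorm (patMat (pat (C *ᵥ x)) *ᵥ (C *ᵥ u)))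
        ∂gaussMatrix m dx (2 / (dx : ℝ≥0)) := by
        simp only [lintegral_const, measure_univ, mul_one]
    _ = ∫⁻ S, ∫⁻ C, ENNReal.ofReal γ ^ (k : ℕ) * f (c * sqNorm (patMat S *ᵥ (C *ᵥ u)))
        ∂gaussMatrix m dx (2 / (dx : ℝ≥0)) ∂patLaw m := by
        -- The gate comes from `x` but the direction is `u`. Since `‖S C u‖` ignores row signs, the
        -- gate can still be decoupled from `C`.
        refine lintegral_pat_mulVec (two_div_ne_zero' hd) hx (fun S C =>
          ENNReal.ofReal γ ^ (k : ℕ) * f (c * sqNorm (patMat S *ᵥ (C *ᵥ u))))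
          (fun S => (hmS S).const_mul _) fun S σ C => ?_
        have : sqNorm (patMat S *ᵥ (flip σ C *ᵥ u)) = sqNorm (patMat S *ᵥ (C *ᵥ u)) := by
          rw [sqNorm_patMat_mulVec, sqNorm_patMat_mulVec]
          refine Finset.sum_congr rfl fun j _ => ?_
          rw [flip_mulVec]
          split_ifs <;> simp
        rw [this]
    _ = ENNReal.ofReal γ ^ (k : ℕ) *
        ∫⁻ ω, f (c * layerOut u ω) ∂layerLaw m dx (2 / (dx : ℝ≥0)) := by
        rw [← lintegral_const_mul _ hml, lintegral_layerLaw _ (hml.const_mul _)]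
        rfl
    _ ≤ ENNReal.ofReal γ ^ (k : ℕ) *
        (ENNReal.ofReal γ * f (c * layerMean m (2 / (dx : ℝ≥0)) u)) :=
        mul_le_mul' le_rfl (hf.step (two_div_ne_zero' hd) u hc)
    _ = _ := by
        rw [layerMean_two_div, hu, mul_one, hs, ENNReal.ofReal_mul (by positivity),
          ENNReal.ofReal_pow hγ, pow_succ, mul_assoc]

lemma initLaw_matF_le (hm : 0 < m) (hd : 0 < dx) {γ t : ℝ} (hγ : 0 ≤ γ)
    (hf : StepBound m f (ENNReal.ofReal γ)) (ht : 0 < t) {x : Fin dx → ℝ} (hx : x ≠ 0)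
    {u : Fin dy → ℝ} (hu : sqNorm u = 1) {c s : ℝ} (hc : 0 < c)
    (hs : f (c * (m / dy)) = ENNReal.ofReal s) (k : Fin (L + 1)) :
    initLaw L m dx dy {ω | Alive ω x ∧
      ENNReal.ofReal t ≤ f (c * sqNorm ((matF ω x ω.W₁ k)ᵀ *ᵥ u))} ≤
        ENNReal.ofReal (γ ^ (L - k + 1 : ℕ) * s / t) := by
  have hdy : 0 < dy := by
    rcases Nat.eq_zero_or_pos dy with rfl | h
    · simp [sqNorm] at hu
    · exact h
  have h1 : ∀ ω : Init L m dx dy, matF ω x ω.W₁ k = subF (patMats (actPats ω x)) ω.B ω.W₁ k :=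
    fun ω => by rw [matF, act_eq_patMats]
  simp only [h1]
  have hΓ : ∀ S, Measurable fun q : Layers L m × Matrix (Fin dy) (Fin m) ℝ =>
      f (c * sqNorm ((subF (patMats S) q.2 q.1 k)ᵀ *ᵥ u)) := by
    intro S
    have h2 : Measurable fun p : Matrix (Fin dy) (Fin m) ℝ × Layers L m =>
      f (c * sqNorm ((subF (patMats S) p.1 p.2 k)ᵀ *ᵥ u)) :=
        measurable_test hf.meas (continuous_subF (patMats S) k).matrix_transpose u c
    have h3 : Measurable fun q : Layers L m × Matrix (Fin dy) (Fin m) ℝ => (q.2, q.1) :=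
      measurable_snd.prodMk measurable_fst
    have h4 := h2.comp h3
    exact h4
  have hΓ' : ∀ S, Measurable fun q : Layers L m × Matrix (Fin m) (Fin dx) ℝ ×
      Matrix (Fin dy) (Fin m) ℝ => f (c * sqNorm ((subF (patMats S) q.2.2 q.1 k)ᵀ *ᵥ u)) := by
    intro S
    have h3 : Measurable fun q : Layers L m × Matrix (Fin m) (Fin dx) ℝ ×
        Matrix (Fin dy) (Fin m) ℝ => (q.1, q.2.2) :=
      measurable_fst.prodMk (measurable_snd.comp measurable_snd)
    have h4 := (hΓ S).comp h3
    exact h4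
  refine initLaw_alive_le (Γ := fun S q => f (c * sqNorm ((subF (patMats S) q.2.2 q.1 k)ᵀ *ᵥ u)))
    hΓ' ht
    ((lintegral_initLaw_onAlive_le' hm hd hx hΓ).trans
      ((lintegral_subF_le hm hf (two_div_ne_zero' hdy) u hc k).trans (le_of_eq ?_)))
  rw [layerMean_two_div, hu, mul_one, hs, ENNReal.ofReal_mul (by positivity),
    ENNReal.ofReal_pow hγ]

lemma initLaw_subM_le (hm : 0 < m) (hd : 0 < dx) {γ t : ℝ} (hγ : 1 ≤ γ)
    (hf : StepBound m f (ENNReal.ofReal γ)) (ht : 0 < t) (hmono : MonotoneOn f (Set.Ici 0))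
    (h1 : f 1 = 1) {x : Fin dx → ℝ} (hx : x ≠ 0) {u : Fin m → ℝ} (hu : sqNorm u = 1)
    (a k : Fin (L + 1)) :
    initLaw L m dx dy {ω | Alive ω x ∧
      ENNReal.ofReal t ≤ f (sqNorm (subM (act ω.Ψ ω.C x) ω.W₁ a k *ᵥ u))} ≤
        ENNReal.ofReal (γ ^ (k : ℕ) / t) := by
  simp only [act_eq_patMats]
  have hΓ : ∀ S, Measurable fun q : Layers L m × Matrix (Fin dy) (Fin m) ℝ =>
      f (sqNorm (subM (patMats S) q.1 a k *ᵥ u)) := by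
    intro S
    have h2 : Measurable fun W : Layers L m => f (1 * sqNorm (subM (patMats S) W a k *ᵥ u)) :=
      measurable_test hf.meas (continuous_subM (patMats S) a k) u 1
    simp only [one_mul] at h2
    have h3 : Measurable fun q : Layers L m × Matrix (Fin dy) (Fin m) ℝ => q.1 := measurable_fst
    have h4 := h2.comp h3
    exact h4
  have hΓ' : ∀ S, Measurable fun q : Layers L m × Matrix (Fin m) (Fin dx) ℝ ×
      Matrix (Fin dy) (Fin m) ℝ => f (sqNorm (subM (patMats S) q.1 a k *ᵥ u)) := by
    intro S
    have h3 : Measurable fun q : Layers L m × Matrix (Fin m) (Fin dx) ℝ ×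
        Matrix (Fin dy) (Fin m) ℝ => (q.1, q.2.2) :=
      measurable_fst.prodMk (measurable_snd.comp measurable_snd)
    have h4 := (hΓ S).comp h3
    exact h4
  refine initLaw_alive_le (Γ := fun S q => f (sqNorm (subM (patMats S) q.1 a k *ᵥ u)))
    hΓ' ht
    ((lintegral_initLaw_onAlive_le' hm hd hx hΓ).trans ?_)
  have h := lintegral_subM_le hm hf (by rw [← ENNReal.ofReal_one]; gcongr) hmono u one_pos a k
  simp only [one_mul, hu, h1, mul_one] at h
  refine (lintegral_mono fun B => h).trans ?_
  rw [lintegral_const, measure_univ, mul_one, ENNReal.ofReal_pow (by linarith)]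

end InitLaw


/-! ### Two-sided bounds for `G` and `Fᵀ` in all directions. -/

section Frames

variable {L m dx dy : ℕ}

/-- `Y` has mean `r` and its test functions are controlled by `N` gated layers, on the event that
the features of `x` do not vanish. -/
structure IsChain (x : Fin dx → ℝ) (N : ℕ) (r : ℝ) (Y : Init L m dx dy → ℝ) : Prop where
  pos : 0 < r
  tail : ∀ {f : ℝ → ℝ≥0∞} {γ t c s : ℝ}, 0 ≤ γ → StepBound m f (ENNReal.ofReal γ) → 0 < t → 0 < c →
    f (c * r) = ENNReal.ofReal s →
    initLaw L m dx dy {ω | Alive ω x ∧ ENNReal.ofReal t ≤ f (c * Y ω)} ≤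
      ENNReal.ofReal (γ ^ N * s / t)

lemma isChain_matG (hm : 0 < m) (hd : 0 < dx) {x : Fin dx → ℝ} (hx : x ≠ 0) (k : Fin (L + 1))
    {u : Fin dx → ℝ} (hu : sqNorm u = 1) :
    IsChain x (k + 1) (m / dx) fun ω : Init L m dx dy =>
      sqNorm (matG ω x ω.W₁ k *ᵥ u) where
  pos := by positivity
  tail hγ hf ht hc hs := initLaw_matG_le hm hd hγ hf ht hx hu hc hs k

lemma isChain_matF (hm : 0 < m) (hd : 0 < dx) {x : Fin dx → ℝ} (hx : x ≠ 0) (k : Fin (L + 1))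
    {u : Fin dy → ℝ} (hu : sqNorm u = 1) :
    IsChain x (L - k + 1) (m / dy) fun ω : Init L m dx dy =>
      sqNorm ((matF ω x ω.W₁ k)ᵀ *ᵥ u) where
  pos := by
    rcases Nat.eq_zero_or_pos dy with rfl | h
    · simp [sqNorm] at hu
    · positivity
  tail hγ hf ht hc hs := initLaw_matF_le hm hd hγ hf ht hx hu hc hs k

lemma IsChain.upper {x : Fin dx → ℝ} {N : ℕ} {r : ℝ} {Y : Init L m dx dy → ℝ}
    (h : IsChain x N r Y) (hL : 1 ≤ L) (hm : 0 < m) (hN : N ≤ L + 1) :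
    initLaw L m dx dy {ω | Alive ω x ∧ 4.1 * r < Y ω} ≤
      ENNReal.ofReal (Real.exp (-(m / (8 * L)))) := by
  obtain ⟨p, γ, hp, hγ, hf, hle⟩ := exists_upper_test hL hm
  have hr := h.pos
  have ht : (0 : ℝ) < 4.1 ^ p := by positivity
  have h1 := h.tail (c := r⁻¹) (s := 1) (by linarith) hf ht (by positivity)
    (by rw [inv_mul_cancel₀ hr.ne', Real.one_rpow])
  refine (measure_mono fun ω hω => ?_).trans (h1.trans (ENNReal.ofReal_le_ofReal ?_))
  · refine ⟨hω.1, ENNReal.ofReal_le_ofReal (Real.rpow_le_rpow (by norm_num) ?_ hp)⟩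
    rw [← div_eq_inv_mul, le_div_iff₀ hr]
    exact hω.2.le
  · rw [mul_one, div_le_iff₀ ht]
    exact (pow_le_pow_right₀ hγ hN).trans hle

lemma IsChain.lower {x : Fin dx → ℝ} {N : ℕ} {r : ℝ} {Y : Init L m dx dy → ℝ}
    (h : IsChain x N r Y) (hN : N ≤ L + 1) {b p γ E : ℝ} (hb : 0 < b) (hb1 : b ≤ 1) (hγ : 1 ≤ γ)
    (hf : StepBound m (lowTest b p) (ENNReal.ofReal γ)) (hE : γ ^ (L + 1) * b ^ p ≤ E) :
    initLaw L m dx dy {ω | Alive ω x ∧ Y ω < b * r} ≤ ENNReal.ofReal E := by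
  have hr := h.pos
  have h1 := h.tail (c := r⁻¹) (s := b ^ p) (by linarith) hf one_pos (by positivity)
    (by rw [inv_mul_cancel₀ hr.ne', lowTest_one hb1])
  refine (measure_mono fun ω hω => ?_).trans (h1.trans (ENNReal.ofReal_le_ofReal ?_))
  · refine ⟨hω.1, ?_⟩
    rw [lowTest_of_le hb, ENNReal.ofReal_one]
    rw [← div_eq_inv_mul, div_le_iff₀ hr]
    exact hω.2.le
  · rw [div_one]
    refine le_trans ?_ hE
    gcongr

/-- `A` distorts squared lengths by factors between `lo` and `hi`. -/
def Frame {p d : ℕ} (A : Matrix (Fin p) (Fin d) ℝ) (lo hi : ℝ) : Prop :=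
  ∀ u, lo * sqNorm u ≤ sqNorm (A *ᵥ u) ∧ sqNorm (A *ᵥ u) ≤ hi * sqNorm u

lemma measure_biUnion_finset_le_card_mul {Ω ι : Type*} [MeasurableSpace Ω] (μ : Measure Ω)
    (s : Finset ι) (E : ι → Set Ω) {c ε : ℝ} (hs : (s.card : ℝ) ≤ c) (hε : 0 ≤ ε)
    (h : ∀ i ∈ s, μ (E i) ≤ ENNReal.ofReal ε) : μ (⋃ i ∈ s, E i) ≤ ENNReal.ofReal (c * ε) := by
  calc μ (⋃ i ∈ s, E i) ≤ ∑ i ∈ s, μ (E i) := measure_biUnion_finset_le _ _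
    _ ≤ ∑ _i ∈ s, ENNReal.ofReal ε := Finset.sum_le_sum h
    _ = ENNReal.ofReal (s.card * ε) := by
        rw [Finset.sum_const, nsmul_eq_mul, ENNReal.ofReal_mul (by positivity),
          ENNReal.ofReal_natCast]
    _ ≤ _ := by gcongr

lemma exists_initLaw_frame_le (hL : 1 ≤ L) (hs : 48 * L < √(m : ℝ)) : ∃ b : ℝ,
    1 / 7 ≤ b ∧ (2 ≤ L → 2 / 11 ≤ b) ∧ ∀ {p d N : ℕ} {r : ℝ} {x : Fin dx → ℝ}
      (A : Init L m dx dy → Matrix (Fin p) (Fin d) ℝ), 0 ≤ r → N ≤ L + 1 →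
      (∀ u, sqNorm u = 1 → IsChain x N r fun ω => sqNorm (A ω *ᵥ u)) →
      initLaw L m dx dy {ω | Alive ω x ∧ ¬ Frame (A ω) ((b - 0.05125) * r) (4.15125 * r)} ≤
        ENNReal.ofReal (19 ^ d * (2 * Real.exp (2 * √m - m / (8 * L)))) := by
  obtain ⟨b, q, γ, hb, hb2, hb1, -, hγ, hf, hE⟩ := exists_lower_test hL hs
  have hm : 0 < m := by
    rcases Nat.eq_zero_or_pos m with rfl | h
    · simp at hs; linarith [Nat.cast_nonneg' (α := ℝ) L]
    · exact h
  refine ⟨b, hb, hb2, fun {p d N r x} A hr hN hA => ?_⟩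
  -- With `ε = 1/9` the upper constant becomes `4.1/(1 - 1/81) = 4.15125`, and the lower one loses
  -- `4.15125/81 = 0.05125`.
  obtain ⟨S, hS, hS1, hS2⟩ := exists_net (Finset.univ : Finset (Fin d)) (ε := 1 / 9) (by norm_num)
  rw [Finset.card_univ, Fintype.card_fin, show (1 : ℝ) + 2 / (1 / 9) = 19 by norm_num] at hS
  refine le_trans (measure_mono ?_) (measure_biUnion_finset_le_card_mul _ S (fun v =>
    {ω | Alive ω x ∧ 4.1 * r < sqNorm (A ω *ᵥ v)} ∪ {ω | Alive ω x ∧ sqNorm (A ω *ᵥ v) < b * r})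
    hS (by positivity) fun v hv => ?_)
  · rintro ω ⟨hal, hω⟩
    by_contra hcon
    simp only [Set.mem_iUnion, not_exists, Set.mem_union, Set.mem_ofPred_eq, not_or, not_and,
      not_lt] at hcon
    have hup : ∀ u, sqNorm (A ω *ᵥ u) ≤ 4.15125 * r * sqNorm u := by
      intro u
      have := sqNorm_mulVec_le_of_net (A ω) (ε := 1 / 9) (by norm_num) hS1 hS2
        (fun v hv => (hcon v hv).1 hal) (u := u) (fun a ha => absurd (Finset.mem_univ a) ha)
      refine this.trans (le_of_eq ?_)
      ring
    refine hω fun u => ⟨?_, hup u⟩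
    have := le_sqNorm_mulVec_of_net (A ω) (ε := 1 / 9) hS1 hS2
        (fun v hv => (hcon v hv).2 hal) (fun u _ => hup u) (by positivity) (u := u)
        (fun a ha => absurd (Finset.mem_univ a) ha)
    refine le_trans (le_of_eq ?_) this
    ring
  · have h1 := (hA v (hS1 v hv).2).upper hL hm hN
    have h2 := (hA v (hS1 v hv).2).lower hN (by linarith) hb1.le hγ hf hE
    refine (measure_union_le _ _).trans ((add_le_add h1 h2).trans ?_)
    rw [← ENNReal.ofReal_add (by positivity) (by positivity)]
    refine ENNReal.ofReal_le_ofReal ?_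
    have : Real.exp (-(m / (8 * L))) ≤ Real.exp (2 * √(m : ℝ) - m / (8 * L)) := by
      rw [Real.exp_le_exp]; linarith [Real.sqrt_nonneg (m : ℝ)]
    linarith

end Frames

/-! ### Operator norms of partial products by coordinate blocks. -/

section Blocks

variable {L m dx dy : ℕ}

/-- The `j`-th block of `s` consecutive coordinates. -/
def block (m s j : ℕ) : Finset (Fin m) := Finset.univ.filter fun a => (a : ℕ) / s = j

lemma card_block_le {s : ℕ} (hs : 0 < s) (j : ℕ) : (block m s j).card ≤ s := by
  refine (Finset.card_le_card_of_injOn (s := block m s j) (t := Finset.range s) (fun a => (a : ℕ) % s)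
    (fun a _ => by simpa using Nat.mod_lt _ hs) fun a ha b hb hab => ?_).trans_eq
    (Finset.card_range s)
  simp only [block, Finset.coe_filter, Finset.mem_univ, true_and, Set.mem_ofPred_eq] at ha hb
  have h1 := Nat.div_add_mod (a : ℕ) s
  have h2 := Nat.div_add_mod (b : ℕ) s
  dsimp only at hab
  rw [ha, hab] at h1
  rw [hb] at h2
  exact Fin.ext (h1.symm.trans h2)

/-- Split `u` into its orthogonal block parts; Cauchy–Schwarz over the blocks costs the square root
of their number. -/
lemma opBound_of_blocks {p s : ℕ} (A : Matrix (Fin p) (Fin m) ℝ) {c : ℝ} (hc : 0 ≤ c)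
    (h : ∀ j ∈ Finset.range (m / s + 1), ∀ u, SuppIn (block m s j) u →
      sqNorm (A *ᵥ u) ≤ c * sqNorm u) : OpBound A √(((m / s + 1 : ℕ) : ℝ) * c) := by
  refine ⟨Real.sqrt_nonneg _, fun u => ?_⟩
  set R := Finset.range (m / s + 1)
  let U : ℕ → Fin m → ℝ := fun j a => if (a : ℕ) / s = j then u a else 0
  have hmem : ∀ a : Fin m, (a : ℕ) / s ∈ R := fun a =>
    Finset.mem_range.2 (Nat.lt_succ_of_le (Nat.div_le_div_right a.2.le))
  have hU : u = ∑ j ∈ R, U j := by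
    funext a
    rw [Finset.sum_apply, Finset.sum_ite_eq, if_pos (hmem a)]
  have hsq : ∑ j ∈ R, sqNorm (U j) = sqNorm u := by
    simp only [sqNorm]
    rw [Finset.sum_comm]
    refine Finset.sum_congr rfl fun a _ => ?_
    simp only [U, ite_pow, ne_eq, OfNat.ofNat_ne_zero, not_false_eq_true, zero_pow]
    rw [Finset.sum_ite_eq, if_pos (hmem a)]
  have h1 : √(sqNorm (A *ᵥ u)) ≤ √c * ∑ j ∈ R, √(sqNorm (U j)) := by
    calc √(sqNorm (A *ᵥ u)) = √(sqNorm (∑ j ∈ R, A *ᵥ U j)) := by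
          nth_rewrite 1 [hU]; rw [mulVec_sum]
      _ ≤ ∑ j ∈ R, √(sqNorm (A *ᵥ U j)) := sqrt_sqNorm_sum_le _ _
      _ ≤ ∑ j ∈ R, √c * √(sqNorm (U j)) := by
          refine Finset.sum_le_sum fun j hj => ?_
          rw [← Real.sqrt_mul hc]
          refine Real.sqrt_le_sqrt (h j hj _ fun a ha => ?_)
          have : ¬ (a : ℕ) / s = j := by simpa [block] using ha
          simp [U, this]
      _ = _ := by rw [Finset.mul_sum]
  have h2 : ∑ j ∈ R, √(sqNorm (U j)) ≤ √((m / s + 1 : ℕ) : ℝ) * √(sqNorm u) := by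
    rw [← Real.sqrt_mul (by positivity)]
    refine Real.le_sqrt_of_sq_le ?_
    have := sq_sum_le_card_mul_sum_sq (s := R) (f := fun j => √(sqNorm (U j)))
    simp only [Real.sq_sqrt (sqNorm_nonneg _)] at this
    rwa [hsq, Finset.card_range] at this
  calc √(sqNorm (A *ᵥ u)) ≤ √c * (√((m / s + 1 : ℕ) : ℝ) * √(sqNorm u)) :=
        h1.trans (by gcongr)
    _ = _ := by rw [Real.sqrt_mul (by positivity)]; ring

/-- A `1/2`-net of a block has at most `5^s` points and costs the factor `4/3 = 1/(1 - 1/4)`. -/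
lemma initLaw_subM_not_opBound_le (hL : 2 ≤ L) (hm : 0 < m) (hd : 0 < dx) {θ : ℝ} (hθ : 0 < θ)
    (hθ1 : θ < 1 / 2) {x : Fin dx → ℝ} (hx : x ≠ 0) {s : ℕ} (hs : 0 < s) (a k : Fin (L + 1)) :
    initLaw L m dx dy {ω | Alive ω x ∧ ¬ OpBound (subM (act ω.Ψ ω.C x) ω.W₁ a k)
        √(((m / s + 1 : ℕ) : ℝ) * (4 / 3 * Real.exp (4 * θ + 2 / 3)))} ≤
      ENNReal.ofReal ((m / s + 1 : ℕ) * (5 ^ s * Real.exp (-(16 / 15 * θ * m / L)))) := by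
  obtain ⟨p, γ, hp, hγ, hf, hE⟩ := exists_block_test hL hm hθ hθ1
  have hnet := fun j => exists_net (block m s j) (ε := 1 / 2) (by norm_num)
  choose S hS hS1 hS2 using hnet
  refine le_trans (measure_mono ?_) (measure_biUnion_finset_le_card_mul _
    (Finset.range (m / s + 1)) (fun j => ⋃ v ∈ S j, {ω | Alive ω x ∧ Real.exp (4 * θ + 2 / 3) <
      sqNorm (subM (act ω.Ψ ω.C x) ω.W₁ a k *ᵥ v)}) (by simp) (by positivity) fun j hj =>
      measure_biUnion_finset_le_card_mul _ _ _ (c := 5 ^ s) ?_ (by positivity) fun v hv => ?_)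
  · rintro ω ⟨hal, hω⟩
    by_contra hcon
    simp only [Set.mem_iUnion, not_exists, Set.mem_ofPred_eq, not_and, not_lt] at hcon
    refine hω (opBound_of_blocks _ (by positivity) fun j hj u hu => ?_)
    have := sqNorm_mulVec_le_of_net (subM (act ω.Ψ ω.C x) ω.W₁ a k) (ε := 1 / 2) (by norm_num)
      (hS1 j) (hS2 j) (fun v hv => hcon j hj v hv hal) hu
    refine this.trans (le_of_eq ?_)
    ring
  · refine (hS j).trans ?_
    rw [show (1 : ℝ) + 2 / (1 / 2) = 5 by norm_num]
    exact pow_le_pow_right₀ (by norm_num) (card_block_le hs j)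
  · have ht : 0 < Real.exp (4 * θ + 2 / 3) ^ p := by positivity
    refine (measure_mono fun ω hω => ?_).trans ((initLaw_subM_le (dy := dy) hm hd hγ hf ht
      (fun y hy z _ hyz => ENNReal.ofReal_le_ofReal (Real.rpow_le_rpow hy hyz hp)) (by simp) hx
      (hS1 j v hv).2 a k).trans (ENNReal.ofReal_le_ofReal ?_))
    · exact ⟨hω.1, ENNReal.ofReal_le_ofReal (Real.rpow_le_rpow (by positivity) hω.2.le hp)⟩
    · rw [div_le_iff₀ ht]
      exact (pow_le_pow_right₀ hγ (Nat.lt_succ_iff.1 k.2)).trans hE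

end Blocks


/-! ### From good initializations to spectra at nearby weights. -/

section Deterministic

variable {L m dx dy : ℕ} {D : Fin (L + 1) → Matrix (Fin m) (Fin m) ℝ}
  {C : Matrix (Fin m) (Fin dx) ℝ} {B : Matrix (Fin dy) (Fin m) ℝ} {W W' : Layers L m}
  {A τ δ b r α : ℝ}

/-- The decimals satisfy `0.2887² > 1/12` and `2.59² < 27/4`. -/
lemma spectrumWithin_of_sqrt {p d : ℕ} {A : Matrix (Fin p) (Fin d) ℝ} {r α β : ℝ} (hr : 0 ≤ r)
    (hα : 0.2887 ≤ α) (hβ : β ≤ 2.59) (h : ∀ u, α * √(r * sqNorm u) ≤ √(sqNorm (A *ᵥ u)) ∧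
      √(sqNorm (A *ᵥ u)) ≤ β * √(r * sqNorm u)) :
    SpectrumWithin (Aᵀ * A) (r / 12) (27 / 4 * r) := by
  refine spectrumWithin_of_sqNorm (by positivity) fun u => ?_
  have hu := sqNorm_nonneg u
  have hru : 0 ≤ r * sqNorm u := by positivity
  obtain ⟨h1, h2⟩ := h u
  have e1 := Real.sq_sqrt hru
  have e2 := Real.sq_sqrt (sqNorm_nonneg (A *ᵥ u))
  set y := √(r * sqNorm u)
  have hy : 0 ≤ y := Real.sqrt_nonneg _
  have h3 : 0.2887 * y ≤ √(sqNorm (A *ᵥ u)) := (mul_le_mul_of_nonneg_right hα hy).trans h1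
  have h4 : √(sqNorm (A *ᵥ u)) ≤ 2.59 * y := h2.trans (mul_le_mul_of_nonneg_right hβ hy)
  have h5 := pow_le_pow_left₀ (by positivity) h3 2
  have h6 := pow_le_pow_left₀ (Real.sqrt_nonneg _) h4 2
  rw [e2, mul_pow, e1] at h5 h6
  constructor <;> linarith

lemma Frame.sqrt_bounds {p d : ℕ} {A : Matrix (Fin p) (Fin d) ℝ} (hr : 0 ≤ r)
    (hαb : α ^ 2 ≤ b - 0.05125) (h : Frame A ((b - 0.05125) * r) (4.15125 * r)) (u : Fin d → ℝ) :
    α * √(r * sqNorm u) ≤ √(sqNorm (A *ᵥ u)) ∧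
      √(sqNorm (A *ᵥ u)) ≤ 2.0375 * √(r * sqNorm u) := by
  have hu := sqNorm_nonneg u
  have hru : 0 ≤ r * sqNorm u := by positivity
  obtain ⟨h1, h2⟩ := h u
  constructor
  · refine Real.le_sqrt_of_sq_le ?_
    rw [mul_pow, Real.sq_sqrt hru]
    nlinarith
  · rw [Real.sqrt_le_left (by positivity), mul_pow, Real.sq_sqrt hru]
    nlinarith

lemma spectrumWithin_subG (hA : 0 ≤ A)
    (hM : ∀ j k, (j, k) ≠ (0, Fin.last L) → OpBound (subM D W j k) A)
    (hτ : 0 ≤ τ) (hW : ∀ k, specNorm (W' k - W k) ≤ τ) (hδ : L * (A * τ) ≤ δ) (hδ1 : δ ≤ 1 / 36)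
    (hr : 0 ≤ r) (hαb : α ^ 2 ≤ b - 0.05125)
    (hαδ : 0.2887 ≤ α - δ / (1 - δ) * 2.0375)
    (h : ∀ k, Frame (subG D C W k) ((b - 0.05125) * r) (4.15125 * r)) (k : Fin (L + 1)) :
    SpectrumWithin ((subG D C W' k)ᵀ * subG D C W' k) (r / 12) (27 / 4 * r) := by
  have hδ' : δ / (1 - δ) ≤ 1 / 35 := by rw [div_le_iff₀ (by linarith)]; linarith
  refine spectrumWithin_of_sqrt (α := α - δ / (1 - δ) * 2.0375)
    (β := 2.0375 + δ / (1 - δ) * 2.0375) hr hαδ (by linarith) fun u => ?_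
  have h1 := fun k => (h k).sqrt_bounds hr hαb u
  have h2 := subG_near hA hM hτ hW hδ (by linarith) u (fun k => (h1 k).2) k
  have h3 := h1 k
  constructor <;> linarith

lemma spectrumWithin_subF (hA : 0 ≤ A)
    (hM : ∀ j k, (j, k) ≠ (0, Fin.last L) → OpBound (subM D W j k) A)
    (hτ : 0 ≤ τ) (hW : ∀ k, specNorm (W' k - W k) ≤ τ) (hδ : L * (A * τ) ≤ δ) (hδ1 : δ ≤ 1 / 36)
    (hr : 0 ≤ r) (hαb : α ^ 2 ≤ b - 0.05125)
    (hαδ : 0.2887 ≤ α - δ / (1 - δ) * 2.0375)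
    (h : ∀ k, Frame (subF D B W k)ᵀ ((b - 0.05125) * r) (4.15125 * r)) (k : Fin (L + 1)) :
    SpectrumWithin (subF D B W' k * (subF D B W' k)ᵀ) (r / 12) (27 / 4 * r) := by
  have hδ' : δ / (1 - δ) ≤ 1 / 35 := by rw [div_le_iff₀ (by linarith)]; linarith
  have key := spectrumWithin_of_sqrt (A := (subF D B W' k)ᵀ) (α := α - δ / (1 - δ) * 2.0375)
    (β := 2.0375 + δ / (1 - δ) * 2.0375) hr hαδ (by linarith) fun u => ?_
  · rwa [transpose_transpose] at key
  have h1 := fun k => (h k).sqrt_bounds hr hαb u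
  have h2 := subF_near hA hM hτ hW hδ (by linarith) u (fun k => (h1 k).2) k
  have h3 := h1 k
  constructor <;> linarith

lemma opBound_patMat (S : Fin m → Bool) : OpBound (patMat S) 1 :=
  ⟨zero_le_one, fun u => by rw [one_mul]; exact Real.sqrt_le_sqrt (sqNorm_patMat_le S u)⟩

lemma opBound_subM_one_layer {D : Fin (1 + 1) → Matrix (Fin m) (Fin m) ℝ} {W : Layers 1 m}
    (hD : ∀ k, OpBound (D k) 1) (j k : Fin (1 + 1)) (h : (j, k) ≠ (0, Fin.last 1)) :
    OpBound (subM D W j k) 1 := by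
  rcases lt_trichotomy k j with hk | rfl | hk
  · rw [subM_of_lt D W hk]
    exact ⟨zero_le_one, fun u => by simp [sqNorm]⟩
  · rw [subM_self]; exact hD _
  · refine absurd ?_ h
    rw [Prod.mk.injEq]
    constructor <;> ext <;> simp <;> omega

/-- The factor in front of `L τ` in the smallness hypothesis. -/
noncomputable def gain (L : ℕ) (θ : ℝ) : ℝ := 3 * √(12 * L) * Real.exp (2 * θ) * θ ^ (-(1 / 2) : ℝ)

lemma gain_sq {θ : ℝ} (hθ : 0 < θ) : gain L θ ^ 2 = 108 * L * Real.exp (4 * θ) / θ := by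
  have h1 : (θ ^ (-(1 / 2) : ℝ)) ^ 2 = θ⁻¹ := by
    rw [← Real.rpow_natCast, ← Real.rpow_mul hθ.le, ← Real.rpow_neg_one]
    norm_num
  have h2 : Real.exp (2 * θ) ^ 2 = Real.exp (4 * θ) := by
    rw [← Real.exp_nat_mul]; congr 1; push_cast; ring
  rw [gain, mul_pow, mul_pow, mul_pow, h1, h2, Real.sq_sqrt (by positivity)]
  ring

lemma gain_nonneg {θ : ℝ} (hθ : 0 < θ) : 0 ≤ gain L θ := by unfold gain; positivity

lemma le_gain {θ : ℝ} (hL : 1 ≤ L) (hθ : 0 < θ) (hθ1 : θ < 1 / 2) : 25 ≤ gain L θ := by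
  refine (sq_le_sq₀ (by norm_num) (gain_nonneg hθ)).1 ?_
  have hL' : (1 : ℝ) ≤ L := by exact_mod_cast hL
  rw [gain_sq hθ, le_div_iff₀ hθ]
  have h1 : 4 * θ + 1 ≤ Real.exp (4 * θ) := Real.add_one_le_exp _
  calc (25 : ℝ) ^ 2 * θ ≤ 108 * (4 * θ + 1) := by linarith
    _ ≤ 108 * Real.exp (4 * θ) := by gcongr
    _ ≤ 108 * L * Real.exp (4 * θ) := by nlinarith [Real.exp_pos (4 * θ)]

/-- Size of the coordinate blocks. -/
noncomputable def blockSize (L m : ℕ) (θ : ℝ) : ℕ := ⌊θ * m / (2 * L)⌋₊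

variable {θ : ℝ}

/-- The floor is harmless because its argument is at least `576`, and the extra block is absorbed by
`L/θ ≥ 4`. -/
lemma blockSize_bounds (hL : 2 ≤ L) (hθ : 0 < θ) (hθ1 : θ < 1 / 2)
    (hz : 576 ≤ θ * m / (2 * L)) : 0 < blockSize L m θ ∧
      (blockSize L m θ : ℝ) ≤ θ * m / (2 * L) ∧
      ((m / blockSize L m θ + 1 : ℕ) : ℝ) ≤ 2.3 * (L / θ) := by
  have hL' : (2 : ℝ) ≤ L := by exact_mod_cast hL
  set z := θ * m / (2 * L) with hz'
  have h1 : z - 1 < blockSize L m θ := Nat.sub_one_lt_floor z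
  have h2 : (blockSize L m θ : ℝ) ≤ z := Nat.floor_le (by linarith)
  have hs : (0 : ℝ) < blockSize L m θ := by linarith
  refine ⟨by exact_mod_cast hs, h2, ?_⟩
  have hm : (m : ℝ) = 2 * z * (L / θ) := by rw [hz']; field_simp
  have hq : 4 ≤ (L : ℝ) / θ := by rw [le_div_iff₀ hθ]; linarith
  have h3 : ((m / blockSize L m θ : ℕ) : ℝ) ≤ m / blockSize L m θ := Nat.cast_div_le
  have h4 : (m : ℝ) / blockSize L m θ ≤ 2.01 * (L / θ) := by
    rw [div_le_iff₀ hs, hm]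
    nlinarith
  push_cast
  linarith

/-- Bound for the norms of the partial products. -/
noncomputable def prodBound (L m : ℕ) (θ : ℝ) : ℝ :=
  √(((m / blockSize L m θ + 1 : ℕ) : ℝ) * (4 / 3 * Real.exp (4 * θ + 2 / 3)))

lemma exp_two_thirds_le : Real.exp (2 / 3) ≤ 2 := by
  refine le_of_pow_le_pow_left₀ three_ne_zero zero_le_two ?_
  rw [← Real.exp_nat_mul]
  have h := Real.exp_one_lt_d9
  have e : Real.exp (((3 : ℕ) : ℝ) * (2 / 3)) = Real.exp 1 * Real.exp 1 := by
    rw [← Real.exp_add]; norm_num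
  rw [e]
  nlinarith [Real.exp_pos 1]

lemma prodBound_le (hL : 2 ≤ L) (hθ : 0 < θ) (hθ1 : θ < 1 / 2)
    (hz : 576 ≤ θ * m / (2 * L)) : prodBound L m θ ≤ gain L θ / 4 := by
  have hg := gain_nonneg (L := L) hθ
  refine Real.sqrt_le_iff.2 ⟨by positivity, ?_⟩
  rw [div_pow, gain_sq hθ, Real.exp_add]
  obtain ⟨-, -, h⟩ := blockSize_bounds hL hθ hθ1 hz
  have hLθ : 0 ≤ (L : ℝ) / θ := by positivity
  calc _ ≤ 2.3 * (L / θ) * (4 / 3 * (Real.exp (4 * θ) * 2)) := by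
        gcongr
        exact exp_two_thirds_le
    _ = 2.3 * (8 / 3) * (L / θ * Real.exp (4 * θ)) := by ring
    _ ≤ 108 / 16 * (L / θ * Real.exp (4 * θ)) := by gcongr; norm_num
    _ = _ := by ring

/-- The properties of the initialization from which the theorem follows. -/
structure Good (b A : ℝ) (ω : Init L m dx dy) (x : Fin dx → ℝ) : Prop where
  frameG : ∀ k, Frame (matG ω x ω.W₁ k) ((b - 0.05125) * (m / dx)) (4.15125 * (m / dx))
  frameF : ∀ k, Frame (matF ω x ω.W₁ k)ᵀ ((b - 0.05125) * (m / dy)) (4.15125 * (m / dy))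
  opBound : 2 ≤ L → ∀ a k, OpBound (subM (act ω.Ψ ω.C x) ω.W₁ a k) A

lemma Good.spectrumWithin (hL : 1 ≤ L) (hθ : 0 < θ) (hθ1 : θ < 1 / 2)
    (hz : 576 ≤ θ * m / (2 * L)) (hb : 1 / 7 ≤ b) (hb2 : 2 ≤ L → 2 / 11 ≤ b)
    {ω : Init L m dx dy} {x : Fin dx → ℝ} (h : Good b (prodBound L m θ) ω x) {W' : Layers L m}
    (hτ : 0 ≤ τ) (hW : ∀ k, specNorm (W' k - ω.W₁ k) ≤ τ) (hτL : L * τ * gain L θ ≤ 1 / 9)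
    (k : Fin (L + 1)) :
    SpectrumWithin ((matG ω x W' k)ᵀ * matG ω x W' k) (m / dx / 12) (27 / 4 * (m / dx)) ∧
      SpectrumWithin (matF ω x W' k * (matF ω x W' k)ᵀ) (m / dy / 12) (27 / 4 * (m / dy)) := by
  have hLτ : 0 ≤ L * τ := by positivity
  obtain ⟨A, δ, α, hA, hM, hδ, hδ1, hαb, hαδ⟩ : ∃ A δ α : ℝ, 0 ≤ A ∧
      (∀ j k, (j, k) ≠ (0, Fin.last L) → OpBound (subM (act ω.Ψ ω.C x) ω.W₁ j k) A) ∧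
      L * (A * τ) ≤ δ ∧ δ ≤ 1 / 36 ∧ α ^ 2 ≤ b - 0.05125 ∧
      0.2887 ≤ α - δ / (1 - δ) * 2.0375 := by
    rcases hL.eq_or_lt with h1 | h2
    · have hg := le_gain hL hθ hθ1
      -- For `L = 1` the relevant products have norm at most `1`, and `gain ≥ 25` gives `τ ≤ 1/225`;
      -- `0.302² ≤ 1/7 - 0.05125`.
      refine ⟨1, 1 / 225, 0.302, zero_le_one, ?_, ?_, by norm_num, by linarith, by norm_num⟩
      · subst h1
        refine opBound_subM_one_layer fun k => ?_
        rw [act_eq_patMats]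
        exact opBound_patMat _
      · nlinarith
    · have hg := prodBound_le h2 hθ hθ1 hz
      have := hb2 h2
      -- `prodBound ≤ gain/4` turns the hypothesis `1/9` into `1/36`; `0.36² ≤ 2/11 - 0.05125`.
      refine ⟨prodBound L m θ, 1 / 36, 0.36, Real.sqrt_nonneg _, fun j k _ => h.opBound h2 j k,
        ?_, le_rfl, by linarith, by norm_num⟩
      have := mul_le_mul_of_nonneg_left hg hLτ
      linarith
  exact ⟨spectrumWithin_subG hA hM hτ hW hδ hδ1 (by positivity) hαb hαδ h.frameG k,
    spectrumWithin_subF hA hM hτ hW hδ hδ1 (by positivity) hαb hαδ h.frameF k⟩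

end Deterministic

/-! ### Summing the failure probabilities. -/

section Probability

variable {L m dx dy : ℕ} {θ : ℝ}

/-- The net costs at most `1.62 z` in the exponent, with `z = θm/(2L)`; of the available `32z/15`
more than `z/2` remains. -/
lemma exp_block_le (hL : 2 ≤ L) (hθ : 0 < θ) (hθ1 : θ < 1 / 2) (hz : 576 ≤ θ * m / (2 * L)) :
    5 ^ blockSize L m θ * Real.exp (-(16 / 15 * θ * m / L)) ≤ Real.exp (-(θ * m / (4 * L))) := by
  obtain ⟨-, h, -⟩ := blockSize_bounds hL hθ hθ1 hz
  have hL' : (2 : ℝ) ≤ L := by exact_mod_cast hL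
  set z := θ * m / (2 * L) with hz'
  have e1 : 16 / 15 * θ * m / L = 32 / 15 * z := by rw [hz']; field_simp; ring
  have e2 : θ * m / (4 * L) = z / 2 := by rw [hz']; field_simp; ring
  rw [e1, e2, ← Real.rpow_natCast, Real.rpow_def_of_pos (by norm_num), ← Real.exp_add,
    Real.exp_le_exp]
  have h5 := log_five_le
  have : Real.log 5 * blockSize L m θ ≤ 1.62 * z :=
    mul_le_mul h5 h (Nat.cast_nonneg' _) (by norm_num)
  linarith

lemma exists_initLaw_not_good_le (hL : 1 ≤ L) (hd : 0 < dx) (hθ : 0 < θ) (hθ1 : θ < 1 / 2)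
    (hs : 48 * L < √(m : ℝ)) (hz : 576 ≤ θ * m / (2 * L)) : ∃ b : ℝ,
    1 / 7 ≤ b ∧ (2 ≤ L → 2 / 11 ≤ b) ∧ ∀ x : Fin dx → ℝ, x ≠ 0 →
      initLaw L m dx dy {ω | ¬ Good b (prodBound L m θ) ω x} ≤
        ENNReal.ofReal ((L + 1) * (1 / 2) ^ m + (L + 1) * (4 * 19 ^ max dx dy *
          Real.exp (2 * √m - m / (8 * L))) +
          (L + 1) ^ 2 * (2.3 * (L / θ) * Real.exp (-(θ * m / (4 * L))))) := by
  obtain ⟨b, hb, hb2, hframe⟩ := exists_initLaw_frame_le (dx := dx) (dy := dy) hL hs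
  have hm : 0 < m := by
    rcases Nat.eq_zero_or_pos m with rfl | h
    · simp at hs; linarith [Nat.cast_nonneg' (α := ℝ) L]
    · exact h
  refine ⟨b, hb, hb2, fun x hx => ?_⟩
  set A := prodBound L m θ with hA
  set ε₂ : ℝ := 2 * Real.exp (2 * √(m : ℝ) - m / (8 * L)) with hε₂
  have hpow : ∀ d, d ≤ max dx dy → (19 : ℝ) ^ d * ε₂ ≤ 19 ^ max dx dy * ε₂ := fun d hd => by
    have : (19 : ℝ) ^ d ≤ 19 ^ max dx dy := pow_le_pow_right₀ (by norm_num) hd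
    gcongr
  have h1 : initLaw L m dx dy {ω | ¬ Alive ω x} ≤ ENNReal.ofReal ((L + 1) * (1 / 2) ^ m) := by
    refine (initLaw_not_alive_le hm hd hx).trans (le_of_eq ?_)
    rw [ENNReal.ofReal_mul (by positivity), ENNReal.ofReal_pow (by norm_num), one_div,
      ENNReal.ofReal_inv_of_pos two_pos, ENNReal.ofReal_ofNat]
    congr 1
    exact_mod_cast (ENNReal.ofReal_natCast (L + 1)).symm
  have h2 := measure_biUnion_finset_le_card_mul (initLaw L m dx dy) Finset.univ
    (fun k : Fin (L + 1) => {ω | Alive ω x ∧ ¬ Frame (matG ω x ω.W₁ k) ((b - 0.05125) * (m / dx))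
      (4.15125 * (m / dx))} ∪ {ω | Alive ω x ∧ ¬ Frame (matF ω x ω.W₁ k)ᵀ
        ((b - 0.05125) * (m / dy)) (4.15125 * (m / dy))}) (c := L + 1)
    (ε := 19 ^ max dx dy * ε₂ + 19 ^ max dx dy * ε₂) (by simp) (by positivity) fun k _ => by
      rw [ENNReal.ofReal_add (by positivity) (by positivity)]
      refine (measure_union_le _ _).trans (add_le_add ?_ ?_)
      · refine (hframe (fun ω => matG ω x ω.W₁ k) (by positivity) (N := k + 1) (by omega)
          fun u hu => isChain_matG hm hd hx k hu).trans (ENNReal.ofReal_le_ofReal ?_)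
        exact hpow _ (le_max_left _ _)
      · refine (hframe (fun ω => (matF ω x ω.W₁ k)ᵀ) (by positivity) (N := L - k + 1) (by omega)
          fun u hu => isChain_matF hm hd hx k hu).trans (ENNReal.ofReal_le_ofReal ?_)
        exact hpow _ (le_max_right _ _)
  have h3 := measure_biUnion_finset_le_card_mul (initLaw L m dx dy) Finset.univ
    (fun q : Fin (L + 1) × Fin (L + 1) => {ω | 2 ≤ L ∧ Alive ω x ∧
      ¬ OpBound (subM (act ω.Ψ ω.C x) ω.W₁ q.1 q.2) A}) (c := (L + 1) ^ 2)
    (ε := 2.3 * (L / θ) * Real.exp (-(θ * m / (4 * L)))) (by simp [pow_two]) (by positivity)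
    fun q _ => by
      by_cases hL2 : 2 ≤ L
      · simp only [hL2, true_and]
        obtain ⟨hs0, -, hnb⟩ := blockSize_bounds hL2 hθ hθ1 hz
        refine (initLaw_subM_not_opBound_le hL2 hm hd hθ hθ1 hx hs0 q.1 q.2).trans
          (ENNReal.ofReal_le_ofReal ?_)
        exact mul_le_mul hnb (exp_block_le hL2 hθ hθ1 hz) (by positivity) (by positivity)
      · simp [hL2]
  have hsub : {ω : Init L m dx dy | ¬ Good b A ω x} ⊆ ({ω | ¬ Alive ω x} ∪
      ⋃ k ∈ (Finset.univ : Finset (Fin (L + 1))), ({ω | Alive ω x ∧ ¬ Frame (matG ω x ω.W₁ k)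
        ((b - 0.05125) * (m / dx)) (4.15125 * (m / dx))} ∪ {ω | Alive ω x ∧
        ¬ Frame (matF ω x ω.W₁ k)ᵀ ((b - 0.05125) * (m / dy)) (4.15125 * (m / dy))})) ∪
      ⋃ q ∈ (Finset.univ : Finset (Fin (L + 1) × Fin (L + 1))), {ω | 2 ≤ L ∧ Alive ω x ∧
        ¬ OpBound (subM (act ω.Ψ ω.C x) ω.W₁ q.1 q.2) A} := by
    intro ω hω
    by_contra hcon
    simp only [Set.mem_union, Set.mem_iUnion, Set.mem_ofPred_eq, Finset.mem_univ, true_and,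
      exists_prop, not_or, not_exists, not_and, not_not] at hcon
    obtain ⟨⟨hal, hfr⟩, hop⟩ := hcon
    exact hω ⟨fun k => (hfr k).1 hal, fun k => (hfr k).2 hal, fun hL2 a k => hop (a, k) hL2 hal⟩
  refine (measure_mono hsub).trans ((measure_union_le _ _).trans
    ((add_le_add ((measure_union_le _ _).trans (add_le_add h1 h2)) h3).trans (le_of_eq ?_)))
  rw [← ENNReal.ofReal_add (by positivity) (by positivity),
    ← ENNReal.ofReal_add (by positivity) (by positivity), hε₂]
  congr 1
  ring

lemma failure_sum_le {n N : ℕ} (hL : 1 ≤ L) (hn : n ≤ m) (hθ : 0 < θ) (hθ1 : θ < 1 / 2)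
    (hs : 24 * (L / θ) < √(m : ℝ)) :
    n * ((L + 1) * (1 / 2) ^ m + (L + 1) * (4 * 19 ^ N * Real.exp (2 * √m - m / (8 * L))) +
      (L + 1) ^ 2 * (2.3 * (L / θ) * Real.exp (-(θ * m / (4 * L))))) ≤
    3 * (L : ℝ) ^ 2 * √m * Real.exp (-(θ * m / (4 * L)) + 6 * √m + 3 * N) := by
  have hL' : (1 : ℝ) ≤ L := by exact_mod_cast hL
  set s : ℝ := √m with hs'
  have hss : s * s = m := Real.mul_self_sqrt (Nat.cast_nonneg' m)
  have hLθ : 2 ≤ (L : ℝ) / θ := by rw [le_div_iff₀ hθ]; linarith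
  set e := Real.exp (-(θ * m / (4 * L))) with he
  set E := Real.exp s with hE
  have hEs : s + 1 ≤ E := Real.add_one_le_exp s
  have he0 : 0 < e := Real.exp_pos _
  have hθL : θ * m / (4 * L) ≤ m / (8 * L) := by
    rw [div_le_div_iff₀ (by positivity) (by positivity)]
    have : 0 ≤ (m : ℝ) * L := by positivity
    nlinarith
  have h1 : (1 / 2 : ℝ) ^ m ≤ e := by
    rw [← Real.rpow_natCast, Real.rpow_def_of_pos (by norm_num), one_div, Real.log_inv, he,
      Real.exp_le_exp]
    have h2 := Real.log_two_gt_d9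
    have h3 : (m : ℝ) / (8 * L) ≤ m / 8 := by
      gcongr
      linarith
    have : 0 ≤ (m : ℝ) := Nat.cast_nonneg' m
    nlinarith
  have h2 : Real.exp (2 * s - m / (8 * L)) ≤ E ^ 2 * e := by
    rw [hE, he, ← Real.exp_nat_mul, ← Real.exp_add, Real.exp_le_exp]
    push_cast
    linarith
  have h3 : (19 : ℝ) ^ N ≤ Real.exp (3 * N) := by
    rw [mul_comm, Real.exp_nat_mul]
    gcongr
    have := Real.exp_one_gt_d9
    have e3 : Real.exp 3 = Real.exp 1 ^ 3 := by rw [← Real.exp_nat_mul]; norm_num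
    rw [e3]
    exact le_trans (by norm_num) (pow_le_pow_left₀ (by norm_num) this.le 3)
  have h4 : Real.exp (-(θ * m / (4 * L)) + 6 * s + 3 * N) = e * E ^ 6 * Real.exp (3 * N) := by
    rw [hE, he, ← Real.exp_nat_mul, ← Real.exp_add, ← Real.exp_add]; push_cast; rfl
  set X := Real.exp (3 * N) with hX
  have hX1 : 1 ≤ X := Real.one_le_exp (by positivity)
  have hL1 : (L : ℝ) + 1 ≤ 2 * L ^ 2 := by nlinarith
  have hL2 : ((L : ℝ) + 1) ^ 2 ≤ 4 * L ^ 2 := by nlinarith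
  have hE0 : 48 ≤ E := by linarith
  have hs0 : 0 < s := by linarith
  have hn' : (n : ℝ) ≤ s * s := by rw [hss]; exact_mod_cast hn
  rw [h4]
  have hXE : 1 ≤ X * E ^ 2 := one_le_mul_of_one_le_of_one_le hX1 (one_le_pow₀ (by linarith))
  have b1 : (1 / 2 : ℝ) ^ m ≤ e * (X * E ^ 2) := by nlinarith
  have b2 : 4 * 19 ^ N * Real.exp (2 * s - m / (8 * L)) ≤ 4 * (e * (X * E ^ 2)) := by
    calc _ ≤ 4 * X * (E ^ 2 * e) := by gcongr
      _ = _ := by ring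
  have b3 : 2.3 * (L / θ) * e ≤ e * (X * E ^ 2) := by
    have : 2.3 * (L / θ) ≤ X * E ^ 2 := by nlinarith
    nlinarith
  set Y := e * (X * E ^ 2) with hY
  have hY0 : 0 < Y := by positivity
  -- Of the `n ≤ m = s²` examples, one factor `s` is the `√m` of the bound; the other and the
  -- constant `14` go into the spare powers of `E = exp √m`.
  calc _ ≤ s * s * (2 * L ^ 2 * Y + 2 * L ^ 2 * (4 * Y) + 4 * L ^ 2 * Y) := by gcongr
    _ = 14 * L ^ 2 * s * Y * s := by ring
    _ ≤ 14 * L ^ 2 * s * Y * E := by gcongr; linarith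
    _ ≤ (3 * E ^ 3) * L ^ 2 * s * Y * E := by
        gcongr
        nlinarith [pow_le_pow_left₀ (by norm_num) hE0 3]
    _ = _ := by rw [hY]; ring

end Probability


/-! ### The training trajectory and the final union bound over examples. -/

variable {L m dx dy n : ℕ}

lemma weights_one (x : Fin n → Fin dx → ℝ) (Φ : Fin n → Matrix (Fin dy) (Fin dx) ℝ) (η : ℝ)
    (ω : Init L m dx dy) : weights x Φ η ω 1 = ω.W₁ := rfl

lemma specNorm_le_tau (x : Fin n → Fin dx → ℝ) (Φ : Fin n → Matrix (Fin dy) (Fin dx) ℝ) (η : ℝ)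
    {T : ℕ} (ω : Init L m dx dy) {t : ℕ} (ht : t ∈ Finset.Icc 1 T) (k : Fin L) :
    (specNorm (weights x Φ η ω t k - ω.W₁ k) : ℝ) ≤ tau x Φ η T ω := by
  rw [← weights_one x Φ η ω, NNReal.coe_le_coe]
  exact (Finset.le_sup (f := fun k => specNorm (weights x Φ η ω t k - weights x Φ η ω 1 k))
    (Finset.mem_univ k)).trans (Finset.le_sup (f := fun t => Finset.univ.sup fun k : Fin L =>
      specNorm (weights x Φ η ω t k - weights x Φ η ω 1 k)) ht)

end GReLU

theorem mainTheorem5 (L m dx dy n T : ℕ) (hL : 1 ≤ L) (hnm : n ≤ m)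
    (x : Fin n → Fin dx → ℝ) (hx : ∀ i, ∑ j, x i j ^ 2 = 1)
    (Φ : Fin n → Matrix (Fin dy) (Fin dx) ℝ) (η : ℝ)
    (θ : ℝ) (hθ₀ : 0 < θ) (hθ₁ : θ < 1 / 2) :
    1 - 3 * (L : ℝ) ^ 2 * √(m : ℝ) *
        Real.exp (-(θ * m / (4 * L)) + 6 * √(m : ℝ) + 3 * (max dx dy : ℕ)) ≤
      (GReLU.initLaw L m dx dy).real
        {ω | (L : ℝ) * GReLU.tau x Φ η T ω * 3 * √(12 * (L : ℝ)) *
              Real.exp (2 * θ) * θ ^ (-(1 / 2) : ℝ) ≤ 1 / 9 →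
            ∀ t ∈ Finset.Icc 1 T, ∀ (k : Fin (L + 1)) (i : Fin n),
              GReLU.SpectrumWithin
                ((GReLU.matG ω (x i) (GReLU.weights x Φ η ω t) k)ᵀ *
                  GReLU.matG ω (x i) (GReLU.weights x Φ η ω t) k)
                ((m : ℝ) / (12 * dx)) (27 * (m : ℝ) / (4 * dx)) ∧
              GReLU.SpectrumWithin
                (GReLU.matF ω (x i) (GReLU.weights x Φ η ω t) k *
                  (GReLU.matF ω (x i) (GReLU.weights x Φ η ω t) k)ᵀ)
                ((m : ℝ) / (12 * dy)) (27 * (m : ℝ) / (4 * dy))} := by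
  have hL' : (1 : ℝ) ≤ L := by exact_mod_cast hL
  rcases Nat.eq_zero_or_pos n with rfl | hn
  -- Without examples the event is everything; this case is separate because `m` and `dx` may then
  -- be zero.
  · have : ∀ S : Set (GReLU.Init L m dx dy), S = Set.univ → 1 - 3 * (L : ℝ) ^ 2 * √(m : ℝ) *
        Real.exp (-(θ * m / (4 * L)) + 6 * √(m : ℝ) + 3 * (max dx dy : ℕ)) ≤
        (GReLU.initLaw L m dx dy).real S := by
      rintro S rfl
      rw [probReal_univ]
      have : 0 ≤ 3 * (L : ℝ) ^ 2 * √(m : ℝ) *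
        Real.exp (-(θ * m / (4 * L)) + 6 * √(m : ℝ) + 3 * (max dx dy : ℕ)) := by positivity
      linarith
    exact this _ (Set.eq_univ_of_forall fun ω _ _ _ _ i => i.elim0)
  have hm : 0 < m := hn.trans_le hnm
  have hx0 : ∀ i, x i ≠ 0 := fun i h => by simpa [h] using hx i
  have hd : 0 < dx := by
    rcases Nat.eq_zero_or_pos dx with rfl | h
    · simpa using hx ⟨0, hn⟩
    · exact h
  have hs1 : 1 ≤ √(m : ℝ) := Real.one_le_sqrt.2 (by exact_mod_cast hm)
  have hss : √(m : ℝ) * √m = m := Real.mul_self_sqrt (Nat.cast_nonneg' m)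
  -- A nonnegative exponent makes the claimed probability nonpositive. Otherwise `6√m < θm/(4L)`,
  -- which provides all the largeness of `m` used below.
  by_cases hexp : 0 ≤ -(θ * m / (4 * L)) + 6 * √(m : ℝ) + 3 * (max dx dy : ℕ)
  · refine le_trans ?_ measureReal_nonneg
    have h1 := Real.one_le_exp hexp
    have h2 : 1 ≤ 3 * (L : ℝ) ^ 2 * √(m : ℝ) :=
      one_le_mul_of_one_le_of_one_le (by nlinarith) hs1
    have := one_le_mul_of_one_le_of_one_le h2 h1
    linarith
  have hbig : 6 * √(m : ℝ) < θ * m / (4 * L) := by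
    have : (0 : ℝ) ≤ 3 * (max dx dy : ℕ) := by positivity
    linarith
  have hs : 24 * (L / θ) < √(m : ℝ) := by
    rw [lt_div_iff₀ (by positivity)] at hbig
    rw [← mul_div_assoc, div_lt_iff₀ hθ₀]
    nlinarith
  have hs48 : 48 * L < √(m : ℝ) := by
    refine lt_trans ?_ hs
    rw [← mul_div_assoc, lt_div_iff₀ hθ₀]
    nlinarith
  have hz : 576 ≤ θ * m / (2 * L) := by
    have : θ * m / (2 * L) = 2 * (θ * m / (4 * L)) := by field_simp; ring
    rw [this]; linarith
  obtain ⟨b, hb, hb2, hbad⟩ :=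
    GReLU.exists_initLaw_not_good_le (dy := dy) hL hd hθ₀ hθ₁ hs48 hz
  set P := GReLU.initLaw L m dx dy
  have : IsProbabilityMeasure P := inferInstanceAs (IsProbabilityMeasure (GReLU.initLaw L m dx dy))
  have h1 := GReLU.measure_biUnion_finset_le_card_mul P Finset.univ
    (fun i : Fin n => {ω | ¬ GReLU.Good b (GReLU.prodBound L m θ) ω (x i)}) (c := n) (by simp)
    (by positivity) fun i _ => hbad (x i) (hx0 i)
  have h2 := (ENNReal.toReal_le_of_le_ofReal (by positivity) h1).trans
    (GReLU.failure_sum_le (N := max dx dy) hL hnm hθ₀ hθ₁ hs)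
  -- The whole space is covered by the event and the bad set, so subadditivity suffices and the
  -- event need not be measurable.
  refine sub_le_iff_le_add.2 (le_trans ?_ (add_le_add le_rfl h2))
  refine (probReal_univ (μ := P)).symm.trans_le
    (le_trans (measureReal_mono ?_) (measureReal_union_le _ _))
  intro ω _
  by_cases hω : ∀ i, GReLU.Good b (GReLU.prodBound L m θ) ω (x i)
  · refine Or.inl fun hτ t ht k i => ?_
    have h3 := (hω i).spectrumWithin hL hθ₀ hθ₁ hz hb hb2 (NNReal.coe_nonneg _)
      (GReLU.specNorm_le_tau x Φ η ω ht) (by rw [GReLU.gain]; linarith) k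
    have e : ∀ d : ℕ, (m : ℝ) / d / 12 = m / (12 * d) ∧ 27 / 4 * ((m : ℝ) / d) = 27 * m / (4 * d) :=
      fun d => ⟨by rw [div_div, mul_comm (d : ℝ)], by rw [div_mul_div_comm]⟩
    rwa [(e dx).1, (e dx).2, (e dy).1, (e dy).2] at h3
  · refine Or.inr ?_
    push Not at hω
    simpa using hω
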